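/- **Model.** An MPC consists of $M$ machines, each with a local space of $S$ words of $O(\log n)$ bits; the global space is $S\cdot M$. The computation is deterministic and proceeds in synchronous rounds. In a round, every machine performs an arbitrary local computation on its memory and on the messages received at the end of the previous round, and then sends messages to machines of its choice. On every machine, the memory, the messages sent in a round, the messages received in a round, and the output each fit into $S$ words. The input graph (vertices with identifiers $0,\dots,n-1$, and edges) is distributed arbitrarily among the machines, at most $S$ words on each; the programs depend only on the number $n$ of vertices, the number $m$ of edges, and the constants. Contracting an edge $\{u,v\}$ (of $u$ into $v$) removes $u$ and connects to $v$ all edges that were incident to $u$; self-loops and parallel edges are removed. A solution to the connectivity problem for a graph is a function $cc$ from its vertices to $\mathbb{N}$ such that $cc(u)=cc(v)$ if and only if $u$ and $v$ are connected in the graph. **Theorem.** Let $\delta>0$ and $c\in\mathbb{R}$ be constants. There is a deterministic MPC algorithm with local space $S=O(n^\delta)$ and global space $S\cdot M=O(n+m)$, sufficient to hold the input, which for every undirected simple graph $G=(V,E)$ with $n=|V|$ vertices and $m=|E|$ edges constructs, in $O(\max\{1,\log\log n\})$ rounds, an undirected simple graph $G^*=(V^*,E^*)$ with $V^*\subseteq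 V$ such that * $G^*$ is obtained from $G$ by a sequence of contractions of edges, and * the number of non-isolated vertices of $G^*$ is at most $\frac{n}{\log^c n}$ (natural logarithm; for $n\le 1$ this bound is read as: $G^*$ has no non-isolated vertices). Furthermore, given any solution to the connectivity problem for $G^*$ with labels of $O(\log n)$ bits, distributed arbitrarily among the same machines (at most $S$ words on each), these machines, continuing from the memories left by the construction of $G^*$, can deterministically compute a solution to the connectivity problem for $G$, with the same $S$ and $M$, in $O(\max\{1,\log\log n\})$ further rounds. The constants in the $O(\cdot)$ depend only on $\delta$ and $c$ and, for the last part, also on the constant that bounds the length of the labels. -/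

import Mathlib

/-! ### Simple graphs on a subset of a fixed vertex type, and edge contractions -/

/-- A simple graph whose vertex set is a subset of `V` (its edges are arbitrary pairs of distinct
vertices of that subset): in Mathlib's terms, a subgraph of the complete graph on `V`. -/
abbrev SubsetGraph (V : Type) : Type := (⊤ : SimpleGraph V).Subgraph

/-- A simple graph on the whole of `V`, seen as a graph on a subset of `V`. -/
def SimpleGraph.toSubsetGraph {V : Type} (G : SimpleGraph V) : SubsetGraph V :=
  SimpleGraph.toSubgraph G le_top

/-- Contract the vertex `u` into the vertex `v`: remove `u`, and connect to `v` all the edges that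
were incident to `u`; self-loops and parallel edges are removed. -/
def SubsetGraph.contract {V : Type} (H : SubsetGraph V) (u v : V) (hv : v ∈ H.verts) :
    SubsetGraph V where
  verts := H.verts \ {u}
  Adj x y := x ≠ u ∧ y ≠ u ∧ x ≠ y ∧
    (H.Adj x y ∨ (x = v ∧ H.Adj u y) ∨ (y = v ∧ H.Adj x u))
  adj_sub := fun h => h.2.2.1
  edge_vert := by
    rintro x y ⟨hx, -, -, h | ⟨rfl, -⟩ | ⟨-, h⟩⟩
    · exact ⟨H.edge_vert h, hx⟩
    · exact ⟨hv, hx⟩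
    · exact ⟨H.edge_vert h, hx⟩
  symm := ⟨by
    rintro x y ⟨hx, hy, hxy, h | ⟨h, h'⟩ | ⟨h, h'⟩⟩
    · exact ⟨hy, hx, hxy.symm, Or.inl h.symm⟩
    · exact ⟨hy, hx, hxy.symm, Or.inr (Or.inr ⟨h, h'.symm⟩)⟩
    · exact ⟨hy, hx, hxy.symm, Or.inr (Or.inl ⟨h, h'.symm⟩)⟩⟩

/-- `H'` arises from `H` by the contraction of one edge `{u, v}` of `H` (of `u` into `v`). -/
def SubsetGraph.ContractsEdge {V : Type} (H H' : SubsetGraph V) : Prop :=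
  ∃ (u v : V) (h : H.Adj u v), H' = H.contract u v (H.edge_vert h.symm)

/-- `H'` is obtained from `H` by a (finite, possibly empty) sequence of edge contractions. -/
def SubsetGraph.IsContraction {V : Type} (H H' : SubsetGraph V) : Prop :=
  Relation.ReflTransGen SubsetGraph.ContractsEdge H H'

/-- `cc` solves the connectivity problem for `G`. -/
def IsConnectivitySolution {V : Type} (G : SimpleGraph V) (cc : V → ℕ) : Prop :=
  ∀ u v : V, G.Reachable u v ↔ cc u = cc v

/-! ### Massively parallel computation -/

namespace MPC

/-- A record is a finite sequence of words; a word is a natural number below a word bound. -/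
abbrev Record : Type := List ℕ

/-- The space taken by a list of records: a record of `k` words takes `k + 1` units, one of which
pays for its delimiter (or, if the record is a message, for its address). -/
def recordsSize (L : List Record) : ℕ := (L.map fun r => r.length + 1).sum

/-- The records take at most `S` units of space, and all their words are below `W`. -/
def Fits (S W : ℕ) (L : List Record) : Prop :=
  recordsSize L ≤ S ∧ ∀ r ∈ L, ∀ w ∈ r, w < W

/-- What a machine sees at the beginning of a round: its local memory, and the messages that it
received at the end of the previous round. -/
structure LocalState where
  memory : List Record
  inbox : List Record

/-- A deterministic program for `M` machines. In round `t`, machine `i` computes from its local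
state, by an arbitrary local computation `step t i`, its new memory and the list of the messages
that it sends, each with the machine it is sent to. After `rounds` rounds, it computes its part of
the output from its local state. -/
structure Program (M : ℕ) where
  rounds : ℕ
  step : ℕ → Fin M → LocalState → List Record × List (Fin M × Record)
  output : Fin M → LocalState → List Record

/-- The local states after `t` rounds. All messages are delivered at the end of the round in which
they are sent, ordered by their senders. -/
def Program.run {M : ℕ} (P : Program M) (init : Fin M → LocalState) : ℕ → Fin M → LocalState
  | 0 => init
  | t + 1 => fun j =>
    { memory := (P.step t j (P.run init t j)).1
      inbox := (List.finRange M).flatMap fun i =>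
        ((P.step t i (P.run init t i)).2.filter fun msg => msg.1 = j).map Prod.snd }

/-- The local states when the program ends. -/
def Program.final {M : ℕ} (P : Program M) (init : Fin M → LocalState) : Fin M → LocalState :=
  P.run init P.rounds

/-- The outputs of the machines when the program ends. -/
def Program.result {M : ℕ} (P : Program M) (init : Fin M → LocalState) : Fin M → List Record :=
  fun i => P.output i (P.final init i)

/-- The execution respects local space `S` and word bound `W`: on every machine, the memory, the
messages received and the messages sent in every round, and the output fit into `S`. -/
structure Program.Respects {M : ℕ} (P : Program M) (S W : ℕ) (init : Fin M → LocalState) :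
    Prop where
  memory : ∀ t ≤ P.rounds, ∀ i, Fits S W (P.run init t i).memory
  received : ∀ t ≤ P.rounds, ∀ i, Fits S W (P.run init t i).inbox
  sent : ∀ t < P.rounds, ∀ i, Fits S W ((P.step t i (P.run init t i)).2.map Prod.snd)
  output : ∀ i, Fits S W (P.result init i)

/-- All the records that are stored in a distributed fashion. -/
def gather {M : ℕ} (D : Fin M → List Record) : List Record := (List.finRange M).flatMap D

/-- The records in `D`, distributed arbitrarily among the machines, are the graph `G`, whose vertices
have the identifiers `ident v`: one record `[ident v]` for every vertex `v`, and one record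
`[ident u, ident v]` for every edge `{u, v}`, in one of its two orientations. -/
def StoresGraph {M : ℕ} {V : Type} (ident : V → ℕ) (G : SimpleGraph V)
    (D : Fin M → List Record) : Prop :=
  (gather D).Nodup ∧
  (∀ r ∈ gather D, (∃ v, r = [ident v]) ∨ ∃ u v, G.Adj u v ∧ r = [ident u, ident v]) ∧
  (∀ v, [ident v] ∈ gather D) ∧
  (∀ u v, G.Adj u v → Xor ([ident u, ident v] ∈ gather D) ([ident v, ident u] ∈ gather D))

/-- The records in `D`, distributed arbitrarily among the machines, are the function `f` on the
vertices: one record `[ident v, f v]` for every vertex `v`. -/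
def StoresFunction {M : ℕ} {V : Type} (ident : V → ℕ) (f : V → ℕ)
    (D : Fin M → List Record) : Prop :=
  (gather D).Nodup ∧ ∀ r, r ∈ gather D ↔ ∃ v, r = [ident v, f v]

/-- The initial states of the machines for an input that is distributed according to `D`. -/
def inputStates {M : ℕ} (D : Fin M → List Record) : Fin M → LocalState :=
  fun i => { memory := D i, inbox := [] }

/-- The initial states of a computation that continues with the memories left by an earlier one and
receives a further input, distributed according to `D`. -/
def resumeStates {M : ℕ} (s : Fin M → LocalState) (D : Fin M → List Record) :
    Fin M → LocalState :=
  fun i => { memory := (s i).memory, inbox := D i }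

end MPC

/-! The graph is contracted in phases. In a phase, every non-isolated vertex v looks at its least
neighbour w, and v is merged into w if a function h satisfies h(v) = false and h(w) = true. The
target of a merge has value true and therefore does not move, so the merges form disjoint stars, and
collapsing stars is a sequence of edge contractions (`SubsetGraph.isContraction_collapse`).

The function h replaces coin flips. Cut an identifier into k blocks of b bits. A function of the
family is given by a block number i, a vector x over the field with two elements and a bit z; it
maps v to z plus the inner product of x with block i of v. Distinct identifiers differ in some
block, and hence at least 1/(4k) of the functions are false at the first and true at the second
(`exists_splitting_family`). By averaging, some function merges at least 1/(4k) of the non-isolated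
vertices (`Represents.support_le_mul_card_merges`). Only 2k 2^b functions exist, which for fixed k
is of order n^(1/k), so the votes for all of them fit into one message and the best one is found
deterministically. A phase multiplies the number of non-isolated vertices by at most 1 - 1/(4k), and
O(max(1, log log n)) phases suffice (`support_le_of_phases`).

A phase must take a constant number of rounds. The basic tool is a prefix sum over an arbitrary,
possibly noncommutative monoid (`realizes_scan`): the number of machines is F^D with D = 2k
constant, and in round j the machines that differ only in digit j of their base-F numbers exchange
partial sums. Counting digits by a scan and sending every item to its rank gives stable sorting by
one digit, and radix sort in base about n^(1/k) needs a constant number of passes (`realizes_sort`).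
After sorting by first endpoint, a scan over the monoid `Head` spreads the least neighbour of a
vertex to all items that start at it (`realizes_attach`). Doing this for both endpoints and scanning
the votes completes a phase (`realizes_phase`).

Every original vertex remembers its representative throughout. To pull a connectivity solution back,
its labels are treated as edges from the representatives to the labels; the label is then the least
neighbour, and one more sort and scan delivers it (`runs_transfer`). -/

namespace MPC

variable {M S W : ℕ}

/-! ### Sequences of rounds with resource bounds -/

/-- The computation of all machines in one round. -/
abbrev Step (M : ℕ) : Type :=
  Fin M → LocalState → List Record × List (Fin M × Record)

/-- The effect of one round on the local states. -/
def Step.exec (f : Step M) (s : Fin M → LocalState) : Fin M → LocalState := fun j =>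
  { memory := (f j (s j)).1
    inbox := (List.finRange M).flatMap fun i =>
      ((f i (s i)).2.filter fun msg => msg.1 = j).map Prod.snd }

/-- Memory and inbox fit on every machine. -/
def StateFits (S W : ℕ) (s : Fin M → LocalState) : Prop :=
  ∀ i, Fits S W (s i).memory ∧ Fits S W (s i).inbox

/-- The rounds `fs` lead from `s` to `s'` within local space `S` and word bound `W`. -/
def Runs (S W : ℕ) : List (Step M) → (Fin M → LocalState) → (Fin M → LocalState) → Prop
  | [], s, s' => s' = s ∧ StateFits S W s
  | f :: fs, s, s' => StateFits S W s ∧ (∀ i, Fits S W ((f i (s i)).2.map Prod.snd)) ∧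
      Runs S W fs (f.exec s) s'

/-- The program that executes the rounds `fs`. -/
def Program.ofSteps (fs : List (Step M)) (out : Fin M → LocalState → List Record) : Program M where
  rounds := fs.length
  -- The default is an idle round; it lies beyond `rounds` and is never executed.
  step t := fs.getD t fun _ s => (s.memory, [])
  output := out

theorem Runs.append {fs gs : List (Step M)} {s s' s'' : Fin M → LocalState}
    (h : Runs S W fs s s') (h' : Runs S W gs s' s'') : Runs S W (fs ++ gs) s s'' := by
  induction fs generalizing s with
  | nil => obtain ⟨rfl, -⟩ := h; exact h'
  | cons f fs ih => exact ⟨h.1, h.2.1, ih h.2.2⟩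

/-- `Program.run` unfolds at the last round, whereas a list of rounds unfolds at the first; this
bridge allows induction on the list. -/
theorem Program.run_ofSteps_cons (f : Step M) (fs : List (Step M))
    (out : Fin M → LocalState → List Record) (s : Fin M → LocalState) (t : ℕ) :
    (Program.ofSteps (f :: fs) out).run s (t + 1) = (Program.ofSteps fs out).run (f.exec s) t := by
  induction t with
  | zero => rfl
  | succ t ih => rw [Program.run, ih]; rfl

theorem Runs.final {fs : List (Step M)} {s s' : Fin M → LocalState} (h : Runs S W fs s s')
    (out : Fin M → LocalState → List Record) : (Program.ofSteps fs out).final s = s' := by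
  induction fs generalizing s with
  | nil => exact h.1.symm
  | cons f fs ih =>
    rw [← ih h.2.2]
    exact Program.run_ofSteps_cons f fs out s fs.length

theorem Runs.fits_run {fs : List (Step M)} {s s' : Fin M → LocalState} (h : Runs S W fs s s')
    (out : Fin M → LocalState → List Record) {t : ℕ} (ht : t ≤ fs.length) :
    StateFits S W ((Program.ofSteps fs out).run s t) := by
  induction fs generalizing s t with
  | nil =>
    obtain rfl : t = 0 := by simpa using ht
    exact h.2
  | cons f fs ih =>
    cases t with
    | zero => exact h.1
    | succ t =>
      rw [Program.run_ofSteps_cons]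
      exact ih h.2.2 (by simpa using ht)

theorem Runs.fits_sent {fs : List (Step M)} {s s' : Fin M → LocalState} (h : Runs S W fs s s')
    (out : Fin M → LocalState → List Record) {t : ℕ} (ht : t < fs.length) (i : Fin M) :
    Fits S W (((Program.ofSteps fs out).step t i ((Program.ofSteps fs out).run s t i)).2.map
      Prod.snd) := by
  induction fs generalizing s t with
  | nil => simp at ht
  | cons f fs ih =>
    cases t with
    | zero => exact h.2.1 i
    | succ t =>
      rw [Program.run_ofSteps_cons]
      exact ih h.2.2 (by simpa using ht)

theorem Runs.respects {fs : List (Step M)} {s s' : Fin M → LocalState} (h : Runs S W fs s s')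
    {out : Fin M → LocalState → List Record} (ho : ∀ i, Fits S W (out i (s' i))) :
    (Program.ofSteps fs out).Respects S W s where
  memory _ ht i := (h.fits_run out ht i).1
  received _ ht i := (h.fits_run out ht i).2
  sent _ ht i := h.fits_sent out ht i
  output i := by
    have := ho i
    rw [← h.final out] at this
    exact this

theorem Fits.mono {S' W' : ℕ} {L : List Record} (h : Fits S W L) (hS : S ≤ S') (hW : W ≤ W') :
    Fits S' W' L :=
  ⟨h.1.trans hS, fun r hr w hw => (h.2 r hr w hw).trans_le hW⟩

theorem fits_nil : Fits S W [] := by simp [Fits, recordsSize]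

theorem fits_singleton {r : Record} (hS : r.length + 1 ≤ S) (hW : ∀ w ∈ r, w < W) :
    Fits S W [r] := by
  simpa [Fits, recordsSize] using ⟨hS, hW⟩

/-- The memory that holds the items `l`, each encoded in one word. -/
def pack {α : Type*} [Denumerable α] (l : List α) : List Record := [l.map Encodable.encode]

/-- The items that are held by a memory. -/
def unpack {α : Type*} [Denumerable α] (m : List Record) : List α :=
  m.headI.map (Denumerable.ofNat α)

@[simp] theorem unpack_pack {α : Type*} [Denumerable α] (l : List α) :
    (unpack (pack l) : List α) = l := by
  simp [unpack, pack, Function.comp_def]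

/-- Machine `i` holds the items `l i`, and there are no messages. -/
def canon {α : Type*} [Denumerable α] (l : Fin M → List α) : Fin M → LocalState :=
  fun i => ⟨pack (l i), []⟩

/-- The rounds `fs` transform the list `L`, distributed among the machines with at most `c` items on
each, into the list `L'` with at most `c'` items on each. -/
def Realizes {α α' : Type} [Denumerable α] [Denumerable α'] (S W : ℕ) (fs : List (Step M))
    (c : ℕ) (L : List α) (c' : ℕ) (L' : List α') : Prop :=
  ∀ l : Fin M → List α, (List.finRange M).flatMap l = L → (∀ i, (l i).length ≤ c) →
    ∃ l' : Fin M → List α', (List.finRange M).flatMap l' = L' ∧ (∀ i, (l' i).length ≤ c') ∧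
      Runs S W fs (canon l) (canon l')

/-- Stages compose because the result list depends only on the input list, not on its distribution:
each stage accepts whatever distribution the previous one leaves. -/
theorem Realizes.append {α α' α'' : Type} [Denumerable α] [Denumerable α'] [Denumerable α'']
    {fs gs : List (Step M)} {c c' c'' : ℕ} {L : List α} {L' : List α'} {L'' : List α''}
    (h : Realizes S W fs c L c' L') (h' : Realizes S W gs c' L' c'' L'') :
    Realizes S W (fs ++ gs) c L c'' L'' := by
  intro l hl hc
  obtain ⟨l', hl', hc', hr⟩ := h l hl hc
  obtain ⟨l'', hl'', hc'', hr'⟩ := h' l' hl' hc'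
  exact ⟨l'', hl'', hc'', hr.append hr'⟩

theorem fits_pack {α : Type*} [Denumerable α] {l : List α} (hS : l.length + 1 ≤ S)
    (hW : ∀ a ∈ l, Encodable.encode a < W) : Fits S W (pack l) :=
  fits_singleton (by simpa using hS) (by simpa using hW)

theorem stateFits_canon {α : Type*} [Denumerable α] {l : Fin M → List α}
    (hS : ∀ i, (l i).length + 1 ≤ S) (hW : ∀ i, ∀ a ∈ l i, Encodable.encode a < W) :
    StateFits S W (canon l) :=
  fun i => ⟨fits_pack (hS i) (hW i), fits_nil⟩

/-! ### Routing -/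

theorem flatMap_filter_map {ι α β : Type*} (L : List ι) (f : ι → List α) (p : α → Bool)
    (g : α → β) :
    (L.flatMap fun i => ((f i).filter p).map g) = ((L.flatMap f).filter p).map g := by
  induction L with
  | nil => rfl
  | cons a L ih => simp [ih]

/-- Every item is sent to the machine that is given by its tag. -/
def routeSendStep (M : ℕ) (α : Type) [Denumerable α] (C : ℕ) : Step M := fun _ s =>
  ([], (unpack s.memory : List (ℕ × α)).flatMap fun p =>
    if h : p.1 / C < M then [(⟨p.1 / C, h⟩, [Encodable.encode p])] else [])

/-- The received items are sorted by their tags, and the tags are removed. -/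
def routeReceiveStep (M : ℕ) (α : Type) [Denumerable α] : Step M := fun _ s =>
  (pack (((s.inbox.map fun r => Denumerable.ofNat (ℕ × α) r.headI).mergeSort
    fun p q => p.1 ≤ q.1).map Prod.snd), [])

/-- Sort the items by their tags. -/
def routeSteps (M : ℕ) (α : Type) [Denumerable α] (C : ℕ) : List (Step M) :=
  [routeSendStep M α C, routeReceiveStep M α]

theorem routeSend_filter {α : Type} [Denumerable α] (C : ℕ) (l : List (ℕ × α)) (j : Fin M) :
    ((l.flatMap fun p => if h : p.1 / C < M then
      [((⟨p.1 / C, h⟩ : Fin M), [Encodable.encode p])] else []).filter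
        fun msg => msg.1 = j).map Prod.snd =
    (l.filter fun p => p.1 / C = j).map fun p => [Encodable.encode p] := by
  induction l with
  | nil => rfl
  | cons p l ih =>
    rw [List.flatMap_cons, List.filter_append, List.map_append, ih]
    by_cases h : p.1 / C = j
    · have hlt : p.1 / C < M := h ▸ j.2
      have : (⟨p.1 / C, hlt⟩ : Fin M) = j := Fin.ext h
      simp [h]
    · by_cases hlt : p.1 / C < M
      · have : (⟨p.1 / C, hlt⟩ : Fin M) ≠ j := fun e => h (Fin.ext_iff.1 e)
        simp [hlt, h, this]
      · simp [hlt, h]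

theorem routeSend_map {α : Type} [Denumerable α] {C : ℕ} {l : List (ℕ × α)}
    (hl : ∀ p ∈ l, p.1 / C < M) :
    (l.flatMap fun p => if h : p.1 / C < M then
      [((⟨p.1 / C, h⟩ : Fin M), [Encodable.encode p])] else []).map Prod.snd =
    l.map fun p => [Encodable.encode p] := by
  induction l with
  | nil => rfl
  | cons p l ih =>
    rw [List.flatMap_cons, List.map_append, ih fun q hq => hl q (by simp [hq])]
    simp [hl p (by simp)]

theorem recordsSize_map_singleton {α : Type*} (l : List α) (g : α → ℕ) :
    recordsSize (l.map fun a => [g a]) = 2 * l.length := by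
  induction l with
  | nil => rfl
  | cons a l ih => simp [recordsSize] at ih ⊢; omega

/-- Pigeonhole: the tags are distinct and lie in an interval of length `C`. -/
theorem length_le_of_tags {α : Type*} {C j : ℕ} {l : List (ℕ × α)} (h : (l.map Prod.fst).Nodup)
    (hj : ∀ p ∈ l, p.1 / C = j) (hC : 0 < C) : l.length ≤ C := by
  have h1 : (l.map Prod.fst) ⊆ List.range' (j * C) C := by
    intro t ht
    obtain ⟨p, hp, rfl⟩ := List.mem_map.1 ht
    have := hj p hp
    subst this
    rw [List.mem_range'_1]
    exact ⟨Nat.div_mul_le_self _ _, by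
      have := Nat.lt_div_mul_add (a := p.1) hC; omega⟩
  simpa using (List.subperm_of_subset h h1).length_le

/-- Each element falls into exactly one class of `g`, so the multiplicities agree. -/
theorem flatMap_filter_perm {ι α : Type*} [DecidableEq ι] {L : List α} {I : List ι}
    (hI : I.Nodup) (g : α → ι) (hg : ∀ a ∈ L, g a ∈ I) :
    (I.flatMap fun i => L.filter fun a => g a = i).Perm L := by
  classical
  rw [List.perm_iff_count]
  intro a
  rw [List.count_flatMap]
  by_cases ha : a ∈ L
  · have : (List.map (List.count a ∘ fun i => L.filter fun b => g b = i) I) =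
        I.map fun i => if i = g a then L.count a else 0 := by
      refine List.map_congr_left fun i _ => ?_
      simp only [Function.comp_apply]
      split_ifs with h
      · subst h
        rw [List.count_filter (by simp)]
      · refine List.count_eq_zero_of_not_mem fun h' => h ?_
        simpa [eq_comm] using (List.mem_filter.1 h').2
    rw [this]
    have key : ∀ J : List ι, J.Nodup → g a ∈ J →
        (J.map fun i => if i = g a then L.count a else 0).sum = L.count a := by
      intro J hJ hm
      rw [← List.sum_toFinset _ hJ, Finset.sum_ite_eq' _ _ fun _ => L.count a]
      simp [hm]
    exact key I hI (hg a ha)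
  · rw [List.count_eq_zero_of_not_mem ha, List.sum_eq_zero]
    intro x hx
    obtain ⟨i, -, rfl⟩ := List.mem_map.1 hx
    exact List.count_eq_zero_of_not_mem fun h' => ha (List.mem_filter.1 h').1

/-- Tag `t` belongs to machine `t / C`. This is monotone in the tag, so local sorting gives a
globally sorted list, and distinctness of the tags bounds every load by `C`. A message is one word
plus its address, hence the factors 2 in the space conditions. -/
theorem realizes_route {α : Type} [Denumerable α] {C c : ℕ} {L : List (ℕ × α)} (hC : 0 < C)
    (hnd : (L.map Prod.fst).Nodup) (hlt : ∀ p ∈ L, p.1 < M * C)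
    (hW : ∀ p ∈ L, Encodable.encode p < W) (hW' : ∀ p ∈ L, Encodable.encode p.2 < W)
    (hS : 2 * c + 1 ≤ S) (hS' : 2 * C + 1 ≤ S) :
    ∃ L' : List (ℕ × α), L'.Perm L ∧ L'.Pairwise (fun p q => p.1 < q.1) ∧
      Realizes S W (routeSteps M α C) c L C (L'.map Prod.snd) := by
  set piece : Fin M → List (ℕ × α) := fun j =>
    (L.filter fun p => p.1 / C = j).mergeSort fun p q => p.1 ≤ q.1 with hpiece
  have hmem : ∀ j, ∀ p ∈ piece j, p ∈ L ∧ p.1 / C = j := by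
    intro j p hp
    simpa [hpiece] using hp
  have hperm : ((List.finRange M).flatMap piece).Perm L := by
    have h0 : ((List.finRange M).flatMap piece).Perm
        ((List.finRange M).flatMap fun j : Fin M => L.filter fun p => p.1 / C = j) :=
      List.Perm.flatMap_left _ fun j _ => List.mergeSort_perm _ _
    refine h0.trans ?_
    have h := flatMap_filter_perm (L := L) (I := (List.finRange M).map Fin.val)
      (by simpa using (List.nodup_finRange M).map Fin.val_injective) (fun p => p.1 / C)
      (fun p hp => List.mem_map.2 ⟨⟨p.1 / C, Nat.div_lt_of_lt_mul (by
        rw [mul_comm]; exact hlt p hp)⟩, by simp, rfl⟩)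
    rwa [List.flatMap_map] at h
  have hsorted : ((List.finRange M).flatMap piece).Pairwise fun p q => p.1 ≤ q.1 := by
    rw [List.pairwise_flatMap]
    refine ⟨fun j _ => ?_, ?_⟩
    · have := List.pairwise_mergeSort (le := fun p q : ℕ × α => decide (p.1 ≤ q.1))
        (by simp only [decide_eq_true_eq]; intros; omega)
        (by simp only [Bool.or_eq_true, decide_eq_true_eq]; intros; omega)
        (L.filter fun p => p.1 / C = j)
      simpa using this
    · refine (List.pairwise_lt_finRange M).imp fun {i j} hij p hp q hq => ?_
      have h1 := (hmem i p hp).2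
      have h2 := (hmem j q hq).2
      by_contra hle
      have := Nat.div_le_div_right (c := C) (not_le.1 hle).le
      rw [h1, h2] at this
      exact absurd hij (not_lt.2 this)
  have hstrict : ((List.finRange M).flatMap piece).Pairwise fun p q => p.1 < q.1 := by
    have hne : ((List.finRange M).flatMap piece).Pairwise fun p q => p.1 ≠ q.1 :=
      List.pairwise_map.1 ((hperm.map Prod.fst).nodup_iff.2 hnd)
    exact (hsorted.and hne).imp fun h => lt_of_le_of_ne h.1 h.2
  have hlen : ∀ j, (piece j).length ≤ C := by
    intro j
    rw [hpiece]
    simp only [List.length_mergeSort]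
    refine length_le_of_tags (j := j) ?_ (fun p hp => by simpa using (List.mem_filter.1 hp).2) hC
    exact hnd.sublist (List.filter_sublist.map _)
  refine ⟨_, hperm, hstrict, fun l hl hc => ⟨fun j => (piece j).map Prod.snd, ?_, ?_, ?_⟩⟩
  · rw [List.map_flatMap]
  · simpa using hlen
  have hlL : ∀ i, ∀ p ∈ l i, p ∈ L := fun i p hp => by
    rw [← hl]; exact List.mem_flatMap.2 ⟨i, by simp, hp⟩
  have hdiv : ∀ i, ∀ p ∈ l i, p.1 / C < M := fun i p hp =>
    Nat.div_lt_of_lt_mul (by rw [mul_comm]; exact hlt p (hlL i p hp))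
  have hexec : (routeSendStep M α C).exec (canon l) = fun j =>
      ⟨[], (L.filter fun p => p.1 / C = j).map fun p => [Encodable.encode p]⟩ := by
    funext j
    simp only [Step.exec, routeSendStep, canon, unpack_pack, routeSend_filter]
    rw [flatMap_filter_map, hl]
  have hexec' : (routeReceiveStep M α).exec ((routeSendStep M α C).exec (canon l)) =
      canon fun j => (piece j).map Prod.snd := by
    rw [hexec]
    funext j
    simp only [Step.exec, routeReceiveStep, canon, hpiece, List.map_map, Function.comp_def,
      List.headI, Denumerable.ofNat_encode, List.map_id', List.filter_nil, List.map_nil]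
    simp
  refine ⟨stateFits_canon (fun i => by have := hc i; omega) fun i p hp => hW p (hlL i p hp),
    fun i => ?_, ?_⟩
  · simp only [routeSendStep, canon, unpack_pack]
    rw [routeSend_map (hdiv i)]
    refine ⟨?_, ?_⟩
    · rw [recordsSize_map_singleton]; have := hc i; omega
    · simp only [List.mem_map, forall_exists_index, and_imp]
      rintro r p hp rfl w hw
      obtain rfl := List.mem_singleton.1 hw
      exact hW p (hlL i p hp)
  refine ⟨?_, fun i => fits_nil, hexec'.symm, ?_⟩
  · rw [hexec]
    refine fun j => ⟨fits_nil, ?_, ?_⟩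
    · rw [recordsSize_map_singleton]
      have := hlen j
      simp only [hpiece, List.length_mergeSort] at this
      omega
    · simp only [List.mem_map, forall_exists_index, and_imp]
      rintro r p hp rfl w hw
      obtain rfl := List.mem_singleton.1 hw
      exact hW p (List.mem_filter.1 hp).1
  · rw [hexec']
    refine stateFits_canon (fun j => by have := hlen j; simp; omega) fun j a ha => ?_
    obtain ⟨p, hp, rfl⟩ := List.mem_map.1 ha
    exact hW' p (hmem j p hp).1

end MPC

namespace MPC

variable {M S W : ℕ}

/-! ### Prefix sums -/

section scanMap

variable {α α' β : Type} [AddMonoid β]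

/-- Replace every item `a` of a list by the items `f tot pre a`, where `pre` is the sum of the
weights `x` of the preceding items. -/
def scanMap (x : α → β) (f : β → β → α → List α') (tot : β) : β → List α → List α'
  | _, [] => []
  | pre, a :: l => f tot pre a ++ scanMap x f tot (pre + x a) l

theorem scanMap_append (x : α → β) (f : β → β → α → List α') (tot pre : β) (l l' : List α) :
    scanMap x f tot pre (l ++ l') =
      scanMap x f tot pre l ++ scanMap x f tot (pre + (l.map x).sum) l' := by
  induction l generalizing pre with
  | nil => simp [scanMap]
  | cons a l ih => simp [scanMap, ih, add_assoc]

theorem length_scanMap_le (x : α → β) (f : β → β → α → List α') (tot pre : β) (l : List α) {r : ℕ}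
    (hf : ∀ t p a, (f t p a).length ≤ r) : (scanMap x f tot pre l).length ≤ r * l.length := by
  induction l generalizing pre with
  | nil => simp [scanMap]
  | cons a l ih =>
    have h1 := hf tot pre a
    have h2 := ih (pre + x a)
    simp only [scanMap, List.length_append, List.length_cons]
    rw [mul_add]
    omega

theorem sum_map_flatMap {ι : Type*} (I : List ι) (l : ι → List α) (x : α → β) :
    ((I.flatMap l).map x).sum = (I.map fun i => ((l i).map x).sum).sum := by
  induction I with
  | nil => rfl
  | cons i I ih => simp [ih]

/-- A machine can process its own items alone as soon as it knows the sum over all earlier machines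
and the grand total; this is what the communication has to provide. -/
theorem scanMap_flatMap (x : α → β) (f : β → β → α → List α') (tot : β) (l : Fin M → List α) :
    scanMap x f tot 0 ((List.finRange M).flatMap l) =
      (List.finRange M).flatMap fun i => scanMap x f tot
        (((List.finRange M).filter fun j => j < i).map fun j => ((l j).map x).sum).sum (l i) := by
  -- Generalise to a suffix `J` of the machines, with `I` the machines already passed.
  have key : ∀ J I : List (Fin M), List.finRange M = I ++ J →
      scanMap x f tot ((I.map fun j => ((l j).map x).sum).sum) (J.flatMap l) =
      J.flatMap fun i => scanMap x f tot
        (((List.finRange M).filter fun j => j < i).map fun j => ((l j).map x).sum).sum (l i) := by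
    intro J
    induction J with
    | nil => intros; rfl
    | cons i J ih =>
      intro I hI
      have hs := List.pairwise_lt_finRange M
      have hfil : (List.finRange M).filter (fun j => j < i) = I := by
        rw [hI] at hs ⊢
        rw [List.pairwise_append, List.pairwise_cons] at hs
        rw [List.filter_append, List.filter_eq_self.2, List.filter_eq_nil_iff.2, List.append_nil]
        · intro j hj
          rcases List.mem_cons.1 hj with rfl | hj
          · simp
          · simpa using (hs.2.1.1 j hj).le
        · intro j hj
          simpa using hs.2.2 j hj i (by simp)
      rw [List.flatMap_cons, scanMap_append, List.flatMap_cons, hfil,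
        ← ih (I ++ [i]) (by simp [hI])]
      simp
  simpa using key (List.finRange M) [] (by simp)

end scanMap

/-- A code for the elements of `β` by sequences of `len` words. -/
structure VecCode (β : Type) where
  len : ℕ
  enc : β → List ℕ
  dec : List ℕ → β
  dec_enc : ∀ b, dec (enc b) = b
  length_enc : ∀ b, (enc b).length = len

section messages

variable {β : Type} (κ : VecCode β)

/-- The message of machine `i` with a pair of sums. -/
def scanMessage (i : ℕ) (v : β × β) : Record := i :: (κ.enc v.1 ++ κ.enc v.2)

/-- The first sum in a message. -/
def messageTotal (r : Record) : β := κ.dec (r.tail.take κ.len)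

/-- The second sum in a message. -/
def messagePrefix (r : Record) : β := κ.dec (r.tail.drop κ.len)

@[simp] theorem messageTotal_scanMessage (i : ℕ) (v : β × β) :
    messageTotal κ (scanMessage κ i v) = v.1 := by
  simp [messageTotal, scanMessage, ← κ.length_enc v.1, κ.dec_enc]

@[simp] theorem messagePrefix_scanMessage (i : ℕ) (v : β × β) :
    messagePrefix κ (scanMessage κ i v) = v.2 := by
  simp [messagePrefix, scanMessage, ← κ.length_enc v.1, κ.dec_enc]

end messages

section scan

variable {α α' β : Type} [AddMonoid β] [Denumerable α] [Denumerable α']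
  (κ : VecCode β) (x : α → β) (f : β → β → α → List α') (F : ℕ)

/-- The sum over a block of machines, and over the part of the block before machine `i`, from the
messages of the subblocks. -/
def combineMessages (i : ℕ) (inbox : List Record) : β × β :=
  ((inbox.map (messageTotal κ)).sum,
    ((inbox.filter fun r => r.headI < i).map (messageTotal κ)).sum +
      ((inbox.filter fun r => r.headI = i).map (messagePrefix κ)).sum)

/-- The two sums that a machine knows at the beginning of round `k` of a scan. -/
def scanRead (k : ℕ) (i : Fin M) (s : LocalState) : β × β :=
  if k = 0 then (((unpack s.memory : List α).map x).sum, 0) else combineMessages κ i s.inbox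

/-- The machines whose numbers differ from `i` at most in digit `k` in base `F`. -/
def peers (k : ℕ) (i : Fin M) : List (Fin M) :=
  (List.finRange M).filter fun j => (j : ℕ) / F ^ (k + 1) = i / F ^ (k + 1) ∧ (j : ℕ) % F ^ k = i % F ^ k

/-- The block of `F ^ k` consecutive machines around machine `i`. -/
def block (k : ℕ) (i : Fin M) : List (Fin M) :=
  (List.finRange M).filter fun j => (j : ℕ) / F ^ k = i / F ^ k

/-- A round of a scan. -/
def scanStep (k : ℕ) : Step M := fun i s =>
  (s.memory, (peers F k i).map fun j => (j, scanMessage κ i (scanRead κ x k i s)))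

/-- The last round of a scan. -/
def scanFinish (D : ℕ) : Step M := fun i s =>
  (pack (scanMap x f (scanRead κ x D i s).1 (scanRead κ x D i s).2 (unpack s.memory)), [])

/-- The rounds of a scan for `F ^ D` machines. -/
def scanSteps (M D : ℕ) : List (Step M) :=
  (List.range D).map (scanStep κ x F) ++ [scanFinish κ x f D]

variable (l : Fin M → List α)

/-- The sum over a block. -/
def blockTotal (k : ℕ) (i : Fin M) : β :=
  ((block F k i).map fun j => ((l j).map x).sum).sum

/-- The sum over the part of a block before machine `i`. -/
def blockPrefix (k : ℕ) (i : Fin M) : β :=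
  (((block F k i).filter fun j => j < i).map fun j => ((l j).map x).sum).sum

/-- The local states after `k` rounds of a scan. -/
def scanState (k : ℕ) : Fin M → LocalState := fun i =>
  ⟨pack (l i), if k = 0 then [] else (peers F (k - 1) i).map fun j : Fin M =>
    scanMessage κ j (blockTotal x F l (k - 1) j, blockPrefix x F l (k - 1) j)⟩

variable {F}

theorem mem_peers {k : ℕ} {i j : Fin M} : j ∈ peers F k i ↔
    (j : ℕ) / F ^ (k + 1) = i / F ^ (k + 1) ∧ (j : ℕ) % F ^ k = i % F ^ k := by
  simp [peers]

theorem mem_block {k : ℕ} {i j : Fin M} :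
    j ∈ block F k i ↔ (j : ℕ) / F ^ k = i / F ^ k := by
  simp [block]

theorem peers_sorted (k : ℕ) (i : Fin M) : (peers F k i).Pairwise (· < ·) :=
  (List.pairwise_lt_finRange M).filter _

theorem block_sorted (k : ℕ) (i : Fin M) : (block F k i).Pairwise (· < ·) :=
  (List.pairwise_lt_finRange M).filter _

theorem length_peers_le (hF : 0 < F) (k : ℕ) (i : Fin M) : (peers F k i).length ≤ F := by
  have hnd : ((peers F k i).map fun j : Fin M => (j : ℕ) / F ^ k % F).Nodup := by
    refine (List.nodup_map_iff_inj_on (((peers_sorted k i).imp fun h => h.ne))).2 ?_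
    intro a ha b hb hab
    rw [mem_peers, pow_succ, ← Nat.div_div_eq_div_mul, ← Nat.div_div_eq_div_mul] at ha hb
    have h1 : (a : ℕ) / F ^ k = b / F ^ k := by
      rw [← Nat.div_add_mod (a / F ^ k) F, ← Nat.div_add_mod (b / F ^ k) F, hab, ha.1, hb.1]
    apply Fin.ext
    rw [← Nat.div_add_mod a (F ^ k), ← Nat.div_add_mod b (F ^ k), h1, ha.2, hb.2]
  have hsub : ((peers F k i).map fun j : Fin M => (j : ℕ) / F ^ k % F) ⊆ List.range F := by
    intro t ht
    obtain ⟨j, -, rfl⟩ := List.mem_map.1 ht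
    exact List.mem_range.2 (Nat.mod_lt _ hF)
  simpa using (List.subperm_of_subset hnd hsub).length_le

/-- Combine the digits of `j` from position `k` upwards with the lower digits of `i`. The result is
a valid machine number because the number of machines is an exact power of `F`. -/
theorem exists_peer {D k : ℕ} (hM : M = F ^ D) (hk : k < D) {i j : Fin M} (hF : 0 < F)
    (h : (j : ℕ) / F ^ (k + 1) = i / F ^ (k + 1)) :
    ∃ p ∈ peers F k i, (j : ℕ) / F ^ k = p / F ^ k := by
  have hpos : 0 < F ^ k := pow_pos hF k
  have hlt : (j : ℕ) / F ^ k * F ^ k + i % F ^ k < M := by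
    have h1 : (j : ℕ) / F ^ k < F ^ (D - k) := by
      apply Nat.div_lt_of_lt_mul
      rw [← pow_add, Nat.add_sub_cancel' hk.le, ← hM]
      exact j.2
    have h2 : (i : ℕ) % F ^ k < F ^ k := Nat.mod_lt _ hpos
    have h3 : ((j : ℕ) / F ^ k + 1) * F ^ k ≤ F ^ (D - k) * F ^ k := Nat.mul_le_mul_right _ h1
    rw [← pow_add, Nat.sub_add_cancel hk.le, ← hM] at h3
    rw [add_mul] at h3
    omega
  have hdiv : ((j : ℕ) / F ^ k * F ^ k + i % F ^ k) / F ^ k = j / F ^ k := by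
    rw [mul_comm, Nat.mul_add_div hpos, Nat.div_eq_of_lt (Nat.mod_lt _ hpos), add_zero]
  refine ⟨⟨_, hlt⟩, ?_, hdiv.symm⟩
  rw [mem_peers]
  refine ⟨?_, ?_⟩
  · rw [pow_succ, ← Nat.div_div_eq_div_mul, ← Nat.div_div_eq_div_mul, hdiv,
      Nat.div_div_eq_div_mul, Nat.div_div_eq_div_mul, ← pow_succ, h]
  · simp [Nat.add_mod]

/-- Peers agree in the lower `k` digits, so distinct peers lie in distinct blocks, and increasing
peers have increasing blocks. -/
theorem flatMap_block_sorted {k : ℕ} {I : List (Fin M)} {i : Fin M} (hI : I.Pairwise (· < ·))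
    (hsub : ∀ j ∈ I, j ∈ peers F k i) : (I.flatMap (block F k)).Pairwise (· < ·) := by
  rw [List.pairwise_flatMap]
  refine ⟨fun j _ => block_sorted k j, ?_⟩
  have : I.Pairwise fun a b => a < b ∧ a ∈ peers F k i ∧ b ∈ peers F k i :=
    List.Pairwise.imp_of_mem (fun ha hb h => ⟨h, hsub _ ha, hsub _ hb⟩) hI
  refine this.imp fun {a b} hab p hp q hq => ?_
  obtain ⟨hab, ha, hb⟩ := hab
  rw [mem_block] at hp hq
  rw [mem_peers] at ha hb
  have hne : (a : ℕ) / F ^ k ≠ b / F ^ k := by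
    intro e
    refine hab.ne (Fin.ext ?_)
    rw [← Nat.div_add_mod a (F ^ k), ← Nat.div_add_mod b (F ^ k), e, ha.2, hb.2]
  by_contra hle
  have h1 := Nat.div_le_div_right (c := F ^ k) (Fin.le_def.1 (not_lt.1 hle))
  have h2 := Nat.div_le_div_right (c := F ^ k) (Fin.le_def.1 hab.le)
  omega

/-- Equality as lists, not just as sets, is needed since the sums may be noncommutative; it follows
because both sides are strictly sorted and have the same members. -/
theorem flatMap_peers {D k : ℕ} (hM : M = F ^ D) (hk : k < D) (hF : 0 < F) (i : Fin M) :
    (peers F k i).flatMap (block F k) = block F (k + 1) i := by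
  refine (flatMap_block_sorted (peers_sorted k i) fun j hj => hj).eq_of_mem_iff
    (block_sorted (k + 1) i) fun j => ?_
  rw [List.mem_flatMap, mem_block]
  constructor
  · rintro ⟨p, hp, hj⟩
    rw [mem_block] at hj
    rw [← (mem_peers.1 hp).1, pow_succ, ← Nat.div_div_eq_div_mul, ← Nat.div_div_eq_div_mul, hj]
  · intro h
    obtain ⟨p, hp, hj⟩ := exists_peer hM hk hF h
    exact ⟨p, hp, mem_block.2 hj⟩

/-- The machines before `i` in the larger block are the full subblocks of the earlier peers,
followed by the machines before `i` in its own subblock. -/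
theorem flatMap_peers_prefix {D k : ℕ} (hM : M = F ^ D) (hk : k < D) (hF : 0 < F) (i : Fin M) :
    ((peers F k i).filter fun j => j < i).flatMap (block F k) ++
      (block F k i).filter (fun j => j < i) = (block F (k + 1) i).filter fun j => j < i := by
  have hlow : ∀ p ∈ peers F k i, p < i → ∀ j ∈ block F k p, (j : ℕ) / F ^ k < i / F ^ k := by
    intro p hp hpi j hj
    rw [mem_block] at hj
    rw [hj]
    refine lt_of_le_of_ne (Nat.div_le_div_right (Fin.le_def.1 hpi.le)) fun e => hpi.ne ?_
    apply Fin.ext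
    rw [← Nat.div_add_mod p (F ^ k), ← Nat.div_add_mod i (F ^ k), e, (mem_peers.1 hp).2]
  refine List.Pairwise.eq_of_mem_iff (r := (· < ·)) ?_ ((block_sorted (k + 1) i).filter _)
    fun j => ?_
  · rw [List.pairwise_append]
    refine ⟨flatMap_block_sorted ((peers_sorted k i).filter _) fun j hj =>
      (List.mem_filter.1 hj).1, (block_sorted k i).filter _, fun a ha b hb => ?_⟩
    obtain ⟨p, hp, ha⟩ := List.mem_flatMap.1 ha
    rw [List.mem_filter] at hp hb
    have h1 := hlow p hp.1 (by simpa using hp.2) a ha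
    rw [← mem_block.1 hb.1] at h1
    by_contra hle
    exact absurd (Nat.div_le_div_right (c := F ^ k) (Fin.le_def.1 (not_lt.1 hle))) (not_le.2 h1)
  · rw [List.mem_append, List.mem_flatMap, List.mem_filter, List.mem_filter, mem_block, mem_block]
    constructor
    · rintro (⟨p, hp, hj⟩ | ⟨hj, hji⟩)
      · rw [List.mem_filter] at hp
        have h1 := hlow p hp.1 (by simpa using hp.2) j hj
        refine ⟨?_, ?_⟩
        · rw [mem_block] at hj
          rw [← (mem_peers.1 hp.1).1, pow_succ, ← Nat.div_div_eq_div_mul,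
            ← Nat.div_div_eq_div_mul, hj]
        · simp only [decide_eq_true_eq]
          by_contra hle
          exact absurd (Nat.div_le_div_right (c := F ^ k) (Fin.le_def.1 (not_lt.1 hle)))
            (not_le.2 h1)
      · refine ⟨?_, hji⟩
        rw [pow_succ, ← Nat.div_div_eq_div_mul, ← Nat.div_div_eq_div_mul, hj]
    · rintro ⟨hj, hji⟩
      obtain ⟨p, hp, hjp⟩ := exists_peer hM hk hF hj
      simp only [decide_eq_true_eq] at hji
      by_cases e : (j : ℕ) / F ^ k = i / F ^ k
      · exact Or.inr ⟨e, by simpa using hji⟩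
      · refine Or.inl ⟨p, List.mem_filter.2 ⟨hp, ?_⟩, mem_block.2 hjp⟩
        simp only [decide_eq_true_eq]
        by_contra hle
        have h1 := Nat.div_le_div_right (c := F ^ k) (Fin.le_def.1 (not_lt.1 hle))
        have h2 := Nat.div_le_div_right (c := F ^ k) (Fin.le_def.1 hji.le)
        omega

theorem filter_eq_singleton {I : List (Fin M)} (hI : I.Pairwise (· < ·)) {i : Fin M} (hi : i ∈ I) :
    (I.filter fun j : Fin M => (j : ℕ) = i) = [i] := by
  refine (hI.filter _).eq_of_mem_iff (List.pairwise_singleton _ _) fun j => ?_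
  simp only [List.mem_filter, decide_eq_true_eq, List.mem_singleton]
  exact ⟨fun h => Fin.ext h.2, by rintro rfl; exact ⟨hi, rfl⟩⟩

/-- The invariant of the exchange: the messages of the peers carry the totals of the subblocks, and
adding the totals of the earlier ones to the prefix in the own subblock extends the prefix by one
digit. -/
theorem scanRead_scanState {D k : ℕ} (hM : M = F ^ D) (hk : k ≤ D) (hF : 0 < F) (i : Fin M) :
    scanRead κ x k i (scanState κ x F l k i) = (blockTotal x F l k i, blockPrefix x F l k i) := by
  cases k with
  | zero =>
    have hb : block F 0 i = [i] := by
      simpa [block, ← Fin.ext_iff] using filter_eq_singleton (List.pairwise_lt_finRange M)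
        (List.mem_finRange i)
    simp [scanRead, scanState, blockTotal, blockPrefix, hb]
  | succ k =>
    -- A machine also writes to itself; since its memory keeps only the items, its prefix survives
    -- in that message.
    have hself : i ∈ peers F k i := mem_peers.2 ⟨rfl, rfl⟩
    set g : Fin M → Record := fun j =>
      scanMessage κ j (blockTotal x F l k j, blockPrefix x F l k j) with hg
    have h1 : ((peers F k i).map g).filter (fun r => r.headI < (i : ℕ)) =
        ((peers F k i).filter fun j => j < i).map g := List.filter_map
    have h2 : ((peers F k i).map g).filter (fun r => r.headI = (i : ℕ)) =
        ((peers F k i).filter fun j : Fin M => (j : ℕ) = i).map g := List.filter_map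
    simp only [scanRead, scanState, Nat.add_eq_zero_iff, one_ne_zero, and_false, if_false,
      Nat.add_sub_cancel, combineMessages, ← hg]
    rw [h1, h2, filter_eq_singleton (peers_sorted k i) hself]
    simp only [List.map_map, Function.comp_def, hg, messageTotal_scanMessage,
      messagePrefix_scanMessage, List.map_cons, List.map_nil]
    refine Prod.ext ?_ ?_
    · simp only [blockTotal]
      rw [← flatMap_peers hM hk hF, sum_map_flatMap]
    · simp only [blockTotal, blockPrefix]
      rw [← flatMap_peers_prefix hM hk hF, List.map_append, List.sum_append, sum_map_flatMap]
      simp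

/-- Being peers is symmetric, and messages are ordered by sender, so the inbox lists the peers in
increasing order. -/
theorem scanStep_exec {D k : ℕ} (hM : M = F ^ D) (hk : k < D) (hF : 0 < F) :
    (scanStep κ x F k).exec (scanState κ x F l k) = scanState κ x F l (k + 1) := by
  funext j
  simp only [Step.exec, scanStep, scanRead_scanState κ x l hM hk.le hF]
  simp only [scanState, Nat.add_eq_zero_iff, one_ne_zero, and_false, if_false, Nat.add_sub_cancel,
    LocalState.mk.injEq, true_and]
  have : ∀ I : List (Fin M), (I.flatMap fun i => (((peers F k i).map fun j =>
      (j, scanMessage κ i (blockTotal x F l k i, blockPrefix x F l k i))).filter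
        fun msg => msg.1 = j).map Prod.snd) =
      (I.filter fun i : Fin M => (i : ℕ) / F ^ (k + 1) = j / F ^ (k + 1) ∧
        (i : ℕ) % F ^ k = j % F ^ k).map fun i : Fin M =>
        scanMessage κ i (blockTotal x F l k i, blockPrefix x F l k i) := by
    intro I
    induction I with
    | nil => rfl
    | cons i I ih =>
      rw [List.flatMap_cons, ih, List.filter_map, List.map_map, List.filter_cons]
      by_cases h : (i : ℕ) / F ^ (k + 1) = j / F ^ (k + 1) ∧ (i : ℕ) % F ^ k = j % F ^ k
      · have hj : j ∈ peers F k i := mem_peers.2 ⟨h.1.symm, h.2.symm⟩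
        have := filter_eq_singleton (peers_sorted k i) hj
        simp only [← Fin.ext_iff] at this
        simp only [Function.comp_def, this]
        simp [h]
      · have hj : ((peers F k i).filter fun a => a = j) = [] := by
          rw [List.filter_eq_nil_iff]
          intro a ha
          simp only [decide_eq_true_eq]
          rintro rfl
          exact h ⟨(mem_peers.1 ha).1.symm, (mem_peers.1 ha).2.symm⟩
        simp only [Function.comp_def, hj]
        simp [h]
  exact this _

theorem block_eq_finRange {D : ℕ} (hM : M = F ^ D) (i : Fin M) :
    block F D i = List.finRange M := by
  refine List.filter_eq_self.2 fun j _ => ?_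
  rw [← hM, Nat.div_eq_of_lt j.2, Nat.div_eq_of_lt i.2]
  simp

theorem fits_map_of_length_le {ι : Type*} {I : List ι} {g : ι → Record} {N R : ℕ}
    (hI : I.length ≤ N) (hg : ∀ i ∈ I, (g i).length + 1 ≤ R) (hS : N * R ≤ S)
    (hW : ∀ i ∈ I, ∀ w ∈ g i, w < W) : Fits S W (I.map g) := by
  refine ⟨?_, ?_⟩
  · have : recordsSize (I.map g) ≤ I.length * R := by
      unfold recordsSize
      rw [List.map_map]
      refine (List.sum_le_card_nsmul _ R ?_).trans (by simp)
      simpa using hg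
    exact this.trans ((Nat.mul_le_mul_right _ hI).trans hS)
  · simpa using hW

/-- Every sum that is sent runs over the items of some set of machines, which form a sublist of `L`;
this is why `hx` bounds the codes of the sums of all sublists. -/
theorem realizes_scan {D c r : ℕ} {L : List α} (hM : M = F ^ D) (hF : 0 < F)
    (hx : ∀ l' : List α, l'.Sublist L → ∀ w ∈ κ.enc (l'.map x).sum, w < W) (hMW : M ≤ W)
    (hc : c + 1 ≤ S) (hS : F * (2 * κ.len + 2) ≤ S) (hr : r * c + 1 ≤ S)
    (hL : ∀ a ∈ L, Encodable.encode a < W) (hf : ∀ t p a, (f t p a).length ≤ r)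
    (hf' : ∀ a ∈ scanMap x f (L.map x).sum 0 L, Encodable.encode a < W) :
    Realizes S W (scanSteps κ x f F M D) c L (r * c) (scanMap x f (L.map x).sum 0 L) := by
  rintro l rfl hlc
  have hsub : ∀ I : List (Fin M), I.Sublist (List.finRange M) →
      ∀ w ∈ κ.enc (I.map fun j => ((l j).map x).sum).sum, w < W := by
    intro I hI w hw
    rw [← sum_map_flatMap] at hw
    refine hx _ ?_ w hw
    rw [List.flatMap_def, List.flatMap_def]
    exact (hI.map l).flatten
  have hmsg : ∀ k (j : Fin M),
      (scanMessage κ j (blockTotal x F l k j, blockPrefix x F l k j)).length + 1 ≤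
        2 * κ.len + 2 ∧
      ∀ w ∈ scanMessage κ j (blockTotal x F l k j, blockPrefix x F l k j), w < W := by
    intro k j
    refine ⟨by simp [scanMessage, κ.length_enc]; omega, fun w hw => ?_⟩
    simp only [scanMessage, List.mem_cons, List.mem_append] at hw
    rcases hw with rfl | hw | hw
    · exact j.2.trans_le hMW
    · exact hsub _ List.filter_sublist w hw
    · exact hsub _ (List.filter_sublist.trans List.filter_sublist) w hw
  have hmem : ∀ i, ∀ a ∈ l i, Encodable.encode a < W := fun i a ha =>
    hL a (List.mem_flatMap.2 ⟨i, List.mem_finRange i, ha⟩)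
  have hstate : ∀ k, StateFits S W (scanState κ x F l k) := by
    intro k i
    refine ⟨fits_pack (by have := hlc i; omega) (hmem i), ?_⟩
    simp only [scanState]
    split_ifs with hk
    · exact fits_nil
    · exact fits_map_of_length_le (length_peers_le hF _ i) (fun (j : Fin M) _ => (hmsg _ j).1) hS
        fun (j : Fin M) _ => (hmsg _ j).2
  set l' : Fin M → List α' := fun i => scanMap x f (((List.finRange M).flatMap l).map x).sum
    (((List.finRange M).filter fun j => j < i).map fun j => ((l j).map x).sum).sum (l i) with hl'
  have hlen : ∀ i, (l' i).length ≤ r * c := fun i =>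
    (length_scanMap_le x f _ _ _ hf).trans (Nat.mul_le_mul_left r (hlc i))
  have hfinish : (scanFinish κ x f D).exec (scanState κ x F l D) = canon l' := by
    funext i
    simp only [Step.exec, scanFinish, scanRead_scanState κ x l hM le_rfl hF, canon]
    simp only [scanState, unpack_pack, blockTotal, blockPrefix, block_eq_finRange hM, hl',
      ← sum_map_flatMap]
    simp
  have hrun : ∀ E k, k + E = D → Runs S W ((List.range' k E).map (scanStep κ x F))
      (scanState κ x F l k) (scanState κ x F l D) := by
    intro E
    induction E with
    | zero => rintro k rfl; exact ⟨rfl, hstate _⟩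
    | succ E ih =>
      intro k hk
      rw [List.range'_succ, List.map_cons]
      refine ⟨hstate k, fun i => ?_, ?_⟩
      · simp only [scanStep, scanRead_scanState κ x l hM (by omega : k ≤ D) hF, List.map_map,
          Function.comp_def]
        exact fits_map_of_length_le (length_peers_le hF k i) (fun j _ => (hmsg k i).1) hS
          fun j _ => (hmsg k i).2
      · rw [scanStep_exec κ x l hM (by omega) hF]
        exact ih (k + 1) (by omega)
  refine ⟨l', (scanMap_flatMap x f _ l).symm, hlen, ?_⟩
  refine Runs.append (s' := scanState κ x F l D) ?_ ⟨hstate D, fun i => fits_nil, hfinish.symm, ?_⟩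
  · rw [List.range_eq_range']
    have := hrun D 0 (by simp)
    exact this
  · rw [hfinish]
    refine stateFits_canon (fun i => by have := hlen i; omega) fun i a ha => hf' a ?_
    rw [scanMap_flatMap]
    exact List.mem_flatMap.2 ⟨i, List.mem_finRange i, ha⟩

end scan

end MPC

namespace MPC

variable {M S W : ℕ}

/-! ### Sorting -/

/-- The code of vectors by their entries. -/
def vecCode (R : ℕ) : VecCode (Fin R → ℕ) where
  len := R
  enc v := List.ofFn v
  dec r := fun i => r.getD i 0
  dec_enc v := by funext i; simp
  length_enc v := by simp

theorem mem_enc_vecCode {R : ℕ} {v : Fin R → ℕ} {w : ℕ} (hw : w ∈ (vecCode R).enc v) :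
    ∃ i, v i = w := by
  simpa [vecCode, List.mem_ofFn] using hw

theorem list_sum_apply_le {α : Type} {R : ℕ} {x : α → Fin R → ℕ} (hx : ∀ a i, x a i ≤ 1)
    (l : List α) (i : Fin R) : (l.map x).sum i ≤ l.length := by
  induction l with
  | nil => simp
  | cons a l ih =>
    have := hx a i
    simp only [List.map_cons, List.sum_cons, Pi.add_apply, List.length_cons]
    omega

/-- Space bounds for a computation of `M = F ^ D` machines with capacity `C` (in items), where items
are encoded by numbers below `B`, and scans use at most `R` words. -/
structure Sizes (M S W D F C R B : ℕ) : Prop where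
  machines : M = F ^ D
  pos_F : 0 < F
  pos_C : 0 < C
  scan_le : F * (2 * R + 2) ≤ S
  cap_le : 4 * C + 1 ≤ S
  two_le : 2 ≤ B
  tag_le : M * C ≤ B
  sq_le : B * B ≤ W

namespace Sizes

variable {D F C R B : ℕ} (h : Sizes M S W D F C R B)
include h

theorem B_lt : B < W := by
  have := h.sq_le
  have := h.two_le
  nlinarith

theorem M_le : M ≤ W := by
  have h1 := h.tag_le
  have h2 := Nat.le_mul_of_pos_right M h.pos_C
  have := h.B_lt
  omega

end Sizes

section radix

variable {α : Type} {s : ℕ} (d : α → Fin s)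

/-- The rank of an item in the list that is stably sorted by `d`. -/
def stableRank (tot pre : Fin s → ℕ) (a : α) : ℕ := ∑ i ∈ Finset.Iio (d a), tot i + pre (d a)

theorem sum_Iio_add_le (tot : Fin s → ℕ) {i j : Fin s} (h : i < j) :
    ∑ k ∈ Finset.Iio i, tot k + tot i ≤ ∑ k ∈ Finset.Iio j, tot k := by
  rw [add_comm, ← Finset.sum_insert (by simp)]
  refine Finset.sum_le_sum_of_subset fun k hk => ?_
  rcases Finset.mem_insert.1 hk with rfl | hk
  · simpa using h
  · simpa using (Finset.mem_Iio.1 hk).trans h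

theorem sum_Iio_add_le_univ (tot : Fin s → ℕ) (i : Fin s) :
    ∑ k ∈ Finset.Iio i, tot k + tot i ≤ ∑ k, tot k := by
  rw [add_comm, ← Finset.sum_insert (by simp)]
  exact Finset.sum_le_sum_of_subset (Finset.subset_univ _)

/-- Items with a smaller digit occupy an earlier interval of ranks, and among equal digits the rank
grows along the list, which is stability. The ranks do not follow the list order, so the comparison
is stated symmetrically. In `htot` an inequality suffices, and it is preserved as `pre` absorbs
items. -/
theorem stableRank_spec {r : α → α → Prop} {tot pre : Fin s → ℕ} {L : List α} (hL : L.Pairwise r)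
    (htot : ∀ i, pre i + (L.map fun a => (Pi.single (d a) 1 : Fin s → ℕ)).sum i ≤ tot i) :
    (∀ p ∈ scanMap (fun a => (Pi.single (d a) 1 : Fin s → ℕ))
        (fun tot pre a => [(stableRank d tot pre a, a)]) tot pre L,
      p.2 ∈ L ∧ stableRank d tot pre p.2 ≤ p.1 ∧
        p.1 < ∑ i ∈ Finset.Iio (d p.2), tot i + tot (d p.2)) ∧
    (scanMap (fun a => (Pi.single (d a) 1 : Fin s → ℕ))
        (fun tot pre a => [(stableRank d tot pre a, a)]) tot pre L).Pairwise fun p q =>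
      (p.1 < q.1 ∧ (d p.2 < d q.2 ∨ d p.2 = d q.2 ∧ r p.2 q.2)) ∨
      (q.1 < p.1 ∧ (d q.2 < d p.2 ∨ d q.2 = d p.2 ∧ r q.2 p.2)) := by
  induction L generalizing pre with
  | nil => simp [scanMap]
  | cons a L ih =>
    rw [List.pairwise_cons] at hL
    have htot' : ∀ i, (pre + Pi.single (d a) 1 : Fin s → ℕ) i +
        (L.map fun a => (Pi.single (d a) 1 : Fin s → ℕ)).sum i ≤ tot i := by
      intro i
      have := htot i
      simp only [List.map_cons, List.sum_cons, Pi.add_apply] at this ⊢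
      omega
    obtain ⟨h1, h2⟩ := ih hL.2 htot'
    have ha : pre (d a) + 1 ≤ tot (d a) := by
      have := htot' (d a)
      simp only [Pi.add_apply, Pi.single_eq_same] at this
      omega
    have hmono : ∀ b, stableRank d tot pre b ≤ stableRank d tot (pre + Pi.single (d a) 1) b := by
      intro b
      simp only [stableRank, Pi.add_apply]
      omega
    simp only [scanMap, List.singleton_append, List.mem_cons, List.pairwise_cons]
    refine ⟨?_, fun q hq => ?_, h2⟩
    · rintro p (rfl | hp)
      · refine ⟨Or.inl rfl, le_rfl, ?_⟩
        simp only [stableRank]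
        omega
      · obtain ⟨h3, h4, h5⟩ := h1 p hp
        exact ⟨Or.inr h3, (hmono _).trans h4, h5⟩
    · obtain ⟨h3, h4, h5⟩ := h1 q hq
      rcases lt_trichotomy (d a) (d q.2) with hlt | heq | hgt
      · refine Or.inl ⟨?_, Or.inl hlt⟩
        have := sum_Iio_add_le tot hlt
        simp only [stableRank] at h4 ⊢
        omega
      · refine Or.inl ⟨?_, Or.inr ⟨heq, hL.1 _ h3⟩⟩
        simp only [stableRank, ← heq, Pi.add_apply, Pi.single_eq_same] at h4 ⊢
        omega
      · refine Or.inr ⟨?_, Or.inl hgt⟩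
        have := sum_Iio_add_le tot hgt
        simp only [stableRank]
        omega

theorem map_snd_scanMap {β : Type} [AddMonoid β] (x : α → β) (g : β → β → α → ℕ) (tot pre : β)
    (L : List α) : (scanMap x (fun tot pre a => [(g tot pre a, a)]) tot pre L).map Prod.snd = L := by
  induction L generalizing pre with
  | nil => rfl
  | cons a L ih => simp [scanMap, ih]

theorem sum_sum_single (L : List α) :
    ∑ i, (L.map fun a => (Pi.single (d a) 1 : Fin s → ℕ)).sum i = L.length := by
  induction L with
  | nil => simp
  | cons a L ih =>
    simp only [List.map_cons, List.sum_cons, Pi.add_apply, Finset.sum_add_distrib, ih,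
      List.length_cons]
    simp [add_comm]

variable [Denumerable α]

/-- Stable sorting of the items by the digit `d`. -/
def passSteps (M D F C : ℕ) : List (Step M) :=
  scanSteps (vecCode s) (fun a => (Pi.single (d a) 1 : Fin s → ℕ))
    (fun tot pre a => [(stableRank d tot pre a, a)]) F M D ++ routeSteps M α C

theorem encode_pair_lt {t B : ℕ} {a : α} (ht : t < B) (ha : Encodable.encode a < B)
    (hB : B * B ≤ W) : Encodable.encode (t, a) < W := by
  refine lt_of_lt_of_le ?_ hB
  have := Nat.pair_lt_max_add_one_sq t (Encodable.encode a)
  rw [Encodable.encode_prod_val, Encodable.encode_nat]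
  refine this.trans_le ?_
  rw [pow_two]
  exact Nat.mul_self_le_mul_self (by omega)

/-- Ranks are distinct and below the number of items, so they serve as routing tags. With any `s`,
the pass also balances the loads down to `C`. -/
theorem realizes_pass {D F C R B c : ℕ} (h : Sizes M S W D F C R B) (hs : s ≤ R) {L : List α}
    (hB : ∀ a ∈ L, Encodable.encode a < B) (hlen : L.length ≤ M * C) (hc : 2 * c + 1 ≤ S) :
    ∃ L' : List α, L'.Perm L ∧
      (∀ r : α → α → Prop, L.Pairwise r →
        L'.Pairwise fun a b => d a < d b ∨ d a = d b ∧ r a b) ∧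
      Realizes S W (passSteps d M D F C) c L C L' := by
  set T := scanMap (fun a => (Pi.single (d a) 1 : Fin s → ℕ))
    (fun tot pre a => [(stableRank d tot pre a, a)])
    (L.map fun a => (Pi.single (d a) 1 : Fin s → ℕ)).sum 0 L with hT
  have hspec := fun r hr => stableRank_spec (r := r) (pre := 0) d (L := L) hr
    (tot := (L.map fun a => (Pi.single (d a) 1 : Fin s → ℕ)).sum) (by simp)
  have htriv : L.Pairwise fun _ _ => True := List.pairwise_of_forall (by simp)
  have htag : ∀ p ∈ T, p.2 ∈ L ∧ p.1 < L.length := by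
    intro p hp
    obtain ⟨h1, -, h2⟩ := (hspec _ htriv).1 p hp
    refine ⟨h1, h2.trans_le ?_⟩
    rw [← sum_sum_single d L]
    exact sum_Iio_add_le_univ _ _
  have hnd : (T.map Prod.fst).Nodup := by
    refine List.pairwise_map.2 ((hspec _ htriv).2.imp ?_)
    rintro p q (⟨h1, -⟩ | ⟨h1, -⟩)
    · exact h1.ne
    · exact h1.ne'
  have hBW := h.B_lt
  have hTB : ∀ p ∈ T, Encodable.encode p < W := fun p hp =>
    encode_pair_lt ((htag p hp).2.trans_le (hlen.trans h.tag_le)) (hB _ (htag p hp).1) h.sq_le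
  have hscan : Realizes S W (scanSteps (vecCode s) (fun a => (Pi.single (d a) 1 : Fin s → ℕ))
      (fun tot pre a => [(stableRank d tot pre a, a)]) F M D) c L (1 * c) T := by
    refine realizes_scan (vecCode s) _ _ h.machines h.pos_F ?_ h.M_le (by omega) ?_ (by omega)
      (fun a ha => (hB a ha).trans hBW) (fun _ _ _ => le_rfl) hTB
    · intro l' hl' w hw
      obtain ⟨i, rfl⟩ := mem_enc_vecCode hw
      have h1 := list_sum_apply_le (x := fun a => (Pi.single (d a) 1 : Fin s → ℕ))
        (fun a i => by by_cases hi : i = d a <;> simp [hi]) l' i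
      have h2 := hl'.length_le
      have h3 := h.tag_le
      omega
    · refine le_trans (Nat.mul_le_mul_left F ?_) h.scan_le
      simp only [vecCode]
      omega
  rw [one_mul] at hscan
  obtain ⟨T', hperm, hsort, hroute⟩ := realizes_route (M := M) (S := S) (W := W) (c := c) h.pos_C
    hnd (fun p hp => (htag p hp).2.trans_le hlen) hTB
    (fun p hp => (hB _ (htag p hp).1).trans hBW) hc (by have := h.cap_le; omega)
  refine ⟨T'.map Prod.snd, ?_, fun r hr => ?_, hscan.append hroute⟩
  · have := hperm.map Prod.snd
    rwa [hT, map_snd_scanMap] at this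
  · rw [List.pairwise_map]
    have hpair := (hspec r hr).2
    -- The relation is symmetric, so it survives the permutation done by the routing.
    have hpair' := (hperm.pairwise_iff (fun {p q} hpq => Or.symm hpq)).2 hpair
    refine (hsort.and hpair').imp ?_
    rintro p q ⟨h1, ⟨-, h2⟩ | ⟨h2, -⟩⟩
    · exact h2
    · exact absurd h1 h2.asymm

/-- Sort the items by `φ`, digit by digit in base `s`. -/
def sortSteps (φ : α → ℕ) (hs : 0 < s) (p M D F C : ℕ) : List (Step M) :=
  (List.range p).flatMap fun j =>
    passSteps (fun a => (⟨φ a / s ^ j % s, Nat.mod_lt _ hs⟩ : Fin s)) M D F C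

theorem length_scanSteps {α' β : Type} [AddMonoid β] [Denumerable α'] (κ : VecCode β) (x : α → β)
    (f : β → β → α → List α') (F M D : ℕ) : (scanSteps κ x f F M D).length = D + 1 := by
  simp [scanSteps]

theorem length_passSteps (M D F C : ℕ) : (passSteps d M D F C).length = D + 3 := by
  simp [passSteps, length_scanSteps, routeSteps]

theorem length_sortSteps (φ : α → ℕ) (hs : 0 < s) (p M D F C : ℕ) :
    (sortSteps φ hs p M D F C).length = p * (D + 3) := by
  simp [sortSteps, length_passSteps]

/-- Radix sort from the lowest digit: stability keeps the order modulo `s ^ j` among items with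
equal digit `j`. At least one pass is made, so the load drops from `c` to `C`. -/
theorem realizes_sort {D F C R B c : ℕ} (h : Sizes M S W D F C R B) (hs : 0 < s) (hsR : s ≤ R)
    {L : List α} (φ : α → ℕ) (hB : ∀ a ∈ L, Encodable.encode a < B) (hlen : L.length ≤ M * C)
    (hc : 2 * c + 1 ≤ S) (p : ℕ) :
    ∃ L' : List α, L'.Perm L ∧ L'.Pairwise (fun a b => φ a % s ^ (p + 1) ≤ φ b % s ^ (p + 1)) ∧
      Realizes S W (sortSteps φ hs (p + 1) M D F C) c L C L' := by
  have step : ∀ (j : ℕ) (L₁ L₂ : List α),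
      L₁.Pairwise (fun a b => φ a % s ^ j ≤ φ b % s ^ j) →
      (∀ r : α → α → Prop, L₁.Pairwise r → L₂.Pairwise fun a b =>
        (⟨φ a / s ^ j % s, Nat.mod_lt _ hs⟩ : Fin s) < ⟨φ b / s ^ j % s, Nat.mod_lt _ hs⟩ ∨
        (⟨φ a / s ^ j % s, Nat.mod_lt _ hs⟩ : Fin s) = ⟨φ b / s ^ j % s, Nat.mod_lt _ hs⟩ ∧
          r a b) →
      L₂.Pairwise (fun a b => φ a % s ^ (j + 1) ≤ φ b % s ^ (j + 1)) := by
    intro j L₁ L₂ h1 h2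
    refine (h2 _ h1).imp fun {a b} hab => ?_
    simp only [Fin.mk_lt_mk, Fin.mk.injEq] at hab
    rw [Nat.mod_pow_succ, Nat.mod_pow_succ]
    rcases hab with hab | ⟨hab, hle⟩
    · have ha : φ a % s ^ j < s ^ j := Nat.mod_lt _ (pow_pos hs j)
      have := Nat.mul_le_mul_left (s ^ j) (Nat.succ_le_of_lt hab)
      rw [Nat.mul_succ] at this
      generalize φ b % s ^ j = t
      omega
    · rw [hab]
      omega
  induction p with
  | zero =>
    obtain ⟨L', hp, hr, hreal⟩ := realizes_pass (c := c)
      (fun a => (⟨φ a / s ^ 0 % s, Nat.mod_lt _ hs⟩ : Fin s)) h hsR hB hlen hc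
    refine ⟨L', hp, step 0 L L' ?_ hr, ?_⟩
    · exact List.pairwise_of_forall fun a b => by simp [Nat.mod_one]
    · simpa [sortSteps] using hreal
  | succ p ih =>
    obtain ⟨L₁, hp₁, hs₁, hreal₁⟩ := ih
    obtain ⟨L', hp, hr, hreal⟩ := realizes_pass (c := C) (L := L₁)
      (fun a => (⟨φ a / s ^ (p + 1) % s, Nat.mod_lt _ hs⟩ : Fin s)) h hsR
      (fun a ha => hB a (hp₁.mem_iff.1 ha)) (hp₁.length_eq ▸ hlen)
      (by have := h.cap_le; omega)
    refine ⟨L', hp.trans hp₁, step (p + 1) L₁ L' hs₁ hr, ?_⟩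
    rw [sortSteps, List.range_succ, List.flatMap_append]
    refine Realizes.append hreal₁ ?_
    simpa using hreal

theorem realizes_sort_of_lt {D F C R B c p : ℕ} (h : Sizes M S W D F C R B) (hs : 0 < s)
    (hsR : s ≤ R) {L : List α} (φ : α → ℕ) (hB : ∀ a ∈ L, Encodable.encode a < B)
    (hlen : L.length ≤ M * C) (hc : 2 * c + 1 ≤ S) (hp : 0 < p) (hφ : ∀ a ∈ L, φ a < s ^ p) :
    ∃ L' : List α, L'.Perm L ∧ L'.Pairwise (fun a b => φ a ≤ φ b) ∧
      Realizes S W (sortSteps φ hs p M D F C) c L C L' := by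
  obtain ⟨p, rfl⟩ := Nat.exists_eq_succ_of_ne_zero hp.ne'
  obtain ⟨L', h1, h2, h3⟩ := realizes_sort h hs hsR φ hB hlen hc p
  refine ⟨L', h1, List.Pairwise.imp_of_mem (fun {a b} ha hb hab => ?_) h2, h3⟩
  rwa [Nat.mod_eq_of_lt (hφ a (h1.mem_iff.1 ha)), Nat.mod_eq_of_lt (hφ b (h1.mem_iff.1 hb))] at hab

end radix

end MPC

namespace MPC

variable {M S W : ℕ}

/-! ### Heads of runs -/

/-- A key with a payload, or nothing. -/
structure Head where
  val : Option (ℕ × ℕ)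

namespace Head

instance : Zero Head := ⟨⟨none⟩⟩

/-- The summand with the larger key; for equal keys, the first summand. -/
instance : Add Head := ⟨fun a b => match a.val, b.val with
  | none, _ => b
  | some _, none => a
  | some u, some v => if v.1 ≤ u.1 then a else b⟩

theorem some_add_some (u v : ℕ × ℕ) :
    (⟨some u⟩ + ⟨some v⟩ : Head) = if v.1 ≤ u.1 then ⟨some u⟩ else ⟨some v⟩ := rfl

theorem none_add (b : Head) : (⟨none⟩ + b : Head) = b := rfl

theorem add_none (b : Head) : (b + ⟨none⟩ : Head) = b := by
  rcases b with ⟨_ | u⟩ <;> rfl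

/-- Associative but not commutative: the leftmost summand among those with the largest key survives.
Along a list with increasing keys, a prefix sum is thus the first item of the current run. -/
instance : AddMonoid Head where
  zero_add := none_add
  add_zero := add_none
  add_assoc := by
    rintro ⟨_ | a⟩ ⟨_ | b⟩ ⟨_ | c⟩ <;>
      simp only [none_add, add_none, some_add_some]
    split_ifs <;> simp only [some_add_some] <;> split_ifs <;> first | rfl | omega
  nsmul := nsmulRec

/-- The code of a head by two words. -/
def code : VecCode Head where
  len := 2
  enc h := match h.val with
    | none => [0, 0]
    | some u => [u.1 + 1, u.2]
  dec r := if r.headI = 0 then ⟨none⟩ else ⟨some (r.headI - 1, r.tail.headI)⟩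
  dec_enc h := by rcases h with ⟨_ | u⟩ <;> simp
  length_enc h := by rcases h with ⟨_ | u⟩ <;> rfl

/-- A sum always selects one of its summands, so partial sums need no larger words than single
items. -/
theorem sum_map_eq {α : Type} (key pay : α → ℕ) (l : List α) :
    (l.map fun a => (⟨some (key a, pay a)⟩ : Head)).sum = 0 ∨
      ∃ h ∈ l, (l.map fun a => (⟨some (key a, pay a)⟩ : Head)).sum = ⟨some (key h, pay h)⟩ := by
  induction l with
  | nil => exact Or.inl rfl
  | cons a l ih =>
    right
    rw [List.map_cons, List.sum_cons]
    rcases ih with ih | ⟨h, hl, ih⟩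
    · exact ⟨a, by simp, by rw [ih, add_zero]⟩
    · rw [ih, some_add_some]
      split_ifs
      · exact ⟨a, by simp, rfl⟩
      · exact ⟨h, by simp [hl], rfl⟩

theorem enc_sum_lt {α : Type} {key pay : α → ℕ} {l : List α} (hW : 0 < W)
    (hk : ∀ a ∈ l, key a + 1 < W) (hp : ∀ a ∈ l, pay a < W) :
    ∀ w ∈ code.enc (l.map fun a => (⟨some (key a, pay a)⟩ : Head)).sum, w < W := by
  intro w hw
  rcases sum_map_eq key pay l with h | ⟨a, ha, h⟩
  · rw [h] at hw
    have : w ∈ [0, 0] := hw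
    have : w = 0 := by simpa using this
    omega
  · rw [h] at hw
    have : w ∈ [key a + 1, pay a] := hw
    rcases List.mem_pair.1 this with rfl | rfl
    · exact hk a ha
    · exact hp a ha

/-- The payload of a head. -/
def payload (h : Head) : ℕ := (h.val.getD (0, 0)).2

/-- In a sorted list, a scan transmits to every item the payload of the first item that has the same
key. -/
theorem scanMap_head {α α' : Type} {key pay φ : α → ℕ} (g : α → ℕ → α') {tot : Head} {L : List α}
    (hL : L.Pairwise fun a b => φ a ≤ φ b)
    (hkey : ∀ a ∈ L, ∀ b ∈ L, φ a ≤ φ b → key a ≤ key b) {N : ℕ → ℕ}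
    (hN : ∀ h ∈ L, (∀ b ∈ L, key b = key h → φ h ≤ φ b) → pay h = N (key h)) :
    scanMap (fun a => (⟨some (key a, pay a)⟩ : Head))
      (fun _ pre a => [g a (payload (pre + ⟨some (key a, pay a)⟩))]) tot 0 L =
      L.map fun a => g a (N (key a)) := by
  -- Invariant: after reading `L₁`, the prefix sum is a `φ`-least item of the largest key in `L₁`.
  -- Ties in `φ` are harmless, since `hN` gives the same payload for every minimal item.
  have main : ∀ (L₂ L₁ : List α) (pre : Head), L = L₁ ++ L₂ →
      (L₁ = [] ∧ pre = 0 ∨ ∃ h ∈ L₁, (∀ b ∈ L₁, key b = key h → φ h ≤ φ b) ∧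
        (∀ b ∈ L₁, key b ≤ key h) ∧ pre = ⟨some (key h, pay h)⟩) →
      scanMap (fun a => (⟨some (key a, pay a)⟩ : Head))
        (fun _ pre a => [g a (payload (pre + ⟨some (key a, pay a)⟩))]) tot pre L₂ =
        L₂.map fun a => g a (N (key a)) := by
    intro L₂
    induction L₂ with
    | nil => intros; rfl
    | cons a L₂ ih =>
      intro L₁ pre hL₁ hpre
      have hord := hL
      rw [hL₁, List.pairwise_append, List.pairwise_cons] at hord
      have hmem : ∀ b, b ∈ L ↔ b ∈ L₁ ∨ b = a ∨ b ∈ L₂ := by simp [hL₁]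
      have hnew : ∃ h ∈ L₁ ++ [a], (∀ b ∈ L₁ ++ [a], key b = key h → φ h ≤ φ b) ∧
          (∀ b ∈ L₁ ++ [a], key b ≤ key h) ∧ key h = key a ∧
          pre + ⟨some (key a, pay a)⟩ = ⟨some (key h, pay h)⟩ := by
        rcases hpre with ⟨rfl, rfl⟩ | ⟨h, hh, h1, h2, rfl⟩
        · exact ⟨a, by simp, by simp, by simp, rfl, zero_add _⟩
        · have hle : key h ≤ key a :=
            hkey h ((hmem h).2 (Or.inl hh)) a ((hmem a).2 (by simp)) (hord.2.2 h hh a (by simp))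
          rw [some_add_some]
          split_ifs with hc
          · refine ⟨h, by simp [hh], ?_, ?_, le_antisymm hle hc, rfl⟩
            · intro b hb hbk
              rcases List.mem_append.1 hb with hb | hb
              · exact h1 b hb hbk
              · obtain rfl := List.mem_singleton.1 hb
                exact hord.2.2 h hh b (by simp)
            · intro b hb
              rcases List.mem_append.1 hb with hb | hb
              · exact h2 b hb
              · obtain rfl := List.mem_singleton.1 hb
                exact hc
          · simp only [not_le] at hc
            refine ⟨a, by simp, ?_, ?_, rfl, rfl⟩
            · intro b hb hbk
              rcases List.mem_append.1 hb with hb | hb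
              · have := h2 b hb
                omega
              · obtain rfl := List.mem_singleton.1 hb
                exact le_rfl
            · intro b hb
              rcases List.mem_append.1 hb with hb | hb
              · have := h2 b hb
                omega
              · obtain rfl := List.mem_singleton.1 hb
                exact le_rfl
      obtain ⟨h, hh, h1, h2, h3, h4⟩ := hnew
      have hpay : pay h = N (key a) := by
        rw [← h3]
        refine hN h ((hmem h).2 (by simpa [or_assoc] using Or.inl (b := h ∈ L₂) hh)) fun b hb hbk => ?_
        rcases (hmem b).1 hb with hb | rfl | hb
        · exact h1 b (by simp [hb]) hbk
        · exact h1 b (by simp) hbk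
        · rcases List.mem_append.1 hh with hh | hh
          · exact hord.2.2 h hh b (by simp [hb])
          · obtain rfl := List.mem_singleton.1 hh
            exact hord.2.1.1 b hb
      rw [scanMap, List.map_cons, h4, ih (L₁ ++ [a]) _ (by simp [hL₁]) (Or.inr ⟨h, hh, h1, h2, rfl⟩)]
      simp [payload, hpay]
  exact main L [] 0 rfl (Or.inl ⟨rfl, rfl⟩)

/-- In a sorted list, a scan removes the repetitions. -/
theorem scanMap_dedup {α : Type} {φ : α → ℕ} {tot : Head} {L : List α}
    (hL : L.Pairwise fun a b => φ a ≤ φ b) (hφ : ∀ a ∈ L, ∀ b ∈ L, φ a = φ b → a = b)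
    {pre : Head} (hpre : ∀ u ∈ pre.val, ∀ a ∈ L, u.1 ≤ φ a) :
    (scanMap (fun a => (⟨some (φ a, 0)⟩ : Head))
      (fun _ pre a => if pre.val.map Prod.fst = some (φ a) then [] else [a]) tot pre L).Pairwise
        (fun a b => φ a < φ b) ∧
    (∀ a ∈ scanMap (fun a => (⟨some (φ a, 0)⟩ : Head))
      (fun _ pre a => if pre.val.map Prod.fst = some (φ a) then [] else [a]) tot pre L,
        a ∈ L ∧ ∀ u ∈ pre.val, u.1 < φ a) ∧
    (∀ a ∈ L, pre.val.map Prod.fst = some (φ a) ∨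
      a ∈ scanMap (fun a => (⟨some (φ a, 0)⟩ : Head))
        (fun _ pre a => if pre.val.map Prod.fst = some (φ a) then [] else [a]) tot pre L) := by
  induction L generalizing pre with
  | nil => simp [scanMap]
  | cons a L ih =>
    rw [List.pairwise_cons] at hL
    -- Once `a` is read, the prefix carries the key `φ a`; so a later item is a repetition exactly
    -- if the prefix before it already has its key.
    have hkey : ((pre + ⟨some (φ a, 0)⟩ : Head)).val.map Prod.fst = some (φ a) := by
      rcases pre with ⟨_ | u⟩
      · rfl
      · have := hpre u rfl a (by simp)
        rw [some_add_some]
        split_ifs with hc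
        · have : u.1 = φ a := le_antisymm this hc
          simp [this]
        · rfl
    have hkey' : ∀ u ∈ (pre + ⟨some (φ a, 0)⟩ : Head).val, u.1 = φ a := by
      intro u hu
      rw [Option.mem_def] at hu
      rw [hu] at hkey
      simpa using hkey
    obtain ⟨u₀, hu₀, hu₀'⟩ := Option.map_eq_some_iff.1 hkey
    obtain ⟨h1, h2, h3⟩ := ih hL.2 (fun b hb c hc => hφ b (by simp [hb]) c (by simp [hc]))
      (pre := pre + ⟨some (φ a, 0)⟩) (fun u hu b hb => by rw [hkey' u hu]; exact hL.1 b hb)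
    have h2' : ∀ b ∈ scanMap (fun a => (⟨some (φ a, 0)⟩ : Head))
        (fun _ pre a => if pre.val.map Prod.fst = some (φ a) then [] else [a]) tot
        (pre + ⟨some (φ a, 0)⟩) L, b ∈ L ∧ φ a < φ b := fun b hb =>
      ⟨(h2 b hb).1, hu₀' ▸ (h2 b hb).2 u₀ hu₀⟩
    rw [hkey] at h3
    simp only [scanMap]
    split_ifs with hc
    · have hpa : ∀ u ∈ pre.val, u.1 = φ a := by
        intro u hu
        rw [Option.mem_def] at hu
        rw [hu] at hc
        simpa using hc
      refine ⟨by simpa using h1, fun b hb => ?_, fun b hb => ?_⟩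
      · have := h2' b (by simpa using hb)
        exact ⟨by simp [this.1], fun u hu => hpa u hu ▸ this.2⟩
      · rw [hc]
        rcases List.mem_cons.1 hb with rfl | hb
        · exact Or.inl rfl
        · simpa using h3 b hb
    · simp only [List.singleton_append, List.pairwise_cons, List.mem_cons]
      refine ⟨⟨fun b hb => (h2' b hb).2, h1⟩, ?_, ?_⟩
      · have hlt : ∀ u ∈ pre.val, u.1 < φ a := by
          intro u hu
          refine lt_of_le_of_ne (hpre u hu a (by simp)) fun e => hc ?_
          rw [Option.mem_def] at hu
          rw [hu, Option.map_some, e]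
        rintro b (rfl | hb)
        · exact ⟨Or.inl rfl, hlt⟩
        · exact ⟨Or.inr (h2' b hb).1, fun u hu => (hlt u hu).trans (h2' b hb).2⟩
      · rintro b (rfl | hb)
        · exact Or.inr (Or.inl rfl)
        · rcases h3 b hb with h | h
          · refine Or.inr (Or.inl (hφ b (by simp [hb]) a (by simp) ?_))
            simpa using h.symm
          · exact Or.inr (Or.inr h)

end Head

/-! ### Items -/

/-- An item `(t, a, b, p, q)`: for `t = 0`, an edge from `a` to `b`; for `t = 1`, a vertex `b` with
its representative `a`. The last two entries are for temporary information about `a` and `b`. -/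
abbrev Item : Type := ℕ × ℕ × ℕ × ℕ × ℕ

namespace Item

/-- The entries of an item are small. -/
def Small (X : ℕ) (it : Item) : Prop :=
  it.1 < 2 ∧ it.2.1 + 1 < X ∧ it.2.2.1 + 1 < X ∧ it.2.2.2.1 < X ∧ it.2.2.2.2 < X

/-- Each of the four nested pairings at most squares the bound. -/
theorem Small.encode_lt {X : ℕ} {it : Item} (h : it.Small X) : Encodable.encode it < X ^ 16 := by
  obtain ⟨t, a, b, p, q⟩ := it
  obtain ⟨ht, ha, hb, hp, hq⟩ := h
  simp only at ht ha hb hp hq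
  have hX : 2 < X ∨ X = 2 ∨ X < 2 := by omega
  have hX1 : 1 ≤ X := by omega
  have h1 : Encodable.encode (p, q) < X ^ 2 := encode_pair_lt hp (by simpa using hq) (by rw [pow_two])
  have h2 : Encodable.encode (b, p, q) < X ^ 4 :=
    encode_pair_lt (B := X ^ 2) (by have := Nat.le_self_pow two_ne_zero X; omega) h1
      (by rw [← pow_add])
  have h3 : Encodable.encode (a, b, p, q) < X ^ 8 :=
    encode_pair_lt (B := X ^ 4) (by have := Nat.le_self_pow four_ne_zero X; omega) h2
      (by rw [← pow_add])
  exact encode_pair_lt (B := X ^ 8)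
    (by have := Nat.le_self_pow (by norm_num : 8 ≠ 0) X; omega) h3 (by rw [← pow_add])

/-- The order of the items: by their first vertex, edges first, then by their second vertex. -/
def order (X : ℕ) (it : Item) : ℕ := (it.2.1 * 2 + it.1) * X + it.2.2.1

theorem order_le_iff {X : ℕ} {i j : Item} (hi : i.Small X) (hj : j.Small X) :
    i.order X ≤ j.order X ↔ i.2.1 < j.2.1 ∨ i.2.1 = j.2.1 ∧
      (i.1 < j.1 ∨ i.1 = j.1 ∧ i.2.2.1 ≤ j.2.2.1) := by
  obtain ⟨t, a, b, p, q⟩ := i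
  obtain ⟨t', a', b', p', q'⟩ := j
  obtain ⟨ht, ha, hb, -⟩ := hi
  obtain ⟨ht', ha', hb', -⟩ := hj
  simp only [order] at *
  rcases lt_trichotomy (a * 2 + t) (a' * 2 + t') with h | h | h
  · have := Nat.mul_le_mul_right X (Nat.succ_le_of_lt h)
    rw [Nat.succ_mul] at this
    constructor <;> intro <;> omega
  · rw [h]
    constructor <;> intro <;> omega
  · have := Nat.mul_le_mul_right X (Nat.succ_le_of_lt h)
    rw [Nat.succ_mul] at this
    constructor <;> intro <;> omega

theorem order_lt {X : ℕ} {it : Item} (h : it.Small X) : it.order X < X ^ 3 := by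
  obtain ⟨t, a, b, p, q⟩ := it
  obtain ⟨ht, ha, hb, -⟩ := h
  simp only [order] at *
  have h1 : a * 2 + t + 1 ≤ X * X := by nlinarith
  have h2 := Nat.mul_le_mul_right X h1
  rw [add_mul, one_mul] at h2
  have : X ^ 3 = X * X * X := by ring
  omega

/-- The payload that tells the items with first vertex `a` about a neighbour of `a`. -/
def pay (it : Item) : ℕ := if it.1 = 0 then it.2.2.1 + 1 else 0

/-- Exchange the two vertices, and store information about the first one. -/
def turn (it : Item) (v : ℕ) : Item := (it.1, it.2.2.1, it.2.1, it.2.2.2.2, v)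

end Item

open Classical in
/-- The least `b` with `e a b`, plus one, or zero if there is none. -/
noncomputable def leastNbr (e : ℕ → ℕ → Prop) (a : ℕ) : ℕ := if h : ∃ b, e a b then Nat.find h + 1 else 0

/-- The edges among the items. -/
def edgeRel (L : List Item) (a b : ℕ) : Prop := ∃ it ∈ L, it.1 = 0 ∧ it.2.1 = a ∧ it.2.2.1 = b

/-- Among the items with a given first vertex, edges precede vertex items and are ordered by their
other end. So the first item is the edge to the least neighbour, or a vertex item if there is no
edge. -/
theorem pay_eq_leastNbr {X : ℕ} {L : List Item} (hX : ∀ it ∈ L, it.Small X) {i : Item} (hi : i ∈ L)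
    (hmin : ∀ j ∈ L, j.2.1 = i.2.1 → i.order X ≤ j.order X) :
    i.pay = leastNbr (edgeRel L) i.2.1 := by
  classical
  unfold leastNbr Item.pay
  by_cases h0 : i.1 = 0
  · have hex : ∃ b, edgeRel L i.2.1 b := ⟨i.2.2.1, i, hi, h0, rfl, rfl⟩
    rw [if_pos h0, dif_pos hex, Nat.add_right_cancel_iff, eq_comm, Nat.find_eq_iff]
    refine ⟨⟨i, hi, h0, rfl, rfl⟩, ?_⟩
    rintro b hb ⟨j, hj, hj0, hja, rfl⟩
    have := (Item.order_le_iff (hX i hi) (hX j hj)).1 (hmin j hj hja)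
    omega
  · rw [if_neg h0, dif_neg]
    rintro ⟨b, j, hj, hj0, hja, rfl⟩
    have := (Item.order_le_iff (hX i hi) (hX j hj)).1 (hmin j hj hja)
    omega

theorem leastNbr_lt {X : ℕ} {L : List Item} (hX : ∀ it ∈ L, it.Small X) {a : ℕ} (h0 : 0 < X) :
    leastNbr (edgeRel L) a < X := by
  classical
  unfold leastNbr
  split_ifs with h
  · obtain ⟨it, hit, -, -, hb⟩ := Nat.find_spec h
    rw [← hb]
    exact (hX it hit).2.2.1
  · exact h0

/-- Store in every item information about its first vertex, and exchange the two vertices. -/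
def attachSteps (X : ℕ) {s : ℕ} (hs : 0 < s) (p M D F C : ℕ) : List (Step M) :=
  sortSteps (Item.order X) hs p M D F C ++
    scanSteps Head.code (fun it : Item => (⟨some (it.2.1, it.pay)⟩ : Head))
      (fun _ pre it => [it.turn (pre + ⟨some (it.2.1, it.pay)⟩).payload]) F M D

theorem length_attachSteps (X : ℕ) {s : ℕ} (hs : 0 < s) (p M D F C : ℕ) :
    (attachSteps X hs p M D F C).length = p * (D + 3) + (D + 1) := by
  simp [attachSteps, length_sortSteps, length_scanSteps]

/-- Sorting makes the items with a common first vertex contiguous, and the `Head` scan spreads the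
payload of the first one, which is the least neighbour plus one, or zero. -/
theorem realizes_attach {D F C R B X p c s : ℕ} (h : Sizes M S W D F C R B) (hs : 0 < s)
    (hsR : s ≤ R) (hR : 2 ≤ R) (hXB : X ^ 16 ≤ B) (hp : 0 < p) (hXp : X ^ 3 ≤ s ^ p) {L : List Item}
    (hX : ∀ it ∈ L, it.Small X) (hlen : L.length ≤ M * C) (hc : 2 * c + 1 ≤ S) :
    ∃ L' : List Item, L'.Perm (L.map fun it => it.turn (leastNbr (edgeRel L) it.2.1)) ∧
      (∀ it ∈ L', it.Small X) ∧ Realizes S W (attachSteps X hs p M D F C) c L C L' := by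
  have hB : ∀ it ∈ L, Encodable.encode it < B := fun it hit => (hX it hit).encode_lt.trans_le hXB
  obtain ⟨L₁, hperm, hsort, hreal⟩ := realizes_sort_of_lt h hs hsR (Item.order X) hB hlen hc hp
    fun it hit => (Item.order_lt (hX it hit)).trans_le hXp
  have hX₁ : ∀ it ∈ L₁, it.Small X := fun it hit => hX it (hperm.mem_iff.1 hit)
  have hedge : edgeRel L₁ = edgeRel L := by
    funext a b
    simp only [edgeRel, hperm.mem_iff]
  have hturn : ∀ it ∈ L₁.map (fun it => it.turn (leastNbr (edgeRel L₁) it.2.1)), it.Small X := by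
    intro it hit
    obtain ⟨j, hj, rfl⟩ := List.mem_map.1 hit
    obtain ⟨h1, h2, h3, h4, h5⟩ := hX₁ j hj
    exact ⟨h1, h3, h2, h5, leastNbr_lt hX₁ (by omega)⟩
  have hscanMap := Head.scanMap_head (key := fun it : Item => it.2.1) (pay := Item.pay)
    (φ := Item.order X) Item.turn
    (tot := (L₁.map fun it : Item => (⟨some (it.2.1, it.pay)⟩ : Head)).sum) hsort
    (fun i hi j hj hij => by
      have := (Item.order_le_iff (hX₁ i hi) (hX₁ j hj)).1 hij
      omega)
    (N := leastNbr (edgeRel L₁)) (fun i hi hmin => pay_eq_leastNbr hX₁ hi hmin)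
  have hBW := h.B_lt
  have hXB' : 0 < X → X ≤ B := fun h0 => (Nat.le_self_pow (by norm_num) X).trans hXB
  refine ⟨_, ?_, hturn, hreal.append ?_⟩
  · rw [hedge]
    exact hperm.map _
  · rw [← hscanMap]
    have := realizes_scan (S := S) (W := W) (M := M) (c := C) (r := 1) Head.code
      (fun it : Item => (⟨some (it.2.1, it.pay)⟩ : Head))
      (fun _ pre it => [it.turn (pre + ⟨some (it.2.1, it.pay)⟩).payload]) (L := L₁) h.machines
      h.pos_F ?_ h.M_le (by have := h.cap_le; omega) ?_ (by have := h.cap_le; omega)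
      (fun it hit => ((hX₁ it hit).encode_lt.trans_le hXB).trans hBW) (fun _ _ _ => le_rfl) ?_
    · rwa [one_mul] at this
    · intro l hl
      refine Head.enc_sum_lt (by omega) (fun it hit => ?_) fun it hit => ?_
      · obtain ⟨-, h2, -⟩ := hX₁ it (hl.subset hit)
        have := hXB' (by omega)
        omega
      · obtain ⟨-, -, h3, -⟩ := hX₁ it (hl.subset hit)
        have := hXB' (by omega)
        unfold Item.pay
        split_ifs <;> omega
    · refine le_trans (Nat.mul_le_mul_left F ?_) h.scan_le
      simp only [Head.code]
      omega
    · rw [hscanMap]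
      exact fun it hit => ((hturn it hit).encode_lt.trans_le hXB).trans hBW

/-- Sort the items, and remove the repetitions. -/
def dedupSteps (X : ℕ) {s : ℕ} (hs : 0 < s) (p M D F C : ℕ) : List (Step M) :=
  sortSteps (Item.order X) hs p M D F C ++
    scanSteps Head.code (fun it : Item => (⟨some (it.order X, 0)⟩ : Head))
      (fun _ pre it => if pre.val.map Prod.fst = some (it.order X) then [] else [it]) F M D

theorem length_dedupSteps (X : ℕ) {s : ℕ} (hs : 0 < s) (p M D F C : ℕ) :
    (dedupSteps X hs p M D F C).length = p * (D + 3) + (D + 1) := by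
  simp [dedupSteps, length_sortSteps, length_scanSteps]

/-- The sort key ignores the two temporary entries; as these vanish, equal keys mean equal items,
and the repetitions are adjacent after sorting. -/
theorem realizes_dedup {D F C R B X p c s : ℕ} (h : Sizes M S W D F C R B) (hs : 0 < s)
    (hsR : s ≤ R) (hR : 2 ≤ R) (hX2 : 2 ≤ X) (hXB : X ^ 16 ≤ B) (hp : 0 < p) (hXp : X ^ 3 ≤ s ^ p)
    {L : List Item} (hX : ∀ it ∈ L, it.Small X) (hpq : ∀ it ∈ L, it.2.2.2 = (0, 0))
    (hlen : L.length ≤ M * C) (hc : 2 * c + 1 ≤ S) :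
    ∃ L' : List Item, L'.Nodup ∧ (∀ it, it ∈ L' ↔ it ∈ L) ∧
      Realizes S W (dedupSteps X hs p M D F C) c L C L' := by
  have hB : ∀ it ∈ L, Encodable.encode it < B := fun it hit => (hX it hit).encode_lt.trans_le hXB
  obtain ⟨L₁, hperm, hsort, hreal⟩ := realizes_sort_of_lt h hs hsR (Item.order X) hB hlen hc hp
    fun it hit => (Item.order_lt (hX it hit)).trans_le hXp
  have hX₁ : ∀ it ∈ L₁, it.Small X := fun it hit => hX it (hperm.mem_iff.1 hit)
  have hinj : ∀ i ∈ L₁, ∀ j ∈ L₁, i.order X = j.order X → i = j := by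
    intro i hi j hj hij
    have h1 := (Item.order_le_iff (hX₁ i hi) (hX₁ j hj)).1 hij.le
    have h2 := (Item.order_le_iff (hX₁ j hj) (hX₁ i hi)).1 hij.ge
    have h3 := hpq i (hperm.mem_iff.1 hi)
    have h4 := hpq j (hperm.mem_iff.1 hj)
    refine Prod.ext (by omega) (Prod.ext (by omega) (Prod.ext (by omega) ?_))
    rw [h3, h4]
  obtain ⟨h1, h2, h3⟩ := Head.scanMap_dedup (φ := Item.order X)
    (tot := (L₁.map fun it : Item => (⟨some (it.order X, 0)⟩ : Head)).sum) hsort hinj (pre := 0)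
    (fun u hu => by cases hu)
  have hmem : ∀ it, it ∈ scanMap (fun it : Item => (⟨some (it.order X, 0)⟩ : Head))
      (fun _ pre it => if pre.val.map Prod.fst = some (it.order X) then [] else [it])
      (L₁.map fun it : Item => (⟨some (it.order X, 0)⟩ : Head)).sum 0 L₁ ↔ it ∈ L := by
    intro it
    rw [← hperm.mem_iff]
    refine ⟨fun hit => (h2 it hit).1, fun hit => (h3 it hit).resolve_left fun e => ?_⟩
    cases e
  have hBW := h.B_lt
  have hXB3 : X ^ 3 ≤ B := (Nat.pow_le_pow_right (by omega) (by norm_num)).trans hXB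
  refine ⟨_, h1.imp fun {a b} hab => ?_, hmem, hreal.append ?_⟩
  · rintro rfl
    exact hab.ne rfl
  · have := realizes_scan (S := S) (W := W) (M := M) (c := C) (r := 1) Head.code
      (fun it : Item => (⟨some (it.order X, 0)⟩ : Head))
      (fun _ pre it => if pre.val.map Prod.fst = some (it.order X) then [] else [it]) (L := L₁)
      h.machines h.pos_F ?_ h.M_le (by have := h.cap_le; omega) ?_ (by have := h.cap_le; omega)
      (fun it hit => ((hX₁ it hit).encode_lt.trans_le hXB).trans hBW)
      (fun _ _ _ => by split_ifs <;> simp) ?_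
    · rwa [one_mul] at this
    · intro l hl
      refine Head.enc_sum_lt (by omega) (fun it hit => ?_) fun it hit => by omega
      have := Item.order_lt (hX₁ it (hl.subset hit))
      omega
    · refine le_trans (Nat.mul_le_mul_left F ?_) h.scan_le
      simp only [Head.code]
      omega
    · exact fun it hit => ((hX it ((hmem it).1 hit)).encode_lt.trans_le hXB).trans hBW

end MPC

namespace MPC

variable {M S W : ℕ}

/-! ### A small family of splitting functions -/

/-- Flipping a coordinate in which `w` is nonzero changes the inner product, so it injects the
vectors with product 0 into those with product 1. -/
theorem card_le_two_mul_card_dot_eq_one {b : ℕ} {w : Fin b → ZMod 2} (hw : w ≠ 0) :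
    2 ^ b ≤ 2 * (Finset.univ.filter fun x : Fin b → ZMod 2 => x ⬝ᵥ w = 1).card := by
  obtain ⟨j, hj⟩ := Function.ne_iff.1 hw
  have hj1 : w j = 1 := by
    have : ∀ z : ZMod 2, z ≠ 0 → z = 1 := by decide
    exact this _ hj
  have hcard : (Finset.univ.filter fun x : Fin b → ZMod 2 => x ⬝ᵥ w = 1).card +
      (Finset.univ.filter fun x : Fin b → ZMod 2 => ¬ x ⬝ᵥ w = 1).card = 2 ^ b := by
    rw [Finset.card_filter_add_card_filter_not]
    simp [ZMod.card]
  have hle : (Finset.univ.filter fun x : Fin b → ZMod 2 => ¬ x ⬝ᵥ w = 1).card ≤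
      (Finset.univ.filter fun x : Fin b → ZMod 2 => x ⬝ᵥ w = 1).card := by
    refine Finset.card_le_card_of_injOn (fun x => x + Pi.single j 1) ?_
      fun x _ y _ hxy => by simpa using hxy
    intro x hx
    have h0 : x ⬝ᵥ w = 0 := by
      have : ∀ z : ZMod 2, ¬ z = 1 → z = 0 := by decide
      exact this _ (by simpa using hx)
    simp [add_dotProduct, h0, hj1]
  omega

/-- A family of functions, few enough to be tried all, such that for any two numbers, a constant
fraction of the functions are false at the first and true at the second. -/
theorem exists_splitting_family (k b : ℕ) :
    ∃ h : Fin (2 * k * 2 ^ b) → ℕ → Bool, ∀ u v, u ≠ v → u < 2 ^ (k * b) → v < 2 ^ (k * b) →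
      2 * k * 2 ^ b ≤
        4 * k * (Finset.univ.filter fun σ => h σ u = false ∧ h σ v = true).card := by
  classical
  -- An index consists of a block number, a vector to multiply the block with, and a bit to add.
  let ι := Fin k × (Fin b → ZMod 2) × ZMod 2
  have hcard : Fintype.card ι = 2 * k * 2 ^ b := by
    simp [ι, ZMod.card]
    ring
  let e : Fin (2 * k * 2 ^ b) ≃ ι := (finCongr hcard.symm).trans (Fintype.equivFin ι).symm
  let bits : ℕ → Fin k → Fin b → ZMod 2 := fun v i j => if v.testBit (i * b + j) then 1 else 0
  let g : ι → ℕ → Bool := fun σ v => decide (σ.2.2 + σ.2.1 ⬝ᵥ bits v σ.1 = 1)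
  refine ⟨fun σ => g (e σ), fun u v huv hu hv => ?_⟩
  have hsame : (Finset.univ.filter fun σ => g (e σ) u = false ∧ g (e σ) v = true).card =
      (Finset.univ.filter fun σ : ι => g σ u = false ∧ g σ v = true).card := by
    refine Finset.card_equiv e fun σ => ?_
    simp
  rw [hsame]
  obtain ⟨t, ht⟩ : ∃ t, u.testBit t ≠ v.testBit t := by
    by_contra hcon
    push Not at hcon
    exact huv (Nat.eq_of_testBit_eq hcon)
  have htlt : t < k * b := by
    by_contra hge
    have h1 : u < 2 ^ t := hu.trans_le (Nat.pow_le_pow_right (by norm_num) (not_lt.1 hge))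
    have h2 : v < 2 ^ t := hv.trans_le (Nat.pow_le_pow_right (by norm_num) (not_lt.1 hge))
    rw [Nat.testBit_lt_two_pow h1, Nat.testBit_lt_two_pow h2] at ht
    exact ht rfl
  have hb : 0 < b := Nat.pos_of_ne_zero (by rintro rfl; simp at htlt)
  let i : Fin k := ⟨t / b, Nat.div_lt_of_lt_mul (by rwa [mul_comm])⟩
  let j : Fin b := ⟨t % b, Nat.mod_lt _ hb⟩
  have hij : (i : ℕ) * b + j = t := by
    simp only [i, j]
    exact Nat.div_add_mod' t b
  have hw : bits v i - bits u i ≠ 0 := by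
    refine Function.ne_iff.2 ⟨j, ?_⟩
    simp only [Pi.sub_apply, bits, hij, Pi.zero_apply]
    cases h1 : u.testBit t <;> cases h2 : v.testBit t <;> simp_all
  have hle : (Finset.univ.filter fun x : Fin b → ZMod 2 => x ⬝ᵥ (bits v i - bits u i) = 1).card ≤
      (Finset.univ.filter fun σ : ι => g σ u = false ∧ g σ v = true).card := by
    -- In a block where `u` and `v` differ, half of the vectors separate them, and for each of these
    -- one choice of the added bit makes the value at `u` zero and at `v` one. In total this is a
    -- fraction 1/(4k).
    refine Finset.card_le_card_of_injOn (fun x => (i, x, - x ⬝ᵥ bits u i)) ?_ ?_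
    · intro x hx
      have hx' : x ⬝ᵥ (bits v i - bits u i) = 1 := by simpa using hx
      rw [dotProduct_sub] at hx'
      have h0 : -x ⬝ᵥ bits u i + x ⬝ᵥ bits u i = 0 := by rw [neg_dotProduct, neg_add_cancel]
      have h1 : -x ⬝ᵥ bits u i + x ⬝ᵥ bits v i = 1 := by
        rw [← hx', neg_dotProduct, neg_add_eq_sub]
      refine Finset.mem_filter.2 ⟨Finset.mem_univ _, ?_, ?_⟩
      · simp only [g, h0]
        decide
      · simp only [g, h1]
        decide
    · intro x _ y _ hxy
      exact (Prod.ext_iff.1 (Prod.ext_iff.1 hxy).2).1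
  have h1 := card_le_two_mul_card_dot_eq_one hw
  have h2 := Nat.mul_le_mul_left (2 * k) (h1.trans (Nat.mul_le_mul_left 2 hle))
  calc 2 * k * 2 ^ b ≤ _ := h2
    _ = _ := by ring

/-! ### Contraction -/

section contract

variable {R₀ : ℕ} (h : Fin R₀ → ℕ → Bool)

/-- With the function `h σ`, the vertex `a` is contracted into its neighbour `p - 1`. -/
def Merges (σ : Fin R₀) (a p : ℕ) : Prop := p ≠ 0 ∧ h σ a = false ∧ h σ (p - 1) = true

instance (σ : Fin R₀) (a p : ℕ) : Decidable (Merges h σ a p) := by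
  unfold Merges; infer_instance

/-- The vertex into which `a` is contracted. -/
def mergeInto (σ : Fin R₀) (a p : ℕ) : ℕ := if Merges h σ a p then p - 1 else a

/-- The functions of the family for which an item is a vertex that is contracted into another. -/
def mergeVote (it : Item) : Fin R₀ → ℕ := fun σ =>
  if it.1 = 1 ∧ it.2.1 = it.2.2.1 ∧ Merges h σ it.2.1 it.2.2.2.1 then 1 else 0

/-- The items after the contraction. -/
def contractItem (σ : Fin R₀) (it : Item) : List Item :=
  if it.1 = 1 then [(1, mergeInto h σ it.2.1 it.2.2.2.1, it.2.2.1, 0, 0)]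
  else if mergeInto h σ it.2.1 it.2.2.2.1 = mergeInto h σ it.2.2.1 it.2.2.2.2 then []
  else [(0, mergeInto h σ it.2.1 it.2.2.2.1, mergeInto h σ it.2.2.1 it.2.2.2.2, 0, 0)]

/-- A position of a largest entry. -/
noncomputable def argmax [Nonempty (Fin R₀)] (v : Fin R₀ → ℕ) : Fin R₀ :=
  Classical.choose (Finite.exists_max v)

theorem le_argmax [Nonempty (Fin R₀)] (v : Fin R₀ → ℕ) (σ : Fin R₀) : v σ ≤ v (argmax v) :=
  Classical.choose_spec (Finite.exists_max v) σ

/-- Contract vertices into their neighbours, with the best function of the family. -/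
noncomputable def contractSteps [Nonempty (Fin R₀)] (M D F : ℕ) : List (Step M) :=
  scanSteps (vecCode R₀) (mergeVote h) (fun tot _ it => contractItem h (argmax tot) it) F M D

theorem length_contractItem_le (σ : Fin R₀) (it : Item) : (contractItem h σ it).length ≤ 1 := by
  unfold contractItem
  split_ifs <;> simp

theorem mergeInto_lt {X a p : ℕ} (σ : Fin R₀) (ha : a + 1 < X) (hp : p < X) :
    mergeInto h σ a p + 1 < X := by
  unfold mergeInto
  split_ifs with hm
  · have := hm.1
    omega
  · exact ha

theorem contractItem_small {X : ℕ} {σ : Fin R₀} {it j : Item} (hit : it.Small X)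
    (hj : j ∈ contractItem h σ it) : j.Small X := by
  obtain ⟨h1, h2, h3, h4, h5⟩ := hit
  unfold contractItem at hj
  have ha := mergeInto_lt h σ h2 h4
  have hb := mergeInto_lt h σ h3 h5
  split_ifs at hj
  · obtain rfl := List.mem_singleton.1 hj
    exact ⟨by simp, ha, h3, by simp; omega, by simp; omega⟩
  · simp at hj
  · obtain rfl := List.mem_singleton.1 hj
    exact ⟨by simp, ha, hb, by simp; omega, by simp; omega⟩

theorem scanMap_eq_flatMap {α α' β : Type} [AddMonoid β] (x : α → β) (g : β → α → List α')
    (tot pre : β) (L : List α) : scanMap x (fun tot _ a => g tot a) tot pre L = L.flatMap (g tot) := by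
  induction L generalizing pre with
  | nil => rfl
  | cons a L ih => simp [scanMap, ih]

/-- The scan sums the vote vectors, so every machine learns the same totals and picks the same
`argmax` without further agreement. The entries of a sum are at most the number of items. -/
theorem realizes_contract [Nonempty (Fin R₀)] {D F C R B X : ℕ} (hs : Sizes M S W D F C R B)
    (hR : R₀ ≤ R) (hXB : X ^ 16 ≤ B) {L : List Item} (hX : ∀ it ∈ L, it.Small X)
    (hlen : L.length ≤ M * C) :
    Realizes S W (contractSteps h M D F) C L C
      (L.flatMap (contractItem h (argmax (L.map (mergeVote h)).sum))) := by
  have hBW := hs.B_lt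
  have := realizes_scan (S := S) (W := W) (M := M) (c := C) (r := 1) (vecCode R₀) (mergeVote h)
    (fun tot _ it => contractItem h (argmax tot) it) (L := L) hs.machines hs.pos_F ?_ hs.M_le
    (by have := hs.cap_le; omega) ?_ (by have := hs.cap_le; omega)
    (fun it hit => ((hX it hit).encode_lt.trans_le hXB).trans hBW)
    (fun _ _ _ => length_contractItem_le h _ _) ?_
  · rwa [one_mul, scanMap_eq_flatMap _ fun tot it => contractItem h (argmax tot) it] at this
  · intro l hl w hw
    obtain ⟨σ, rfl⟩ := mem_enc_vecCode hw
    have h1 := list_sum_apply_le (x := mergeVote h)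
      (fun a i => by unfold mergeVote; split_ifs <;> simp) l σ
    have h2 := hl.length_le
    have h3 := hs.tag_le
    omega
  · refine le_trans (Nat.mul_le_mul_left F ?_) hs.scan_le
    simp only [vecCode]
    omega
  · rw [scanMap_eq_flatMap _ fun tot it => contractItem h (argmax tot) it]
    intro it hit
    obtain ⟨j, hj, hit⟩ := List.mem_flatMap.1 hit
    exact ((contractItem_small h (hX j hj) hit).encode_lt.trans_le hXB).trans hBW

/-- One phase: every vertex learns its least neighbour, and a constant fraction of the vertices that
have a neighbour are contracted into their least neighbours. -/
noncomputable def phaseSteps [Nonempty (Fin R₀)] (X : ℕ) {s : ℕ} (hs : 0 < s) (p M D F C : ℕ) :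
    List (Step M) :=
  attachSteps X hs p M D F C ++ attachSteps X hs p M D F C ++ contractSteps h M D F

theorem length_phaseSteps [Nonempty (Fin R₀)] (X : ℕ) {s : ℕ} (hs : 0 < s) (p M D F C : ℕ) :
    (phaseSteps h X hs p M D F C).length = 2 * (p * (D + 3)) + 3 * (D + 1) := by
  simp [phaseSteps, length_attachSteps, contractSteps, length_scanSteps]
  ring

/-- An item with information about its two vertices. -/
def withInfo (nb : ℕ → ℕ) (it : Item) : Item := (it.1, it.2.1, it.2.2.1, nb it.2.1, nb it.2.2.1)

theorem edgeRel_perm {L L' : List Item} (h : L.Perm L') : edgeRel L = edgeRel L' := by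
  funext a b
  simp only [edgeRel, h.mem_iff]

theorem edgeRel_map_turn (L : List Item) (g : ℕ → ℕ) (a b : ℕ) :
    edgeRel (L.map fun it => it.turn (g it.2.1)) a b ↔ edgeRel L b a := by
  constructor
  · rintro ⟨it, hit, h0, ha, hb⟩
    obtain ⟨j, hj, rfl⟩ := List.mem_map.1 hit
    exact ⟨j, hj, h0, hb, ha⟩
  · rintro ⟨j, hj, h0, ha, hb⟩
    exact ⟨_, List.mem_map.2 ⟨j, hj, rfl⟩, h0, hb, ha⟩

theorem list_sum_apply {α : Type} (x : α → Fin R₀ → ℕ) (L : List α) (σ : Fin R₀) :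
    (L.map x).sum σ = (L.map fun a => x a σ).sum := by
  induction L with
  | nil => rfl
  | cons a L ih => simp [ih]

/-- Each attachment swaps the endpoints, so two of them restore the item and record the least
neighbours of both. By symmetry of the edges, the swap does not affect the relation from which the
second attachment computes. -/
theorem realizes_phase [Nonempty (Fin R₀)] {D F C R B X p s : ℕ} (hS : Sizes M S W D F C R B)
    (hs : 0 < s) (hsR : s ≤ R) (hR : 2 ≤ R) (hR₀ : R₀ ≤ R) (hXB : X ^ 16 ≤ B) (hp : 0 < p)
    (hXp : X ^ 3 ≤ s ^ p) {L : List Item} (hX : ∀ it ∈ L, it.Small X) (hlen : L.length ≤ M * C)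
    (hsymm : ∀ a b, edgeRel L a b → edgeRel L b a) :
    ∃ (σ : Fin R₀) (L' : List Item),
      L'.Perm (L.flatMap fun it => contractItem h σ (withInfo (leastNbr (edgeRel L)) it)) ∧
      (∀ τ, (L.map fun it => mergeVote h (withInfo (leastNbr (edgeRel L)) it) τ).sum ≤
        (L.map fun it => mergeVote h (withInfo (leastNbr (edgeRel L)) it) σ).sum) ∧
      (∀ it ∈ L', it.Small X) ∧
      Realizes S W (phaseSteps h X hs p M D F C) (2 * C) L C L' := by
  obtain ⟨L₁, hp₁, hX₁, hr₁⟩ := realizes_attach (c := 2 * C) hS hs hsR hR hXB hp hXp hX hlen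
    (by have := hS.cap_le; omega)
  have hlen₁ : L₁.length = L.length := by rw [hp₁.length_eq, List.length_map]
  obtain ⟨L₂, hp₂, hX₂, hr₂⟩ := realizes_attach (c := C) hS hs hsR hR hXB hp hXp hX₁
    (hlen₁ ▸ hlen) (by have := hS.cap_le; omega)
  have hlen₂ : L₂.length = L₁.length := by rw [hp₂.length_eq, List.length_map]
  have hedge : edgeRel L₁ = edgeRel L := by
    rw [edgeRel_perm hp₁]
    funext a b
    refine propext ((edgeRel_map_turn L _ a b).trans ⟨hsymm b a, hsymm a b⟩)
  have hperm : L₂.Perm (L.map (withInfo (leastNbr (edgeRel L)))) := by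
    refine hp₂.trans ?_
    rw [hedge]
    refine (hp₁.map _).trans ?_
    rw [List.map_map]
    rfl
  have hr₃ := realizes_contract h hS hR₀ hXB hX₂ (by omega)
  refine ⟨argmax (L₂.map (mergeVote h)).sum, _, ?_, ?_, ?_, (hr₁.append hr₂).append hr₃⟩
  · refine (hperm.flatMap_right _).trans ?_
    rw [List.flatMap_map]
  · intro τ
    have hsum : ∀ τ, (L₂.map (mergeVote h)).sum τ =
        (L.map fun it => mergeVote h (withInfo (leastNbr (edgeRel L)) it) τ).sum := by
      intro τ
      rw [list_sum_apply, (hperm.map _).sum_eq, List.map_map]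
      rfl
    rw [← hsum, ← hsum]
    exact le_argmax _ τ
  · intro it hit
    obtain ⟨j, hj, hit⟩ := List.mem_flatMap.1 hit
    exact contractItem_small h (hX₂ j hj) hit

end contract

end MPC

/-! ### Contracting stars -/

namespace SubsetGraph

variable {V : Type}

/-- The graph that arises if every vertex `v` is identified with `g v`, where `g v` is `v` itself or
a neighbour of `v` that is mapped to itself. -/
def collapse (H : SubsetGraph V) (g : V → V)
    (hg : ∀ v, g v = v ∨ H.Adj v (g v) ∧ g (g v) = g v) : SubsetGraph V where
  verts := {v | v ∈ H.verts ∧ g v = v}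
  Adj x y := x ≠ y ∧ ∃ x₀ y₀, H.Adj x₀ y₀ ∧ g x₀ = x ∧ g y₀ = y
  adj_sub h := h.1
  edge_vert := by
    rintro x y ⟨-, x₀, y₀, h, rfl, rfl⟩
    rcases hg x₀ with h' | h'
    · exact ⟨by rw [h']; exact H.edge_vert h, by rw [h', h']⟩
    · exact ⟨H.edge_vert h'.1.symm, h'.2⟩
  symm := ⟨by
    rintro x y ⟨hne, x₀, y₀, h, hx, hy⟩
    exact ⟨hne.symm, y₀, x₀, h.symm, hy, hx⟩⟩

variable {H : SubsetGraph V} {g : V → V} {hg : ∀ v, g v = v ∨ H.Adj v (g v) ∧ g (g v) = g v}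

theorem apply_apply_of (hg : ∀ v, g v = v ∨ H.Adj v (g v) ∧ g (g v) = g v) (v : V) :
    g (g v) = g v := by
  rcases hg v with h | h
  · rw [h, h]
  · exact h.2

theorem collapse_of_forall_eq (hid : ∀ v, g v = v) : H.collapse g hg = H := by
  apply SimpleGraph.Subgraph.ext
  · ext v
    exact ⟨fun h => h.1, fun h => ⟨h, hid v⟩⟩
  · ext x y
    constructor
    · rintro ⟨-, x₀, y₀, h, rfl, rfl⟩
      rwa [hid, hid]
    · intro h
      exact ⟨h.ne, x, y, h, hid x, hid y⟩

/-- Induction on the number of moved vertices: contract one moved vertex `u` into `g u`, then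
collapse the rest. -/
theorem isContraction_collapse [Finite V] (H : SubsetGraph V) (g : V → V)
    (hg : ∀ v, g v = v ∨ H.Adj v (g v) ∧ g (g v) = g v) : H.IsContraction (H.collapse g hg) := by
  classical
  induction hN : {v | g v ≠ v}.ncard generalizing H g with
  | zero =>
    have hid : ∀ v, g v = v := by
      rw [Set.ncard_eq_zero (Set.toFinite _), Set.eq_empty_iff_forall_notMem] at hN
      simpa using hN
    rw [collapse_of_forall_eq hid]
    exact Relation.ReflTransGen.refl
  | succ N ih =>
    obtain ⟨u, hu⟩ : {v | g v ≠ v}.Nonempty := by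
      rw [← Set.ncard_pos (Set.toFinite _)]
      omega
    have hu' : g u ≠ u := hu
    have hadj : H.Adj u (g u) := ((hg u).resolve_left hu).1
    set H₁ := H.contract u (g u) (H.edge_vert hadj.symm) with hH₁
    -- After its removal `u` must count as unmoved. No vertex is mapped to `u`, as images are fixed
    -- points, so the remaining stars are intact.
    set g₁ := Function.update g u u with hg₁
    have hg₁u : g₁ u = u := by simp [hg₁]
    have hg₁ne : ∀ w, w ≠ u → g₁ w = g w := fun w hw => by simp [hg₁, hw]
    have hgne : ∀ w, g w ≠ u := fun w hw => hu' (by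
      have := apply_apply_of hg w
      rw [hw] at this
      exact this)
    have hg₁' : ∀ v, g₁ v = v ∨ H₁.Adj v (g₁ v) ∧ g₁ (g₁ v) = g₁ v := by
      intro w
      by_cases hw : w = u
      · left
        rw [hw, hg₁u]
      · rw [hg₁ne w hw, hg₁ne _ (hgne w)]
        rcases hg w with h | h
        · exact Or.inl h
        · exact Or.inr ⟨⟨hw, hgne w, h.1.ne, Or.inl h.1⟩, h.2⟩
    have hcard : {v | g₁ v ≠ v}.ncard = N := by
      have : {v | g₁ v ≠ v} = {v | g v ≠ v} \ {u} := by
        ext w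
        by_cases hw : w = u
        · subst hw
          simp [hg₁u]
        · simp [hg₁ne w hw, hw]
      rw [this, Set.ncard_sdiff_singleton_of_mem hu]
      omega
    have hrest := ih H₁ g₁ hg₁' hcard
    have heq : H₁.collapse g₁ hg₁' = H.collapse g hg := by
      apply SimpleGraph.Subgraph.ext
      · ext v
        constructor
        · rintro ⟨⟨h1, h2⟩, h3⟩
          exact ⟨h1, by rwa [hg₁ne v h2] at h3⟩
        · rintro ⟨h1, h2⟩
          have hv : v ≠ u := by rintro rfl; exact hu' h2
          exact ⟨⟨h1, hv⟩, by rwa [hg₁ne v hv]⟩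
      · ext x y
        constructor
        · rintro ⟨hne, x₀, y₀, ⟨hx, hy, -, h⟩, rfl, rfl⟩
          refine ⟨hne, ?_⟩
          rw [hg₁ne x₀ hx, hg₁ne y₀ hy]
          rcases h with h | ⟨rfl, h⟩ | ⟨rfl, h⟩
          · exact ⟨x₀, y₀, h, rfl, rfl⟩
          · exact ⟨u, y₀, h, (apply_apply_of hg u).symm, rfl⟩
          · exact ⟨x₀, u, h, rfl, (apply_apply_of hg u).symm⟩
        · rintro ⟨hne, x₀, y₀, h, rfl, rfl⟩
          refine ⟨hne, ?_⟩
          by_cases hx : x₀ = u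
          · have hy : y₀ ≠ u := hx ▸ (H.adj_sub h).ne'
            rw [hx] at h hne ⊢
            refine ⟨g u, y₀, ⟨hu', hy, ?_, Or.inr (Or.inl ⟨rfl, h⟩)⟩, ?_, hg₁ne y₀ hy⟩
            · intro e
              apply hne
              rw [← e, apply_apply_of hg]
            · rw [hg₁ne _ hu', apply_apply_of hg]
          · by_cases hy : y₀ = u
            · rw [hy] at h hne ⊢
              refine ⟨x₀, g u, ⟨hx, hu', ?_, Or.inr (Or.inr ⟨rfl, h⟩)⟩, hg₁ne x₀ hx, ?_⟩
              · intro e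
                apply hne
                rw [e, apply_apply_of hg]
              · rw [hg₁ne _ hu', apply_apply_of hg]
            · exact ⟨x₀, y₀, ⟨hx, hy, h.ne, Or.inl h⟩, hg₁ne x₀ hx, hg₁ne y₀ hy⟩
    rw [heq] at hrest
    exact Relation.ReflTransGen.head ⟨u, g u, hadj, rfl⟩ hrest

theorem reachable_collapse (u v : V) : H.spanningCoe.Reachable u v ↔
    (H.collapse g hg).spanningCoe.Reachable (g u) (g v) := by
  have hself : ∀ x, H.spanningCoe.Reachable x (g x) := by
    intro x
    rcases hg x with h | h
    · rw [h]
    · exact SimpleGraph.Adj.reachable (G := H.spanningCoe) h.1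
  constructor
  · intro h
    rw [SimpleGraph.reachable_iff_reflTransGen] at h
    induction h with
    | refl => exact SimpleGraph.Reachable.refl _
    | @tail x y _ hxy ih =>
      refine ih.trans ?_
      by_cases e : g x = g y
      · rw [e]
      · exact SimpleGraph.Adj.reachable (G := (H.collapse g hg).spanningCoe) ⟨e, x, y, hxy, rfl, rfl⟩
  · intro h
    rw [SimpleGraph.reachable_iff_reflTransGen] at h
    have key : ∀ x y, Relation.ReflTransGen (H.collapse g hg).spanningCoe.Adj x y →
        H.spanningCoe.Reachable x y := by
      intro x y hxy
      induction hxy with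
      | refl => exact SimpleGraph.Reachable.refl _
      | tail _ hyz ih =>
        obtain ⟨-, x₀, y₀, h, rfl, rfl⟩ := hyz
        exact (ih.trans (hself x₀).symm).trans
          ((SimpleGraph.Adj.reachable (G := H.spanningCoe) h).trans (hself y₀))
    exact ((hself u).trans (key _ _ h)).trans (hself v).symm

theorem support_collapse_subset :
    (H.collapse g hg).support ⊆ H.support \ {v | g v ≠ v} := by
  rintro x ⟨y, -, x₀, y₀, h, rfl, -⟩
  refine ⟨?_, by simpa using apply_apply_of hg x₀⟩
  rcases hg x₀ with h' | h'
  · rw [h']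
    exact ⟨y₀, h⟩
  · exact ⟨x₀, h'.1.symm⟩

/-- Every moved vertex had a neighbour and disappears, and no vertex becomes non-isolated. -/
theorem ncard_support_collapse_add_le [Finite V] :
    (H.collapse g hg).support.ncard + {v | g v ≠ v}.ncard ≤ H.support.ncard := by
  have hsub : {v | g v ≠ v} ⊆ H.support := fun v hv => ⟨g v, ((hg v).resolve_left hv).1⟩
  have h1 := Set.ncard_le_ncard (support_collapse_subset (H := H) (g := g) (hg := hg)) (Set.toFinite _)
  rw [Set.ncard_sdiff hsub (Set.toFinite _)] at h1
  have h2 := Set.ncard_le_ncard hsub (Set.toFinite _)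
  omega

/-- A walk that starts in the vertex set cannot leave it, since edges have both ends there. -/
theorem reachable_coe_iff (H : SubsetGraph V) (a b : H.verts) :
    H.coe.Reachable a b ↔ H.spanningCoe.Reachable a b := by
  constructor
  · intro h
    exact h.map (⟨Subtype.val, fun {x y} hxy => hxy⟩ : H.coe →g H.spanningCoe)
  · intro h
    rw [SimpleGraph.reachable_iff_reflTransGen] at h
    have key : ∀ y, Relation.ReflTransGen H.spanningCoe.Adj a y →
        ∃ hy : y ∈ H.verts, H.coe.Reachable a ⟨y, hy⟩ := by
      intro y hy
      induction hy with
      | refl => exact ⟨a.2, SimpleGraph.Reachable.refl _⟩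
      | @tail y z _ hyz ih =>
        obtain ⟨hy, ih⟩ := ih
        exact ⟨H.edge_vert (H.symm.symm _ _ hyz), ih.trans (SimpleGraph.Adj.reachable (G := H.coe) hyz)⟩
    exact (key b h).2

end SubsetGraph

namespace MPC

/-! ### The items of a contracted graph -/

section represents

variable {n : ℕ}

/-- The graph `H` is obtained from `G` by contractions, and every vertex `v` of `G` was contracted
into the vertex `ρ v` of `H`. -/
structure Tracks (G : SimpleGraph (Fin n)) (H : SubsetGraph (Fin n)) (ρ : Fin n → Fin n) :
    Prop where
  contraction : G.toSubsetGraph.IsContraction H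
  mem_verts : ∀ v, v ∈ H.verts ↔ ρ v = v
  apply_apply : ∀ v, ρ (ρ v) = ρ v
  reachable : ∀ u v, G.Reachable u v ↔ H.spanningCoe.Reachable (ρ u) (ρ v)

theorem Tracks.refl (G : SimpleGraph (Fin n)) : Tracks G G.toSubsetGraph id where
  contraction := Relation.ReflTransGen.refl
  mem_verts v := by simp [SimpleGraph.toSubsetGraph, SimpleGraph.toSubgraph]
  apply_apply v := rfl
  reachable u v := Iff.rfl

theorem Tracks.collapse {G : SimpleGraph (Fin n)} {H : SubsetGraph (Fin n)} {ρ g : Fin n → Fin n}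
    (h : Tracks G H ρ) (hg : ∀ v, g v = v ∨ H.Adj v (g v) ∧ g (g v) = g v) :
    Tracks G (H.collapse g hg) (g ∘ ρ) where
  contraction := h.contraction.trans (SubsetGraph.isContraction_collapse H g hg)
  mem_verts v := by
    constructor
    · rintro ⟨h1, h2⟩
      rw [Function.comp_apply, (h.mem_verts v).1 h1, h2]
    · intro hv
      rw [Function.comp_apply] at hv
      have hgv : g v = v := by
        conv_rhs => rw [← hv]
        rw [← SubsetGraph.apply_apply_of hg (ρ v), hv]
      refine ⟨?_, hgv⟩
      rcases hg (ρ v) with h' | h'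
      · rw [h.mem_verts, ← hv, h', h.apply_apply]
      · rw [hv] at h'
        exact H.edge_vert h'.1.symm
  apply_apply v := by
    have : g (ρ v) ∈ H.verts := by
      rcases hg (ρ v) with h' | h'
      · rw [h', h.mem_verts, h.apply_apply]
      · exact H.edge_vert h'.1.symm
    simp only [Function.comp_apply]
    rw [(h.mem_verts _).1 this, SubsetGraph.apply_apply_of hg]
  reachable u v := (h.reachable u v).trans (SubsetGraph.reachable_collapse _ _)

/-- The items `L` are the vertices with their representatives `ρ`, and the edges of `H`. -/
structure Represents (H : SubsetGraph (Fin n)) (ρ : Fin n → Fin n) (L : List Item) : Prop where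
  vertices : (L.filter fun it => it.1 = 1).Perm
    ((List.finRange n).map fun v => ((1, (ρ v : ℕ), (v : ℕ), 0, 0) : Item))
  exists_adj : ∀ it ∈ L, it.1 ≠ 1 → ∃ a b : Fin n, H.Adj a b ∧ it = (0, (a : ℕ), (b : ℕ), 0, 0)
  mem_of_adj : ∀ a b : Fin n, H.Adj a b → ((0, (a : ℕ), (b : ℕ), 0, 0) : Item) ∈ L

namespace Represents

variable {H : SubsetGraph (Fin n)} {ρ : Fin n → Fin n} {L : List Item} (h : Represents H ρ L)
include h

theorem eq_of_mem {it : Item} (hit : it ∈ L) :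
    (∃ v : Fin n, it = (1, (ρ v : ℕ), (v : ℕ), 0, 0)) ∨
      ∃ a b : Fin n, H.Adj a b ∧ it = (0, (a : ℕ), (b : ℕ), 0, 0) := by
  by_cases h1 : it.1 = 1
  · left
    have : it ∈ L.filter fun it => it.1 = 1 := List.mem_filter.2 ⟨hit, by simpa using h1⟩
    obtain ⟨v, -, hv⟩ := List.mem_map.1 (h.vertices.mem_iff.1 this)
    exact ⟨v, hv.symm⟩
  · exact Or.inr (h.exists_adj it hit h1)

theorem vertex_mem (v : Fin n) : ((1, (ρ v : ℕ), (v : ℕ), 0, 0) : Item) ∈ L :=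
  (List.mem_filter.1 (h.vertices.mem_iff.2 (List.mem_map.2 ⟨v, List.mem_finRange v, rfl⟩))).1

theorem edgeRel_iff {a b : ℕ} : edgeRel L a b ↔ ∃ a' b' : Fin n, H.Adj a' b' ∧ a = a' ∧ b = b' := by
  constructor
  · rintro ⟨it, hit, h0, rfl, rfl⟩
    obtain ⟨a', b', hadj, rfl⟩ := h.exists_adj it hit (by omega)
    exact ⟨a', b', hadj, rfl, rfl⟩
  · rintro ⟨a', b', hadj, rfl, rfl⟩
    exact ⟨_, h.mem_of_adj a' b' hadj, rfl, rfl, rfl⟩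

theorem edgeRel_symm {a b : ℕ} (hab : edgeRel L a b) : edgeRel L b a := by
  obtain ⟨a', b', hadj, rfl, rfl⟩ := h.edgeRel_iff.1 hab
  exact h.edgeRel_iff.2 ⟨b', a', hadj.symm, rfl, rfl⟩

theorem small {X : ℕ} (hX : n + 1 ≤ X) {it : Item} (hit : it ∈ L) : it.Small X := by
  rcases h.eq_of_mem hit with ⟨v, rfl⟩ | ⟨a, b, -, rfl⟩
  · have h1 := v.2
    have h2 := (ρ v).2
    refine ⟨?_, ?_, ?_, ?_, ?_⟩ <;> simp only <;> omega
  · have h1 := a.2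
    have h2 := b.2
    refine ⟨?_, ?_, ?_, ?_, ?_⟩ <;> simp only <;> omega

theorem exists_leastNbr {v : Fin n} (hv : leastNbr (edgeRel L) v ≠ 0) :
    ∃ w : Fin n, H.Adj v w ∧ leastNbr (edgeRel L) v = w + 1 := by
  classical
  unfold leastNbr at hv ⊢
  split_ifs at hv ⊢ with hex
  · obtain ⟨a', b', hadj, ha, hb⟩ := h.edgeRel_iff.1 (Nat.find_spec hex)
    obtain rfl := Fin.ext ha
    exact ⟨b', hadj, by rw [hb]⟩
  · exact absurd rfl hv

theorem leastNbr_ne_zero {v : Fin n} (hv : v ∈ H.support) : leastNbr (edgeRel L) v ≠ 0 := by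
  classical
  obtain ⟨w, hw⟩ := hv
  have hex : ∃ b, edgeRel L v b := ⟨w, h.edgeRel_iff.2 ⟨v, w, hw, rfl, rfl⟩⟩
  rw [leastNbr, dif_pos hex]
  omega

variable {R₀ : ℕ} (f : Fin R₀ → ℕ → Bool)

/-- Only vertices that are their own representatives vote. A vertex that merges has a neighbour,
hence is still present and its own representative, so each is counted exactly once. -/
theorem sum_mergeVote (hρ : ∀ v, v ∈ H.verts → ρ v = v) (τ : Fin R₀) :
    (L.map fun it => mergeVote f (withInfo (leastNbr (edgeRel L)) it) τ).sum =
      (Finset.univ.filter fun v : Fin n => Merges f τ v (leastNbr (edgeRel L) v)).card := by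
  have h1 : (L.map fun it => mergeVote f (withInfo (leastNbr (edgeRel L)) it) τ).sum =
      ((L.filter fun it => it.1 = 1).map fun it =>
        mergeVote f (withInfo (leastNbr (edgeRel L)) it) τ).sum := by
    clear h
    generalize leastNbr (edgeRel L) = nb
    induction L with
    | nil => rfl
    | cons it L ih =>
      rw [List.map_cons, List.sum_cons, ih, List.filter_cons]
      by_cases h1 : it.1 = 1
      · simp [h1]
      · simp [h1, mergeVote, withInfo]
  rw [h1, (h.vertices.map _).sum_eq, List.map_map, ← List.sum_toFinset _ (List.nodup_finRange n),
    List.toFinset_finRange, Finset.card_filter]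
  refine Finset.sum_congr rfl fun v _ => ?_
  simp only [Function.comp_apply, mergeVote, withInfo, true_and]
  refine if_congr ⟨?_, fun hm => ?_⟩ rfl rfl
  · rintro ⟨he, hm⟩
    rwa [he] at hm
  · obtain ⟨w, hw, -⟩ := h.exists_leastNbr hm.1
    have := hρ v (H.edge_vert hw)
    rw [this]
    exact ⟨rfl, hm⟩

/-- The vertices with `Merges` and their targets form stars. On the items, collapsing them renames
endpoints and drops loops; repeated edges may stay, as `Represents` does not restrict their
multiplicity. -/
theorem exists_collapse {G : SimpleGraph (Fin n)} (hG : Tracks G H ρ) {σ : Fin R₀} {L' : List Item}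
    (hL' : L'.Perm (L.flatMap fun it => contractItem f σ (withInfo (leastNbr (edgeRel L)) it))) :
    ∃ H' ρ', Tracks G H' ρ' ∧ Represents H' ρ' L' ∧ H'.support.ncard +
      (Finset.univ.filter fun v : Fin n => Merges f σ v (leastNbr (edgeRel L) v)).card ≤
        H.support.ncard := by
  set nb := leastNbr (edgeRel L) with hnb
  have hex : ∀ v : Fin n, ∃ w : Fin n, (w : ℕ) = mergeInto f σ v (nb v) ∧
      (Merges f σ v (nb v) → H.Adj v w) := by
    intro v
    by_cases hm : Merges f σ v (nb v)
    · obtain ⟨w, hw, he⟩ := h.exists_leastNbr hm.1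
      refine ⟨w, ?_, fun _ => hw⟩
      rw [mergeInto, if_pos hm, hnb, he]
      rfl
    · exact ⟨v, by rw [mergeInto, if_neg hm], fun hm' => absurd hm' hm⟩
  choose g hgv hga using hex
  have hfix : ∀ v : Fin n, ¬ Merges f σ v (nb v) → g v = v := fun v hm =>
    Fin.ext (by rw [hgv, mergeInto, if_neg hm])
  have hg : ∀ v, g v = v ∨ H.Adj v (g v) ∧ g (g v) = g v := by
    intro v
    by_cases hm : Merges f σ v (nb v)
    -- The target has value true under `f σ`, while merging requires false, so the target stays.
    · refine Or.inr ⟨hga v hm, hfix _ fun hm' => ?_⟩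
      have h1 : f σ (g v) = false := hm'.2.1
      rw [hgv v, mergeInto, if_pos hm, hm.2.2] at h1
      cases h1
    · exact Or.inl (hfix v hm)
  refine ⟨H.collapse g hg, g ∘ ρ, hG.collapse hg, ⟨?_, ?_, ?_⟩, ?_⟩
  · have h1 : ∀ L : List Item, (L.flatMap fun it => contractItem f σ (withInfo nb it)).filter
        (fun it => it.1 = 1) = (L.filter fun it => it.1 = 1).map fun it =>
          ((1, mergeInto f σ it.2.1 (nb it.2.1), it.2.2.1, 0, 0) : Item) := by
      intro L
      induction L with
      | nil => rfl
      | cons it L ih =>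
        rw [List.flatMap_cons, List.filter_append, ih, List.filter_cons]
        by_cases h1 : it.1 = 1
        · simp [h1, contractItem, withInfo]
        · by_cases h2 : mergeInto f σ it.2.1 (nb it.2.1) = mergeInto f σ it.2.2.1 (nb it.2.2.1)
          · simp [contractItem, withInfo, h1, h2]
          · simp [contractItem, withInfo, h1, h2]
    refine (hL'.filter _).trans ?_
    rw [h1]
    refine (h.vertices.map _).trans ?_
    rw [List.map_map]
    refine List.Perm.of_eq (List.map_congr_left fun v _ => ?_)
    simp only [Function.comp_apply, hgv]
  · intro it hit h1
    obtain ⟨j, hj, hit⟩ := List.mem_flatMap.1 (hL'.mem_iff.1 hit)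
    rcases h.eq_of_mem hj with ⟨v, rfl⟩ | ⟨a, b, hab, rfl⟩
    · simp only [contractItem, withInfo, if_true, List.mem_singleton] at hit
      rw [hit] at h1
      exact absurd rfl h1
    · simp only [contractItem, withInfo, zero_ne_one, if_false, ← hgv] at hit
      split_ifs at hit with he
      · simp at hit
      · exact ⟨g a, g b, ⟨fun e => he (by rw [e]), a, b, hab, rfl, rfl⟩, by simpa using hit⟩
  · rintro a b ⟨hne, a₀, b₀, hab, rfl, rfl⟩
    rw [hL'.mem_iff]
    refine List.mem_flatMap.2 ⟨_, h.mem_of_adj a₀ b₀ hab, ?_⟩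
    simp only [contractItem, withInfo, zero_ne_one, if_false, ← hgv]
    rw [if_neg fun e => hne (Fin.ext e)]
    simp
  · have hsame : {v | g v ≠ v} = ↑(Finset.univ.filter fun v : Fin n => Merges f σ v (nb v)) := by
      ext v
      simp only [ne_eq, Set.mem_ofPred_eq, Finset.coe_filter, Finset.mem_univ, true_and]
      constructor
      · intro hv
        by_contra hm
        exact hv (hfix v hm)
      · exact fun hm => (H.adj_sub (hga v hm)).ne'
    have := SubsetGraph.ncard_support_collapse_add_le (H := H) (g := g) (hg := hg)
    rwa [hsame, Set.ncard_coe_finset] at this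

/-- Double counting of pairs of a function and a vertex merged by it: each non-isolated vertex is
merged by at least `R₀ / (4 * k)` functions, and the best function is at least average. -/
theorem support_le_mul_card_merges {k : ℕ} {N : ℕ} (hN : n ≤ N)
    (hf : ∀ u v, u ≠ v → u < N → v < N →
      R₀ ≤ 4 * k * (Finset.univ.filter fun σ => f σ u = false ∧ f σ v = true).card)
    (hR₀ : 0 < R₀) {σ : Fin R₀}
    (hσ : ∀ τ, (Finset.univ.filter fun v : Fin n => Merges f τ v (leastNbr (edgeRel L) v)).card ≤
      (Finset.univ.filter fun v : Fin n => Merges f σ v (leastNbr (edgeRel L) v)).card) :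
    H.support.ncard ≤
      4 * k * (Finset.univ.filter fun v : Fin n => Merges f σ v (leastNbr (edgeRel L) v)).card := by
  classical
  set cnt := fun τ => (Finset.univ.filter fun v : Fin n => Merges f τ v (leastNbr (edgeRel L) v)).card
    with hcnt
  have h1 : ∑ τ, cnt τ = ∑ v : Fin n,
      (Finset.univ.filter fun τ => Merges f τ v (leastNbr (edgeRel L) v)).card := by
    simp only [hcnt, Finset.card_filter]
    exact Finset.sum_comm
  have h2 : ∀ v ∈ H.support.toFinset, R₀ ≤ 4 * k *
      (Finset.univ.filter fun τ => Merges f τ v (leastNbr (edgeRel L) v)).card := by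
    intro v hv
    have hv := h.leastNbr_ne_zero (Set.mem_toFinset.1 hv)
    obtain ⟨w, hw, he⟩ := h.exists_leastNbr hv
    have := hf v w (fun e => hw.ne (Fin.ext e)) (v.2.trans_le hN) (w.2.trans_le hN)
    refine this.trans (Nat.mul_le_mul_left _ (Finset.card_le_card fun τ hτ => ?_))
    rw [Finset.mem_filter] at hτ ⊢
    refine ⟨Finset.mem_univ _, hv, hτ.2.1, ?_⟩
    rw [he]
    exact hτ.2.2
  have h3 : R₀ * H.support.ncard ≤ 4 * k * ∑ τ, cnt τ := by
    rw [h1, Set.ncard_eq_toFinset_card', Finset.mul_sum]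
    calc R₀ * H.support.toFinset.card = ∑ v ∈ H.support.toFinset, R₀ := by simp [mul_comm]
      _ ≤ ∑ v ∈ H.support.toFinset, 4 * k *
          (Finset.univ.filter fun τ => Merges f τ v (leastNbr (edgeRel L) v)).card :=
        Finset.sum_le_sum h2
      _ ≤ _ := Finset.sum_le_sum_of_subset (Finset.subset_univ _)
  have h4 : ∑ τ, cnt τ ≤ R₀ * cnt σ := by
    refine (Finset.sum_le_sum fun τ _ => hσ τ).trans ?_
    simp [hcnt]
  have h5 := h3.trans (Nat.mul_le_mul_left (4 * k) h4)
  refine Nat.le_of_mul_le_mul_left (h5.trans (le_of_eq ?_)) hR₀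
  ring

end Represents

end represents

end MPC

/-! ### Iteration of the phases -/

namespace MPC

variable {M S W : ℕ}

theorem Realizes.mono_right {α α' : Type} [Denumerable α] [Denumerable α']
    {fs : List (Step M)} {c c' c'' : ℕ} {L : List α} {L' : List α'}
    (h : Realizes S W fs c L c' L') (hc : c' ≤ c'') : Realizes S W fs c L c'' L' := by
  intro l hl hl0
  obtain ⟨l', hl', hc', hr⟩ := h l hl hl0
  exact ⟨l', hl', fun i => (hc' i).trans hc, hr⟩

theorem realizes_nil {α : Type} [Denumerable α] {c : ℕ} {L : List α} (hc : c + 1 ≤ S)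
    (hW : ∀ a ∈ L, Encodable.encode a < W) : Realizes (M := M) S W [] c L c L := by
  rintro l rfl hlc
  exact ⟨l, rfl, hlc, rfl, stateFits_canon (fun i => by have := hlc i; omega)
    fun i a ha => hW a (List.mem_flatMap.2 ⟨i, List.mem_finRange i, ha⟩)⟩

section phases

variable {n : ℕ} {R₀ : ℕ} (f : Fin R₀ → ℕ → Bool)

/-- At least a fraction 1/(4k) of the support is merged in a phase, and it leaves the support. The
number of items never grows, so the capacity remains sufficient. The load `2 * C` is allowed because
storing both orientations doubles the first load. -/
theorem realizes_phases [Nonempty (Fin R₀)] {D F C R B X p s k N : ℕ}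
    (hS : Sizes M S W D F C R B) (hs : 0 < s) (hsR : s ≤ R) (hR : 2 ≤ R) (hR₀ : R₀ ≤ R)
    (hXB : X ^ 16 ≤ B) (hp : 0 < p) (hXp : X ^ 3 ≤ s ^ p) (hnX : n + 1 ≤ X) (hN : n ≤ N)
    (hf : ∀ u v, u ≠ v → u < N → v < N →
      R₀ ≤ 4 * k * (Finset.univ.filter fun σ => f σ u = false ∧ f σ v = true).card)
    {G : SimpleGraph (Fin n)} {H : SubsetGraph (Fin n)} {ρ : Fin n → Fin n} {L : List Item}
    (hG : Tracks G H ρ) (hL : Represents H ρ L) (hlen : L.length ≤ M * C) (T : ℕ) :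
    ∃ H' ρ' L', Tracks G H' ρ' ∧ Represents H' ρ' L' ∧ L'.length ≤ M * C ∧
      (4 * k) ^ T * H'.support.ncard ≤ (4 * k - 1) ^ T * H.support.ncard ∧
      Realizes S W (List.replicate T (phaseSteps f X hs p M D F C)).flatten (2 * C) L (2 * C) L' := by
  induction T with
  | zero =>
    refine ⟨H, ρ, L, hG, hL, hlen, by simp, ?_⟩
    have h1 := hS.cap_le
    exact realizes_nil (by omega) fun it hit =>
      ((hL.small hnX hit).encode_lt.trans_le hXB).trans hS.B_lt
  | succ T ih =>
    obtain ⟨H₁, ρ₁, L₁, hG₁, hL₁, hlen₁, hsupp₁, hr₁⟩ := ih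
    obtain ⟨σ, L₂, hp₂, hσ, -, hr₂⟩ := realizes_phase f hS hs hsR hR hR₀ hXB hp hXp
      (fun it hit => hL₁.small hnX hit) hlen₁ fun a b => hL₁.edgeRel_symm
    simp only [hL₁.sum_mergeVote f fun v => (hG₁.mem_verts v).1] at hσ
    obtain ⟨H₂, ρ₂, hG₂, hL₂, hcard⟩ := hL₁.exists_collapse f hG₁ hp₂
    have hmany := hL₁.support_le_mul_card_merges f hN hf
      (Fin.pos_iff_nonempty.2 inferInstance) hσ
    refine ⟨H₂, ρ₂, L₂, hG₂, hL₂, ?_, ?_, ?_⟩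
    · refine le_trans ?_ hlen₁
      rw [hp₂.length_eq, List.length_flatMap]
      refine (List.sum_le_card_nsmul _ 1 ?_).trans (by simp)
      simp only [List.mem_map, forall_exists_index, and_imp]
      rintro _ it - rfl
      exact length_contractItem_le f _ _
    · have hstep : 4 * k * H₂.support.ncard ≤ (4 * k - 1) * H₁.support.ncard := by
        have h1 := Nat.mul_le_mul_left (4 * k) hcard
        rw [mul_add] at h1
        rw [Nat.sub_mul, one_mul]
        omega
      calc (4 * k) ^ (T + 1) * H₂.support.ncard
          = (4 * k) ^ T * (4 * k * H₂.support.ncard) := by ring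
        _ ≤ (4 * k) ^ T * ((4 * k - 1) * H₁.support.ncard) := Nat.mul_le_mul_left _ hstep
        _ = (4 * k - 1) * ((4 * k) ^ T * H₁.support.ncard) := by ring
        _ ≤ (4 * k - 1) * ((4 * k - 1) ^ T * H.support.ncard) := Nat.mul_le_mul_left _ hsupp₁
        _ = (4 * k - 1) ^ (T + 1) * H.support.ncard := by ring
    · rw [List.replicate_succ', List.flatten_append]
      refine hr₁.append ?_
      simpa using hr₂.mono_right (by omega)

end phases

/-! ### Reading the input -/

/-- The machines read their memories and messages, and store the items that `g` finds in them. -/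
def absorbStep (M : ℕ) (g : LocalState → List Item) : Step M := fun _ s => (pack (g s), [])

theorem runs_absorb {g : LocalState → List Item} {s : Fin M → LocalState} (hs : StateFits S W s)
    (hS : ∀ i, (g (s i)).length + 1 ≤ S) (hW : ∀ i, ∀ a ∈ g (s i), Encodable.encode a < W) :
    Runs S W [absorbStep M g] s (canon fun i => g (s i)) := by
  have hexec : (absorbStep M g).exec s = canon fun i => g (s i) := by
    funext j
    simp [Step.exec, absorbStep, canon]
  refine ⟨hs, fun i => fits_nil, hexec.symm, ?_⟩
  rw [hexec]
  exact stateFits_canon hS hW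

/-- The item for a record of the input. -/
def Item.ofRecord : Record → Item
  | [v] => (1, v, v, 0, 0)
  | [u, v] => (0, u, v, 0, 0)
  | _ => (0, 0, 0, 0, 0)

/-- An edge in both orientations. -/
def bothOrientations (it : Item) : List Item :=
  if it.1 = 1 then [it] else [it, (it.1, it.2.2.1, it.2.1, it.2.2.2)]

section input

variable {n : ℕ} {G : SimpleGraph (Fin n)} {D : Fin M → List Record}

theorem StoresGraph.exists_of_mem (hD : StoresGraph (fun v : Fin n => (v : ℕ)) G D) {it : Item}
    (hit : it ∈ (gather D).map Item.ofRecord) :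
    (∃ v : Fin n, [(v : ℕ)] ∈ gather D ∧ it = (1, (v : ℕ), (v : ℕ), 0, 0)) ∨
      ∃ u v : Fin n, [(u : ℕ), (v : ℕ)] ∈ gather D ∧ G.Adj u v ∧
        it = (0, (u : ℕ), (v : ℕ), 0, 0) := by
  obtain ⟨r, hr, rfl⟩ := List.mem_map.1 hit
  rcases hD.2.1 r hr with ⟨v, rfl⟩ | ⟨u, v, h, rfl⟩
  · exact Or.inl ⟨v, hr, rfl⟩
  · exact Or.inr ⟨u, v, hr, h, rfl⟩

theorem StoresGraph.nodup_items (hD : StoresGraph (fun v : Fin n => (v : ℕ)) G D) :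
    ((gather D).map Item.ofRecord).Nodup := by
  refine (List.nodup_map_iff_inj_on hD.1).2 fun r hr r' hr' h => ?_
  rcases hD.2.1 r hr with ⟨v, rfl⟩ | ⟨u, v, -, rfl⟩ <;>
    rcases hD.2.1 r' hr' with ⟨v', rfl⟩ | ⟨u', v', -, rfl⟩ <;>
      simp_all [Item.ofRecord]

theorem StoresGraph.edge_mem (hD : StoresGraph (fun v : Fin n => (v : ℕ)) G D) {u v : Fin n} :
    ((0, (u : ℕ), (v : ℕ), 0, 0) : Item) ∈ (gather D).map Item.ofRecord ↔
      [(u : ℕ), (v : ℕ)] ∈ gather D := by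
  constructor
  · intro h
    rcases hD.exists_of_mem h with ⟨w, -, he⟩ | ⟨u', v', hm, -, he⟩
    · simp at he
    · simp only [Prod.mk.injEq, true_and, and_true] at he
      rwa [he.1, he.2]
  · exact fun h => List.mem_map.2 ⟨_, h, rfl⟩

theorem StoresGraph.vertices_perm (hD : StoresGraph (fun v : Fin n => (v : ℕ)) G D) :
    (((gather D).map Item.ofRecord).filter fun it => it.1 = 1).Perm
      ((List.finRange n).map fun v : Fin n => ((1, (v : ℕ), (v : ℕ), 0, 0) : Item)) := by
  have hinj : Function.Injective fun v : Fin n => ((1, (v : ℕ), (v : ℕ), 0, 0) : Item) :=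
    fun v w h => Fin.ext (by simpa using h)
  refine (List.perm_ext_iff_of_nodup (hD.nodup_items.filter _)
    ((List.nodup_finRange n).map hinj)).2 fun it => ?_
  rw [List.mem_filter]
  constructor
  · rintro ⟨h, h1⟩
    rcases hD.exists_of_mem h with ⟨v, -, rfl⟩ | ⟨u, v, -, -, rfl⟩
    · exact List.mem_map.2 ⟨v, List.mem_finRange v, rfl⟩
    · simp at h1
  · intro h
    obtain ⟨v, -, rfl⟩ := List.mem_map.1 h
    exact ⟨List.mem_map.2 ⟨_, hD.2.2.1 v, rfl⟩, by simp⟩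

/-- Each edge is stored in just one orientation, so mapping an unordered pair to its stored
orientation covers all edge items. -/
theorem StoresGraph.length_edges_le (hD : StoresGraph (fun v : Fin n => (v : ℕ)) G D) :
    (((gather D).map Item.ofRecord).filter fun it => ¬ it.1 = 1).length ≤ G.edgeSet.ncard := by
  classical
  set E := ((gather D).map Item.ofRecord).filter fun it => ¬ it.1 = 1 with hE
  let rec₀ : Sym2 (Fin n) → Item := fun e =>
    if [(e.out.1 : ℕ), (e.out.2 : ℕ)] ∈ gather D then (0, (e.out.1 : ℕ), (e.out.2 : ℕ), 0, 0)
    else (0, (e.out.2 : ℕ), (e.out.1 : ℕ), 0, 0)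
  have hsub : E.toFinset ⊆ (Set.toFinite G.edgeSet).toFinset.image rec₀ := by
    intro it hit
    rw [List.mem_toFinset, hE, List.mem_filter] at hit
    rcases hD.exists_of_mem hit.1 with ⟨v, -, rfl⟩ | ⟨u, v, hm, hadj, rfl⟩
    · simp at hit
    · refine Finset.mem_image.2 ⟨s(u, v), by simpa using hadj, ?_⟩
      have hout : s((s(u, v) : Sym2 (Fin n)).out.1, (s(u, v) : Sym2 (Fin n)).out.2) = s(u, v) :=
        Quot.out_eq _
      have hnot : [(v : ℕ), (u : ℕ)] ∉ gather D := by
        rcases hD.2.2.2 u v hadj with h | h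
        · exact h.2
        · exact absurd hm h.2
      simp only [rec₀]
      rcases Sym2.eq_iff.1 hout with ⟨h1, h2⟩ | ⟨h1, h2⟩
      · rw [h1, h2, if_pos hm]
      · rw [h1, h2, if_neg hnot]
  have hcard := (Finset.card_le_card hsub).trans Finset.card_image_le
  rw [List.toFinset_card_of_nodup (hD.nodup_items.filter _),
    ← Set.ncard_eq_toFinset_card _ (Set.toFinite _)] at hcard
  exact hcard

theorem StoresGraph.represents (hD : StoresGraph (fun v : Fin n => (v : ℕ)) G D) {L : List Item}
    (hL : L.Perm ((gather D).map Item.ofRecord)) :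
    Represents G.toSubsetGraph id (L.flatMap bothOrientations) ∧
      (L.flatMap bothOrientations).length ≤ n + 2 * G.edgeSet.ncard := by
  have hfilter : ∀ L : List Item, (L.flatMap bothOrientations).filter (fun it => it.1 = 1) =
      L.filter fun it => it.1 = 1 := by
    intro L
    induction L with
    | nil => rfl
    | cons it L ih =>
      rw [List.flatMap_cons, List.filter_append, ih, List.filter_cons]
      by_cases h1 : it.1 = 1 <;> simp [bothOrientations, h1]
  have hlength : ∀ L : List Item, (L.flatMap bothOrientations).length =
      (L.filter fun it => it.1 = 1).length + 2 * (L.filter fun it => ¬ it.1 = 1).length := by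
    intro L
    induction L with
    | nil => rfl
    | cons it L ih =>
      rw [List.flatMap_cons, List.length_append, ih, List.filter_cons, List.filter_cons]
      by_cases h1 : it.1 = 1
      · simp [bothOrientations, h1]
        omega
      · simp [bothOrientations, h1]
        omega
  refine ⟨⟨?_, ?_, ?_⟩, ?_⟩
  · rw [hfilter]
    exact (hL.filter _).trans hD.vertices_perm
  · intro it hit h1
    obtain ⟨j, hj, hit⟩ := List.mem_flatMap.1 hit
    rcases hD.exists_of_mem (hL.mem_iff.1 hj) with ⟨v, -, rfl⟩ | ⟨u, v, -, hadj, rfl⟩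
    · simp only [bothOrientations, if_true, List.mem_singleton] at hit
      rw [hit] at h1
      exact absurd rfl h1
    · simp only [bothOrientations, zero_ne_one, if_false, List.mem_pair] at hit
      rcases hit with rfl | rfl
      · exact ⟨u, v, hadj, rfl⟩
      · exact ⟨v, u, hadj.symm, rfl⟩
  · intro a b hab
    have hab : G.Adj a b := hab
    rcases hD.2.2.2 a b hab with h | h
    · exact List.mem_flatMap.2 ⟨_, hL.mem_iff.2 (hD.edge_mem.2 h.1), by simp [bothOrientations]⟩
    · exact List.mem_flatMap.2 ⟨_, hL.mem_iff.2 (hD.edge_mem.2 h.1), by simp [bothOrientations]⟩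
  · rw [hlength, (hL.filter _).length_eq, (hL.filter _).length_eq, hD.vertices_perm.length_eq]
    have := hD.length_edges_le
    simp only [List.length_map, List.length_finRange]
    omega

end input

/-! ### The construction of the contracted graph -/

section construct

variable {n : ℕ} {R₀ : ℕ} (f : Fin R₀ → ℕ → Bool)

/-- Store every edge in both orientations. -/
def orientSteps (M D F : ℕ) : List (Step M) :=
  scanSteps (vecCode 0) (fun _ : Item => (0 : Fin 0 → ℕ)) (fun _ _ it => bothOrientations it) F M D

/-- The rounds of the construction of the contracted graph, with `T` phases. -/
noncomputable def constructSteps [Nonempty (Fin R₀)] (X : ℕ) {s : ℕ} (hs : 0 < s)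
    (p M D F C T : ℕ) : List (Step M) :=
  [absorbStep M fun st => st.memory.map Item.ofRecord] ++
    passSteps (fun _ : Item => (⟨0, hs⟩ : Fin s)) M D F C ++ orientSteps M D F ++
    (List.replicate T (phaseSteps f X hs p M D F C)).flatten ++ dedupSteps X hs p M D F C

theorem length_constructSteps [Nonempty (Fin R₀)] (X : ℕ) {s : ℕ} (hs : 0 < s)
    (p M D F C T : ℕ) : (constructSteps f X hs p M D F C T).length =
      1 + (D + 3) + (D + 1) + T * (2 * (p * (D + 3)) + 3 * (D + 1)) + (p * (D + 3) + (D + 1)) := by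
  simp [constructSteps, length_passSteps, orientSteps, length_scanSteps, length_phaseSteps,
    length_dedupSteps]
  omega

theorem length_le_recordsSize {L : List Record} {q : ℕ} (h : ∀ r ∈ L, q ≤ r.length + 1) :
    q * L.length ≤ recordsSize L := by
  induction L with
  | nil => simp [recordsSize]
  | cons r L ih =>
    have h1 := h r (by simp)
    have h2 := ih fun r' hr' => h r' (by simp [hr'])
    simp only [recordsSize, List.map_cons, List.sum_cons, List.length_cons] at h2 ⊢
    rw [mul_add]
    omega

/-- Repeated edges that arise during the phases are carried along and removed only once, at the end.
-/
theorem runs_construct [Nonempty (Fin R₀)] {D F C R B X p s k N : ℕ}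
    (hS : Sizes M S W D F C R B) (hs : 0 < s) (hsR : s ≤ R) (hR : 2 ≤ R) (hR₀ : R₀ ≤ R)
    (hXB : X ^ 16 ≤ B) (hp : 0 < p) (hXp : X ^ 3 ≤ s ^ p) (hnX : n + 2 ≤ X) (hN : n ≤ N)
    (hf : ∀ u v, u ≠ v → u < N → v < N →
      R₀ ≤ 4 * k * (Finset.univ.filter fun σ => f σ u = false ∧ f σ v = true).card)
    {G : SimpleGraph (Fin n)} {I : Fin M → List Record}
    (hI : StoresGraph (fun v : Fin n => (v : ℕ)) G I) (hIS : ∀ i, recordsSize (I i) ≤ S)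
    (hodd : 2 * (S / 2) + 1 ≤ S) (hcap : n + 2 * G.edgeSet.ncard ≤ M * C) (T : ℕ) :
    ∃ H ρ L, ∃ l : Fin M → List Item, Tracks G H ρ ∧ Represents H ρ L ∧ L.Nodup ∧
      (List.finRange M).flatMap l = L ∧ (∀ i, (l i).length ≤ C) ∧
      (4 * k) ^ T * H.support.ncard ≤ (4 * k - 1) ^ T * n ∧
      Runs S W (constructSteps f X hs p M D F C T) (inputStates I) (canon l) := by
  have hBW := hS.B_lt
  have hXB1 : X ≤ B := (Nat.le_self_pow (by norm_num) X).trans hXB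
  have hsmall₀ : ∀ it ∈ (gather I).map Item.ofRecord, it.Small X := by
    intro it hit
    rcases hI.exists_of_mem hit with ⟨v, -, rfl⟩ | ⟨u, v, -, -, rfl⟩
    · have h1 := v.2
      refine ⟨?_, ?_, ?_, ?_, ?_⟩ <;> simp only <;> omega
    · have h1 := v.2
      have h2 := u.2
      refine ⟨?_, ?_, ?_, ?_, ?_⟩ <;> simp only <;> omega
  have hmemI : ∀ i, ∀ r ∈ I i, r ∈ gather I := fun i r hr =>
    List.mem_flatMap.2 ⟨i, List.mem_finRange i, hr⟩
  have hload : ∀ i, ((I i).map Item.ofRecord).length ≤ S / 2 := by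
    intro i
    rw [List.length_map, Nat.le_div_iff_mul_le (by norm_num), mul_comm]
    refine (length_le_recordsSize fun r hr => ?_).trans (hIS i)
    rcases hI.2.1 r (hmemI i r hr) with ⟨v, rfl⟩ | ⟨u, v, -, rfl⟩ <;> simp
  have hrun₀ : Runs S W [absorbStep M fun st => st.memory.map Item.ofRecord] (inputStates I)
      (canon fun i => (I i).map Item.ofRecord) := by
    refine runs_absorb (fun i => ⟨⟨hIS i, ?_⟩, fits_nil⟩)
      (fun i => by have := hload i; simp only [inputStates]; omega) fun i a ha => ?_
    · intro r hr w hw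
      rcases hI.2.1 r (hmemI i r hr) with ⟨v, rfl⟩ | ⟨u, v, -, rfl⟩
      · have h1 := v.2
        simp only [List.mem_singleton] at hw
        omega
      · have h1 := v.2
        have h2 := u.2
        simp only [List.mem_pair] at hw
        omega
    · obtain ⟨r, hr, rfl⟩ := List.mem_map.1 ha
      exact ((hsmall₀ _ (List.mem_map.2 ⟨r, hmemI i r hr, rfl⟩)).encode_lt.trans_le hXB).trans hBW
  have hlen₀ : ((gather I).map Item.ofRecord).length ≤ M * C := by
    refine le_trans ?_ hcap
    rw [List.length_eq_length_filter_add fun it : Item => decide (it.1 = 1),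
      hI.vertices_perm.length_eq]
    have := hI.length_edges_le
    simp only [decide_not] at this
    simp only [List.length_map, List.length_finRange]
    omega
  -- Sorting by a constant digit only balances the loads: an input machine may hold up to `S / 2`
  -- items, as a record takes at least two units.
  obtain ⟨L₁, hp₁, -, hr₁⟩ := realizes_pass (c := S / 2) (fun _ : Item => (⟨0, hs⟩ : Fin s)) hS hsR
    (fun it hit => (hsmall₀ it hit).encode_lt.trans_le hXB) hlen₀ hodd
  obtain ⟨hrep, hlen₂⟩ := hI.represents hp₁
  -- A scan whose sums have no entries: in effect a local replacement on every machine.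
  have hr₂ : Realizes S W (orientSteps M D F) C L₁ (2 * C) (L₁.flatMap bothOrientations) := by
    have h1 := hS.cap_le
    have := realizes_scan (S := S) (W := W) (M := M) (c := C) (r := 2) (vecCode 0)
      (fun _ : Item => (0 : Fin 0 → ℕ)) (fun _ _ it => bothOrientations it) (L := L₁) hS.machines
      hS.pos_F ?_ hS.M_le (by omega) ?_ (by omega)
      (fun it hit => ((hsmall₀ it (hp₁.mem_iff.1 hit)).encode_lt.trans_le hXB).trans hBW)
      (fun _ _ it => by unfold bothOrientations; split_ifs <;> simp) ?_
    · rwa [scanMap_eq_flatMap _ fun _ it => bothOrientations it] at this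
    · intro l hl w hw
      obtain ⟨i, -⟩ := mem_enc_vecCode hw
      exact i.elim0
    · refine le_trans (Nat.mul_le_mul_left F ?_) hS.scan_le
      simp [vecCode]
    · rw [scanMap_eq_flatMap _ fun _ it => bothOrientations it]
      exact fun it hit => ((hrep.small (by omega) hit).encode_lt.trans_le hXB).trans hBW
  obtain ⟨H, ρ, L₃, hG₃, hrep₃, hlen₃, hsupp, hr₃⟩ := realizes_phases f hS hs hsR hR hR₀ hXB hp hXp
    (by omega) hN hf (Tracks.refl G) hrep (hlen₂.trans hcap) T
  obtain ⟨L₄, hnd, hmem, hr₄⟩ := realizes_dedup (c := 2 * C) hS hs hsR hR (by omega) hXB hp hXp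
    (fun it hit => hrep₃.small (by omega) hit)
    (fun it hit => by rcases hrep₃.eq_of_mem hit with ⟨v, rfl⟩ | ⟨a, b, -, rfl⟩ <;> rfl) hlen₃
    (by have := hS.cap_le; omega)
  obtain ⟨l, hl, hlc, hrun⟩ := (((hr₁.append hr₂).append hr₃).append hr₄)
    (fun i => (I i).map Item.ofRecord) (by rw [gather, List.map_flatMap]) hload
  refine ⟨H, ρ, L₄, l, hG₃, ⟨?_, fun it hit => hrep₃.exists_adj it ((hmem it).1 hit),
    fun a b hab => (hmem _).2 (hrep₃.mem_of_adj a b hab)⟩, hnd, hl, hlc, ?_, ?_⟩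
  · have hnd' := (List.nodup_finRange n).map (f := fun v =>
      ((1, (ρ v : ℕ), (v : ℕ), 0, 0) : Item)) fun v w h => Fin.ext (by
        simp only [Prod.mk.injEq] at h; exact h.2.2.1)
    refine (List.perm_ext_iff_of_nodup (hnd.filter _) hnd').2 fun it => ?_
    rw [← hrep₃.vertices.mem_iff, List.mem_filter, List.mem_filter, hmem]
  · refine hsupp.trans (Nat.mul_le_mul_left _ ?_)
    refine (Set.ncard_le_card _).trans ?_
    simp
  · have := hrun₀.append hrun
    simpa [constructSteps] using this

/-- The record in the output for an item. -/
def Item.toRecord (it : Item) : Option Record :=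
  if it.1 = 1 then if it.2.1 = it.2.2.1 then some [it.2.2.1] else none
  else if it.2.1 < it.2.2.1 then some [it.2.1, it.2.2.1] else none

/-- Both orientations of every edge are present, so keeping the increasing one outputs each edge
once; vertices that are their own representatives are exactly those that remain. -/
theorem Represents.storesGraph {G : SimpleGraph (Fin n)} {H : SubsetGraph (Fin n)}
    {ρ : Fin n → Fin n} {L : List Item} (hG : Tracks G H ρ) (hL : Represents H ρ L) (hnd : L.Nodup)
    {D : Fin M → List Record} (hD : gather D = L.filterMap Item.toRecord) :
    StoresGraph (fun v : H.verts => ((v : Fin n) : ℕ)) H.coe D := by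
  have hmem : ∀ r, r ∈ gather D ↔ (∃ v : Fin n, ρ v = v ∧ r = [(v : ℕ)]) ∨
      ∃ a b : Fin n, H.Adj a b ∧ a < b ∧ r = [(a : ℕ), (b : ℕ)] := by
    intro r
    rw [hD, List.mem_filterMap]
    constructor
    · rintro ⟨it, hit, hr⟩
      rcases hL.eq_of_mem hit with ⟨v, rfl⟩ | ⟨a, b, hab, rfl⟩
      · simp only [Item.toRecord, if_true, Fin.val_inj] at hr
        split_ifs at hr with h
        exact Or.inl ⟨v, h, by simpa using hr.symm⟩
      · simp only [Item.toRecord, zero_ne_one, if_false, Fin.val_fin_lt] at hr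
        split_ifs at hr with h
        exact Or.inr ⟨a, b, hab, h, by simpa using hr.symm⟩
    · rintro (⟨v, hv, rfl⟩ | ⟨a, b, hab, hlt, rfl⟩)
      · exact ⟨_, hL.vertex_mem v, by simp [Item.toRecord, hv]⟩
      · exact ⟨_, hL.mem_of_adj a b hab, by simp [Item.toRecord, hlt]⟩
  refine ⟨?_, fun r hr => ?_, fun v => ?_, fun u v huv => ?_⟩
  · rw [hD, List.Nodup, List.pairwise_filterMap]
    refine List.Pairwise.imp_of_mem (fun {x y} hx hy hxy r hr r' hr' => ?_) hnd
    rintro rfl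
    -- A record determines its item, so distinct items give distinct records.
    have hinv : ∀ z ∈ L, z.toRecord = some r → z = Item.ofRecord r := by
      intro z hz hzr
      rcases hL.eq_of_mem hz with ⟨v, rfl⟩ | ⟨a, b, -, rfl⟩
      · simp only [Item.toRecord, if_true] at hzr
        split_ifs at hzr with h
        rw [← Option.some_inj.1 hzr, h]
        rfl
      · simp only [Item.toRecord, zero_ne_one, if_false] at hzr
        split_ifs at hzr with h
        rw [← Option.some_inj.1 hzr]
        rfl
    exact hxy ((hinv x hx hr).trans (hinv y hy hr').symm)
  · rcases (hmem r).1 hr with ⟨v, hv, rfl⟩ | ⟨a, b, hab, -, rfl⟩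
    · exact Or.inl ⟨⟨v, (hG.mem_verts v).2 hv⟩, rfl⟩
    · exact Or.inr ⟨⟨a, H.edge_vert hab⟩, ⟨b, H.edge_vert hab.symm⟩, hab, rfl⟩
  · exact (hmem _).2 (Or.inl ⟨v, (hG.mem_verts _).1 v.2, rfl⟩)
  · have hadj : H.Adj u v := huv
    have key : ∀ x y : Fin n, H.Adj x y → ([(x : ℕ), (y : ℕ)] ∈ gather D ↔ x < y) := by
      intro x y hxy
      rw [hmem]
      constructor
      · rintro (⟨w, -, hw⟩ | ⟨a, b, -, hlt, he⟩)
        · simp at hw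
        · simp only [List.cons.injEq, and_true] at he
          rw [Fin.lt_def, he.1, he.2]
          exact hlt
      · exact fun h => Or.inr ⟨x, y, hxy, h, rfl⟩
    rw [key u v hadj, key v u hadj.symm]
    have hne : (u : Fin n) ≠ v := (H.adj_sub hadj).ne
    rcases lt_or_gt_of_ne hne with h | h
    · exact Or.inl ⟨h, h.asymm⟩
    · exact Or.inr ⟨h, h.asymm⟩

end construct

end MPC

namespace MPC

variable {M S W : ℕ}

/-! ### Transferring a solution to the original graph -/

/-- The item for a record of a connectivity solution. -/
def Item.ofLabel : Record → Item
  | [u, w] => (0, u, w, 0, 0)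
  | _ => (0, 0, 0, 0, 0)

/-- The record of the transferred solution for an item. -/
def Item.toLabel (it : Item) : Option Record :=
  if it.1 = 1 then some [it.2.1, it.2.2.2.2 - 1] else none

/-- The vertex items in the memory, and the labels in the messages. -/
def transferInput (st : LocalState) : List Item :=
  ((unpack st.memory : List Item).filter fun it => it.1 = 1) ++ st.inbox.map Item.ofLabel

/-- The rounds that transfer a connectivity solution of the contracted graph to the original
graph. -/
def transferSteps (X : ℕ) {s : ℕ} (hs : 0 < s) (p M D F C : ℕ) : List (Step M) :=
  [absorbStep M transferInput] ++ attachSteps X hs p M D F C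

theorem length_transferSteps (X : ℕ) {s : ℕ} (hs : 0 < s) (p M D F C : ℕ) :
    (transferSteps X hs p M D F C).length = 1 + (p * (D + 3) + (D + 1)) := by
  simp [transferSteps, length_attachSteps, add_comm]

variable {n : ℕ} {G : SimpleGraph (Fin n)} {H : SubsetGraph (Fin n)} {ρ : Fin n → Fin n}

theorem Tracks.mem (hG : Tracks G H ρ) (v : Fin n) : ρ v ∈ H.verts :=
  (hG.mem_verts _).2 (hG.apply_apply v)

theorem Tracks.isConnectivitySolution (hG : Tracks G H ρ) {cc : H.verts → ℕ}
    (hcc : IsConnectivitySolution H.coe cc) :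
    IsConnectivitySolution G fun v => cc ⟨ρ v, hG.mem v⟩ := by
  intro u v
  rw [hG.reachable u v, ← hcc, SubsetGraph.reachable_coe_iff]

theorem length_gather_label_le {cc : H.verts → ℕ} {E : Fin M → List Record}
    (hE : StoresFunction (fun v : H.verts => ((v : Fin n) : ℕ)) cc E) : (gather E).length ≤ n := by
  classical
  have hsub : gather E ⊆ (List.finRange n).map fun v : Fin n =>
      [(v : ℕ), if h : v ∈ H.verts then cc ⟨v, h⟩ else 0] := by
    intro r hr
    obtain ⟨v, rfl⟩ := (hE.2 r).1 hr
    exact List.mem_map.2 ⟨v, List.mem_finRange _, by simp⟩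
  simpa using (List.subperm_of_subset hE.1 hsub).length_le

/-- A label record becomes an edge item from a remaining vertex to its label. One attachment then
hands the label, as the only neighbour, to all vertex items with that representative. -/
theorem runs_transfer {D F C R B X p s : ℕ} (hS : Sizes M S W D F C R B) (hs : 0 < s)
    (hsR : s ≤ R) (hR : 2 ≤ R) (hXB : X ^ 16 ≤ B) (hp : 0 < p) (hXp : X ^ 3 ≤ s ^ p)
    (hnX : n + 2 ≤ X) (h6 : 6 * C + 3 ≤ S) (hcap : 2 * n ≤ M * C) (hG : Tracks G H ρ)
    {L : List Item} (hL : Represents H ρ L) {l : Fin M → List Item}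
    (hl : (List.finRange M).flatMap l = L) (hlc : ∀ i, (l i).length ≤ C) {cc : H.verts → ℕ}
    (hcc : ∀ v, cc v + 1 < X) {E : Fin M → List Record}
    (hE : StoresFunction (fun v : H.verts => ((v : Fin n) : ℕ)) cc E)
    (hES : ∀ i, recordsSize (E i) ≤ S) :
    ∃ l' : Fin M → List Item, (∀ i, (l' i).length ≤ C) ∧ (∀ i, ∀ it ∈ l' i, it.Small X) ∧
      StoresFunction (fun v : Fin n => (v : ℕ)) (fun v => cc ⟨ρ v, hG.mem v⟩)
        (fun i => (l' i).filterMap Item.toLabel) ∧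
      Runs S W (transferSteps X hs p M D F C) (resumeStates (canon l) E) (canon l') := by
  have hBW := hS.B_lt
  have hXB1 : X ≤ B := (Nat.le_self_pow (by norm_num) X).trans hXB
  have hmemE : ∀ i, ∀ r ∈ E i, r ∈ gather E := fun i r hr =>
    List.mem_flatMap.2 ⟨i, List.mem_finRange i, hr⟩
  have hmemL : ∀ i, ∀ it ∈ l i, it ∈ L := fun i it hit => by
    rw [← hl]
    exact List.mem_flatMap.2 ⟨i, List.mem_finRange i, hit⟩
  set l₀ : Fin M → List Item := fun i =>
    ((l i).filter fun it => it.1 = 1) ++ (E i).map Item.ofLabel with hl₀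
  set L₀ := (List.finRange M).flatMap l₀ with hL₀
  have hmem₀ : ∀ it, it ∈ L₀ ↔ (it ∈ L ∧ it.1 = 1) ∨
      ∃ v : H.verts, it = (0, ((v : Fin n) : ℕ), cc v, 0, 0) := by
    intro it
    simp only [hL₀, hl₀, List.mem_flatMap, List.mem_append, List.mem_filter, List.mem_map,
      decide_eq_true_eq]
    constructor
    · rintro ⟨i, -, ⟨h1, h2⟩ | ⟨r, hr, rfl⟩⟩
      · exact Or.inl ⟨hmemL i it h1, h2⟩
      · obtain ⟨v, rfl⟩ := (hE.2 r).1 (hmemE i r hr)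
        exact Or.inr ⟨v, rfl⟩
    · rintro (⟨h1, h2⟩ | ⟨v, rfl⟩)
      · rw [← hl] at h1
        obtain ⟨i, hi, h1⟩ := List.mem_flatMap.1 h1
        exact ⟨i, hi, Or.inl ⟨h1, h2⟩⟩
      · obtain ⟨i, hi, h1⟩ := List.mem_flatMap.1 ((hE.2 _).2 ⟨v, rfl⟩)
        exact ⟨i, hi, Or.inr ⟨_, h1, rfl⟩⟩
  have hsmall₀ : ∀ it ∈ L₀, it.Small X := by
    intro it hit
    rcases (hmem₀ it).1 hit with ⟨h1, -⟩ | ⟨v, rfl⟩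
    · exact hL.small (by omega) h1
    · have h1 := (v : Fin n).2
      have h2 := hcc v
      refine ⟨?_, ?_, ?_, ?_, ?_⟩ <;> simp only <;> omega
  have hfilter₀ : (L₀.filter fun it => it.1 = 1) = L.filter fun it => it.1 = 1 := by
    rw [hL₀, ← hl, List.filter_flatMap, List.filter_flatMap]
    congr 1
    funext i
    have : ((E i).map Item.ofLabel).filter (fun it => it.1 = 1) = [] := by
      rw [List.filter_eq_nil_iff]
      intro it hit
      obtain ⟨r, hr, rfl⟩ := List.mem_map.1 hit
      obtain ⟨v, rfl⟩ := (hE.2 r).1 (hmemE i r hr)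
      simp [Item.ofLabel]
    simp [hl₀, this]
  -- A label record takes three units, so at most `S / 3` of them join the at most `C` stored vertex
  -- items; `h6` leaves enough room for sorting.
  have hload : ∀ i, (l₀ i).length ≤ C + S / 3 := by
    intro i
    have h1 : (E i).length ≤ S / 3 := by
      rw [Nat.le_div_iff_mul_le (by norm_num), mul_comm]
      refine (length_le_recordsSize fun r hr => ?_).trans (hES i)
      obtain ⟨v, rfl⟩ := (hE.2 r).1 (hmemE i r hr)
      simp
    have h2 := (List.length_filter_le (fun it : Item => decide (it.1 = 1)) (l i)).trans (hlc i)
    simp only [hl₀, List.length_append, List.length_map]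
    omega
  have hlen₀ : L₀.length ≤ M * C := by
    refine le_trans ?_ hcap
    have h1 : L₀.length = (L.filter fun it => it.1 = 1).length + (gather E).length := by
      rw [hL₀, ← hl, List.filter_flatMap, gather, List.length_flatMap, List.length_flatMap,
        List.length_flatMap, ← List.sum_map_add]
      simp [hl₀]
    rw [h1, hL.vertices.length_eq]
    have := length_gather_label_le hE
    simp only [List.length_map, List.length_finRange]
    omega
  have hrun₀ : Runs S W [absorbStep M transferInput] (resumeStates (canon l) E) (canon l₀) := by
    have := runs_absorb (S := S) (W := W) (g := transferInput) (s := resumeStates (canon l) E)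
      (fun i => ⟨?_, hES i, ?_⟩) ?_ ?_
    · simpa [transferInput, resumeStates, canon] using this
    · exact fits_pack (by have := hlc i; omega) fun it hit =>
        ((hL.small (by omega) (hmemL i it hit)).encode_lt.trans_le hXB).trans hBW
    · intro r hr w hw
      obtain ⟨v, rfl⟩ := (hE.2 r).1 (hmemE i r hr)
      have h1 := (v : Fin n).2
      have h2 := hcc v
      simp only [List.mem_pair] at hw
      omega
    · intro i
      have := hload i
      simp only [transferInput, resumeStates, canon, unpack_pack]
      simp only [hl₀] at this
      omega
    · intro i it hit
      simp only [transferInput, resumeStates, canon, unpack_pack] at hit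
      exact ((hsmall₀ it (List.mem_flatMap.2 ⟨i, List.mem_finRange i, hit⟩)).encode_lt.trans_le
        hXB).trans hBW
  obtain ⟨L₁, hp₁, hX₁, hr₁⟩ := realizes_attach (c := C + S / 3) hS hs hsR hR hXB hp hXp hsmall₀
    hlen₀ (by omega)
  obtain ⟨l', hl', hlc', hrun⟩ := hr₁ l₀ rfl hload
  have hnb : ∀ v : Fin n, leastNbr (edgeRel L₀) (ρ v) = cc ⟨ρ v, hG.mem v⟩ + 1 := by
    classical
    intro v
    have hrel : ∀ b, edgeRel L₀ (ρ v) b ↔ b = cc ⟨ρ v, hG.mem v⟩ := by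
      intro b
      constructor
      · rintro ⟨it, hit, h0, ha, rfl⟩
        rcases (hmem₀ it).1 hit with ⟨-, h1⟩ | ⟨w, rfl⟩
        · omega
        · have : w = ⟨ρ v, hG.mem v⟩ := Subtype.ext (Fin.ext ha)
          rw [this]
      · rintro rfl
        exact ⟨_, (hmem₀ _).2 (Or.inr ⟨⟨ρ v, hG.mem v⟩, rfl⟩), rfl, rfl, rfl⟩
    have hex : ∃ b, edgeRel L₀ (ρ v) b := ⟨_, (hrel _).2 rfl⟩
    rw [leastNbr, dif_pos hex, (hrel _).1 (Nat.find_spec hex)]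
  have hgather : (gather fun i => (l' i).filterMap Item.toLabel).Perm
      ((List.finRange n).map fun v : Fin n => [(v : ℕ), cc ⟨ρ v, hG.mem v⟩]) := by
    have h1 : (gather fun i => (l' i).filterMap Item.toLabel) = L₁.filterMap Item.toLabel := by
      rw [← hl', gather, List.filterMap_flatMap]
    have h2 : ∀ (nb : ℕ → ℕ) (L : List Item),
        (L.map fun it => it.turn (nb it.2.1)).filterMap Item.toLabel =
          (L.filter fun it => it.1 = 1).map fun it => [it.2.2.1, nb it.2.1 - 1] := by
      intro nb L
      induction L with
      | nil => rfl
      | cons it L ih =>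
        rw [List.map_cons, List.filterMap_cons, List.filter_cons, ih]
        by_cases h1 : it.1 = 1 <;> simp [Item.toLabel, Item.turn, h1]
    rw [h1]
    refine (hp₁.filterMap _).trans ?_
    rw [h2, hfilter₀]
    refine (hL.vertices.map _).trans (List.Perm.of_eq ?_)
    rw [List.map_map]
    refine List.map_congr_left fun v _ => ?_
    simp only [Function.comp_apply, hnb, Nat.add_sub_cancel]
  refine ⟨l', hlc', fun i it hit => hX₁ it ?_, ⟨?_, fun r => ?_⟩, hrun₀.append hrun⟩
  · rw [← hl']
    exact List.mem_flatMap.2 ⟨i, List.mem_finRange i, hit⟩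
  · refine hgather.nodup_iff.2 ((List.nodup_finRange n).map fun v w h => Fin.ext ?_)
    simp only [List.cons.injEq] at h
    exact h.1
  · rw [hgather.mem_iff, List.mem_map]
    exact ⟨fun ⟨v, _, h⟩ => ⟨v, h.symm⟩, fun ⟨v, h⟩ => ⟨v, List.mem_finRange v, h.symm⟩⟩

end MPC

namespace MPC

/-! ### The choice of the parameters -/

/-- About the `k`-th part of the number of bits of a vertex. -/
def bits (k n : ℕ) : ℕ := Nat.clog 2 (n + 2) / k + 1

/-- The base in which the keys are sorted, about `n ^ (1 / k)`. -/
def base (k n : ℕ) : ℕ := 2 ^ bits k n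

/-- The number of items that a machine holds between the operations. -/
def capacity (k n : ℕ) : ℕ := base k n ^ 2

/-- The base in which the machines are numbered. -/
noncomputable def fan (k n m : ℕ) : ℕ := sInf {F | 2 * (n + m) ≤ F ^ (2 * k) * capacity k n}

/-- The number of machines. -/
noncomputable def machineCount (k n m : ℕ) : ℕ := fan k n m ^ (2 * k)

/-- The local space. -/
def space (k n : ℕ) : ℕ := if n = 0 then 0 else 2 * (8 * k + 2) * base k n ^ 2 + 1

section parameters

variable {k n m : ℕ}

theorem two_le_base : 2 ≤ base k n := by
  exact Nat.le_self_pow (Nat.succ_ne_zero _) 2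

theorem base_pos : 0 < base k n := by
  have := two_le_base (k := k) (n := n)
  omega

theorem le_base_pow (hk : 0 < k) : n + 2 ≤ base k n ^ k := by
  unfold base bits
  rw [← pow_mul]
  refine (Nat.le_pow_clog (by norm_num) (n + 2)).trans (Nat.pow_le_pow_right (by norm_num) ?_)
  have := Nat.lt_div_mul_add (a := Nat.clog 2 (n + 2)) hk
  rw [add_mul]
  omega

theorem two_pow_clog_le : 2 ^ Nat.clog 2 (n + 2) ≤ 2 * (n + 2) := by
  have h1 := Nat.pow_pred_clog_lt_self (b := 2) (by norm_num) (x := n + 2) (by omega)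
  have h2 : 0 < Nat.clog 2 (n + 2) := Nat.clog_pos (by norm_num) (by omega)
  obtain ⟨j, hj⟩ := Nat.exists_eq_succ_of_ne_zero h2.ne'
  rw [hj] at h1 ⊢
  rw [Nat.pow_succ]
  simp only [Nat.succ_eq_add_one, Nat.pred_succ] at h1
  omega

theorem base_pow_le : base k n ^ k ≤ 2 ^ (k + 1) * (n + 2) := by
  unfold base bits
  rw [← pow_mul, add_mul, one_mul, pow_add]
  have h1 : 2 ^ (Nat.clog 2 (n + 2) / k * k) ≤ 2 ^ Nat.clog 2 (n + 2) :=
    Nat.pow_le_pow_right (by norm_num) (Nat.div_mul_le_self _ _)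
  calc 2 ^ (Nat.clog 2 (n + 2) / k * k) * 2 ^ k ≤ (2 * (n + 2)) * 2 ^ k :=
        Nat.mul_le_mul_right _ (h1.trans two_pow_clog_le)
    _ = _ := by ring

theorem base_le : base k n ≤ (n + 2) ^ 3 := by
  have h1 : base k n ≤ 2 ^ (Nat.clog 2 (n + 2) + 1) :=
    Nat.pow_le_pow_right (by norm_num) (Nat.succ_le_succ (Nat.div_le_self _ _))
  have h2 := two_pow_clog_le (n := n)
  rw [pow_succ] at h1
  have h3 : 2 * 2 * (n + 2) ≤ (n + 2) * (n + 2) * (n + 2) :=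
    Nat.mul_le_mul_right _ (Nat.mul_le_mul (by omega) (by omega))
  have h4 : (n + 2) ^ 3 = (n + 2) * (n + 2) * (n + 2) := by ring
  omega

theorem le_fan_pow (hk : 0 < k) : 2 * (n + m) ≤ machineCount k n m * capacity k n := by
  have hne : {F | 2 * (n + m) ≤ F ^ (2 * k) * capacity k n}.Nonempty := by
    refine ⟨2 * (n + m), ?_⟩
    refine (Nat.le_self_pow (by omega) _).trans (Nat.le_mul_of_pos_right _ ?_)
    exact pow_pos base_pos 2
  exact Nat.sInf_mem hne

theorem fan_pos (hk : 0 < k) (hn : 0 < n) : 0 < fan k n m := by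
  have h := le_fan_pow (n := n) (m := m) hk
  rw [machineCount] at h
  by_contra h0
  rw [Nat.eq_zero_of_not_pos h0, zero_pow (by omega)] at h
  omega

/-- The value `base k n` already satisfies the defining inequality, because its power `2 * k`
exceeds `(n + 2) ^ 2`, which dominates the input size. -/
theorem fan_le_base (hk : 0 < k) (hm : 2 * m ≤ n * n) : fan k n m ≤ base k n := by
  refine Nat.sInf_le ?_
  have h1 : (n + 2) ^ 2 ≤ base k n ^ (2 * k) := by
    rw [mul_comm, pow_mul]
    exact Nat.pow_le_pow_left (le_base_pow hk) 2
  have h2 : base k n ^ (2 * k) ≤ base k n ^ (2 * k) * capacity k n :=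
    Nat.le_mul_of_pos_right _ (pow_pos base_pos 2)
  have h3 : 2 * (n + m) ≤ (n + 2) ^ 2 := by nlinarith
  exact h3.trans (h1.trans h2)

theorem space_le_mul_capacity : space k n ≤ (16 * k + 5) * capacity k n := by
  unfold space capacity
  split_ifs
  · omega
  · have : 1 ≤ base k n ^ 2 := pow_pos base_pos 2
    nlinarith

theorem capacity_le (hk : 2 ≤ k) (hn : 0 < n) : capacity k n ≤ 2 ^ (k + 1) * 3 * n := by
  refine (Nat.pow_le_pow_right base_pos hk).trans (base_pow_le.trans ?_)
  rw [mul_assoc]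
  exact Nat.mul_le_mul_left _ (by omega)

/-- Rounding the number of machines up to a power costs a constant factor: by minimality `fan - 1`
is too small, and `fan` is at most twice that. If `fan` is 1, the single capacity is already linear
in `n`, as `k` is at least 2. -/
theorem machineCount_mul_capacity_le (hk : 2 ≤ k) (hn : 0 < n) :
    capacity k n * machineCount k n m ≤ (2 ^ (k + 1) * 3 + 2 ^ (2 * k) * 2) * (n + m) := by
  have hpos := fan_pos (m := m) (by omega : 0 < k) hn
  rw [machineCount]
  by_cases h1 : fan k n m = 1
  · rw [h1, one_pow, mul_one]
    refine (capacity_le hk hn).trans (Nat.mul_le_mul ?_ ?_) <;> omega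
  · have hlt : fan k n m - 1 < fan k n m := by omega
    have h2 := Nat.notMem_of_lt_sInf hlt
    have h2' : (fan k n m - 1) ^ (2 * k) * capacity k n < 2 * (n + m) := not_le.1 h2
    have h3 : fan k n m ^ (2 * k) ≤ 2 ^ (2 * k) * (fan k n m - 1) ^ (2 * k) := by
      rw [← mul_pow]
      exact Nat.pow_le_pow_left (by omega) _
    calc capacity k n * fan k n m ^ (2 * k)
        ≤ capacity k n * (2 ^ (2 * k) * (fan k n m - 1) ^ (2 * k)) := Nat.mul_le_mul_left _ h3
      _ = 2 ^ (2 * k) * ((fan k n m - 1) ^ (2 * k) * capacity k n) := by ring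
      _ ≤ 2 ^ (2 * k) * (2 * (n + m)) := Nat.mul_le_mul_left _ h2'.le
      _ = 2 ^ (2 * k) * 2 * (n + m) := by ring
      _ ≤ _ := Nat.mul_le_mul_right _ (by omega)

theorem space_mul_machineCount_le (hk : 2 ≤ k) (hm : n = 0 → m = 0) :
    space k n * machineCount k n m ≤
      (16 * k + 5) * (2 ^ (k + 1) * 3 + 2 ^ (2 * k) * 2) * (n + m) := by
  rcases Nat.eq_zero_or_pos n with rfl | hn
  · simp [space]
  · calc space k n * machineCount k n m
        ≤ (16 * k + 5) * capacity k n * machineCount k n m :=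
          Nat.mul_le_mul_right _ space_le_mul_capacity
      _ = (16 * k + 5) * (capacity k n * machineCount k n m) := by ring
      _ ≤ _ := by
        rw [mul_assoc]
        exact Nat.mul_le_mul_left _ (machineCount_mul_capacity_le hk hn)

theorem capacity_le_space_div (hk : 0 < k) (hn : 0 < n) : 6 * capacity k n + 3 ≤ space k n := by
  unfold space capacity
  rw [if_neg hn.ne']
  have : 1 ≤ base k n ^ 2 := pow_pos base_pos 2
  nlinarith

theorem add_le_machineCount_mul (hk : 0 < k) (hm : n = 0 → m = 0) :
    n + m ≤ machineCount k n m * (space k n / 3) := by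
  rcases Nat.eq_zero_or_pos n with rfl | hn
  · simp [hm rfl]
  · have h1 := le_fan_pow (n := n) (m := m) hk
    have h2 : capacity k n ≤ space k n / 3 := by
      have := capacity_le_space_div hk hn
      omega
    have := Nat.mul_le_mul_left (machineCount k n m) h2
    omega

/-- The power `base ^ k` is linear in `n`, so the square of the base is of order `n ^ (2 / k)`. For
`n = 0` the right side vanishes, which is why `space` is defined to be zero there. -/
theorem space_le_rpow {δ : ℝ} (hδ : 0 < δ) (hk : 2 ≤ k) (hkδ : 2 / (k : ℝ) ≤ δ) :
    (space k n : ℝ) ≤ ((16 * k + 5) * (2 ^ (k + 1) * 3) : ℕ) * (n : ℝ) ^ δ := by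
  rcases Nat.eq_zero_or_pos n with rfl | hn
  · simp [space, Real.zero_rpow hδ.ne']
  have hk0 : (0 : ℝ) < k := by
    have : 0 < k := by omega
    exact_mod_cast this
  have hn1 : (1 : ℝ) ≤ n := by exact_mod_cast hn
  have hbk : ((base k n : ℝ)) ^ k ≤ (2 ^ (k + 1) * 3 : ℝ) * n := by
    have h1 : base k n ^ k ≤ 2 ^ (k + 1) * 3 * n := by
      refine base_pow_le.trans ?_
      rw [mul_assoc]
      exact Nat.mul_le_mul_left _ (by omega)
    exact_mod_cast h1
  have hA : (1 : ℝ) ≤ 2 ^ (k + 1) * 3 := by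
    have : (1 : ℝ) ≤ 2 ^ (k + 1) := one_le_pow₀ (by norm_num)
    linarith
  have hcap : (capacity k n : ℝ) ≤ (2 ^ (k + 1) * 3 : ℝ) * (n : ℝ) ^ δ := by
    have h1 : (capacity k n : ℝ) = ((base k n : ℝ) ^ k) ^ (2 / (k : ℝ)) := by
      rw [← Real.rpow_natCast, ← Real.rpow_mul (by positivity), mul_div_cancel₀ _ hk0.ne', capacity]
      push_cast
      exact (Real.rpow_natCast _ 2).symm
    rw [h1]
    calc ((base k n : ℝ) ^ k) ^ (2 / (k : ℝ)) ≤ ((2 ^ (k + 1) * 3 : ℝ) * n) ^ (2 / (k : ℝ)) :=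
          Real.rpow_le_rpow (by positivity) hbk (by positivity)
      _ = (2 ^ (k + 1) * 3 : ℝ) ^ (2 / (k : ℝ)) * (n : ℝ) ^ (2 / (k : ℝ)) :=
          Real.mul_rpow (by positivity) (by positivity)
      _ ≤ (2 ^ (k + 1) * 3 : ℝ) ^ (1 : ℝ) * (n : ℝ) ^ δ := by
          refine mul_le_mul (Real.rpow_le_rpow_of_exponent_le hA ?_)
            (Real.rpow_le_rpow_of_exponent_le hn1 hkδ) (by positivity) (by positivity)
          rw [div_le_one hk0]
          exact_mod_cast hk
      _ = _ := by rw [Real.rpow_one]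
  have hS : (space k n : ℝ) ≤ ((16 * k + 5 : ℕ) : ℝ) * capacity k n := by
    exact_mod_cast space_le_mul_capacity
  refine hS.trans ?_
  have := mul_le_mul_of_nonneg_left hcap (Nat.cast_nonneg (α := ℝ) (16 * k + 5))
  refine this.trans (le_of_eq ?_)
  push_cast
  ring

/-- The exponent of a bound for the items, if the labels are below `(n + 2) ^ a`. -/
def exponent (k a : ℕ) : ℕ := 16 * (a + 1) + (6 * k + 6)

/-- The scan width `4 * k * base` has room for the `2 * k * base` votes and for the digit counts. In
`exponent`, the term `16 * (a + 1)` covers encoded items and `6 * k + 6` covers routing tags; the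
word bound is the square, for a tag paired with an item. -/
theorem sizes (hk : 0 < k) (hn : 0 < n) (hm : 2 * m ≤ n * n) (a : ℕ) :
    Sizes (machineCount k n m) (space k n) ((n + 2) ^ (2 * exponent k a)) (2 * k) (fan k n m)
      (capacity k n) (4 * k * base k n) ((n + 2) ^ exponent k a) where
  machines := rfl
  pos_F := fan_pos hk hn
  pos_C := pow_pos base_pos 2
  scan_le := by
    refine (Nat.mul_le_mul_right _ (fan_le_base hk hm)).trans ?_
    unfold space
    rw [if_neg hn.ne']
    have := base_pos (k := k) (n := n)
    nlinarith
  cap_le := by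
    have := capacity_le_space_div hk hn
    omega
  two_le := (show 2 ≤ n + 2 by omega).trans (Nat.le_self_pow (by unfold exponent; omega) _)
  tag_le := by
    have h1 : machineCount k n m ≤ base k n ^ (2 * k) := Nat.pow_le_pow_left (fan_le_base hk hm) _
    calc machineCount k n m * capacity k n ≤ base k n ^ (2 * k) * base k n ^ 2 :=
          Nat.mul_le_mul_right _ h1
      _ = base k n ^ (2 * k + 2) := (pow_add _ _ _).symm
      _ ≤ ((n + 2) ^ 3) ^ (2 * k + 2) := Nat.pow_le_pow_left base_le _
      _ = (n + 2) ^ (6 * k + 6) := by rw [← pow_mul]; ring_nf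
      _ ≤ _ := Nat.pow_le_pow_right (by omega) (by unfold exponent; omega)
  sq_le := by rw [← pow_add, two_mul]

theorem key_le (hk : 0 < k) (a : ℕ) : ((n + 2) ^ (a + 1)) ^ 3 ≤ base k n ^ (3 * k * (a + 1)) := by
  calc ((n + 2) ^ (a + 1)) ^ 3 = (n + 2) ^ (3 * (a + 1)) := by rw [← pow_mul, mul_comm]
    _ ≤ (base k n ^ k) ^ (3 * (a + 1)) := Nat.pow_le_pow_left (le_base_pow hk) _
    _ = _ := by rw [← pow_mul]; ring_nf

theorem entry_le (k a : ℕ) : ((n + 2) ^ (a + 1)) ^ 16 ≤ (n + 2) ^ exponent k a := by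
  rw [← pow_mul]
  exact Nat.pow_le_pow_right (by omega) (by unfold exponent; omega)

end parameters

theorem two_mul_ncard_edgeSet_le {n : ℕ} (G : SimpleGraph (Fin n)) :
    2 * G.edgeSet.ncard ≤ n * n := by
  classical
  have h1 := G.card_edgeFinset_le_card_choose_two
  rw [Fintype.card_fin, ← SimpleGraph.coe_edgeFinset] at *
  rw [Set.ncard_coe_finset]
  have h2 : n.choose 2 * 2 ≤ n * n := by
    rw [Nat.choose_two_right]
    exact (Nat.div_mul_le_self _ _).trans (Nat.mul_le_mul_left _ (by omega))
  omega

/-! ### The number of phases -/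

/-- A number of phases that leaves few vertices. -/
noncomputable def phaseCount (k : ℕ) (c : ℝ) (n : ℕ) : ℕ :=
  ⌈4 * k * (|c| + 1) * max 1 (Real.log (Real.log n))⌉₊

/-- Use `(1 - 1 / (4k)) ^ T ≤ exp (-T / (4k))`. For `n ≥ 3` the exponent beats `c * log log n`. For
`n = 2` the logarithm is below 1, but the bound `2 / e < 1` leaves no vertex; this uses the summand
1 in `|c| + 1`. -/
theorem support_le_of_phases {k n : ℕ} {c : ℝ} (hk : 0 < k) {V : Set (Fin n)}
    (hV : n ≤ 1 → V = ∅)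
    (h : (4 * k) ^ phaseCount k c n * V.ncard ≤ (4 * k - 1) ^ phaseCount k c n * n) :
    (V.ncard : ℝ) ≤ n / Real.log n ^ c := by
  by_cases hn1 : n ≤ 1
  · rw [hV hn1, Set.ncard_empty, Nat.cast_zero]
    exact div_nonneg (Nat.cast_nonneg n) (Real.rpow_nonneg (Real.log_natCast_nonneg n) c)
  set T := phaseCount k c n with hT
  set mx := max 1 (Real.log (Real.log n)) with hmx
  have hk0 : (0 : ℝ) < 4 * k := by positivity
  have hmx1 : 1 ≤ mx := le_max_left _ _
  have hTle : (|c| + 1) * mx ≤ T / (4 * k) := by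
    rw [le_div_iff₀ hk0]
    refine le_trans (le_of_eq ?_) (Nat.le_ceil _)
    ring
  have hreal : (4 * k : ℝ) ^ T * V.ncard ≤ (4 * k - 1) ^ T * n := by
    have h1 : ((4 * k - 1 : ℕ) : ℝ) = 4 * k - 1 := by
      rw [Nat.cast_sub (by omega)]
      push_cast
      ring
    rw [← h1]
    exact_mod_cast h
  have hexp : (V.ncard : ℝ) ≤ Real.exp (-((|c| + 1) * mx)) * n := by
    have h1 : (V.ncard : ℝ) ≤ (1 - 1 / (4 * k)) ^ T * n := by
      have h2 : (1 - 1 / (4 * k : ℝ)) = (4 * k - 1) / (4 * k) := by field_simp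
      rw [h2, div_pow, div_mul_eq_mul_div, le_div_iff₀ (by positivity), mul_comm]
      exact hreal
    refine h1.trans (mul_le_mul_of_nonneg_right ?_ (Nat.cast_nonneg n))
    have h3 : (1 - 1 / (4 * k : ℝ)) ^ T ≤ Real.exp (-(1 / (4 * k : ℝ))) ^ T := by
      refine pow_le_pow_left₀ ?_ (Real.one_sub_le_exp_neg _) T
      have hk1 : (1 : ℝ) ≤ k := by exact_mod_cast hk
      rw [sub_nonneg, div_le_one hk0]
      linarith
    refine h3.trans ?_
    rw [← Real.exp_nat_mul]
    refine Real.exp_le_exp.2 ?_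
    have : (T : ℝ) * -(1 / (4 * k)) = -(T / (4 * k)) := by ring
    rw [this]
    linarith
  have hc0 : 0 ≤ |c| := abs_nonneg c
  by_cases hn2 : n = 2
  · have hlt : (V.ncard : ℝ) < 1 := by
      refine hexp.trans_lt ?_
      have h1 : Real.exp (-((|c| + 1) * mx)) ≤ Real.exp (-1) := Real.exp_le_exp.2 (by nlinarith)
      have h2 : Real.exp (-1) * 2 < 1 := by
        rw [Real.exp_neg, inv_mul_lt_iff₀ (Real.exp_pos 1)]
        linarith [Real.exp_one_gt_d9]
      rw [hn2]
      push_cast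
      linarith
    have h0 : V.ncard = 0 := by
      have : V.ncard < 1 := by exact_mod_cast hlt
      omega
    rw [h0, Nat.cast_zero]
    exact div_nonneg (Nat.cast_nonneg n) (Real.rpow_nonneg (Real.log_natCast_nonneg n) c)
  · have hn3 : (3 : ℝ) ≤ n := by
      have : 3 ≤ n := by omega
      exact_mod_cast this
    have hlog : 1 < Real.log n := by
      rw [Real.lt_log_iff_exp_lt (by linarith)]
      linarith [Real.exp_one_lt_d9]
    have hll : 0 ≤ Real.log (Real.log n) := Real.log_nonneg hlog.le
    refine hexp.trans ?_
    rw [Real.rpow_def_of_pos (by linarith), div_eq_mul_inv, ← Real.exp_neg, mul_comm]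
    refine mul_le_mul_of_nonneg_left (Real.exp_le_exp.2 ?_) (Nat.cast_nonneg n)
    have h1 : Real.log (Real.log n) * c ≤ Real.log (Real.log n) * |c| :=
      mul_le_mul_of_nonneg_left (le_abs_self c) hll
    have h2 : Real.log (Real.log n) ≤ mx := le_max_right _ _
    nlinarith

theorem phaseCount_le (k : ℕ) (c : ℝ) (n : ℕ) :
    (phaseCount k c n : ℝ) ≤ ((⌈4 * k * (|c| + 1)⌉₊ + 1 : ℕ) : ℝ) * max 1 (Real.log (Real.log n)) := by
  have hmx1 : 1 ≤ max 1 (Real.log (Real.log n)) := le_max_left _ _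
  have h1 : 0 ≤ 4 * k * (|c| + 1) := by positivity
  have h2 := (Nat.ceil_lt_add_one (mul_nonneg h1 (by linarith : 0 ≤ max 1 (Real.log (Real.log n))))).le
  have h3 := mul_le_mul_of_nonneg_right (Nat.le_ceil (4 * k * (|c| + 1)))
    (by linarith : 0 ≤ max 1 (Real.log (Real.log n)))
  unfold phaseCount
  push_cast
  linarith

end MPC

namespace MPC

/-! ### The programs -/

theorem fits_filterMap {S W : ℕ} {l : List Item} {g : Item → Option Record}
    (hg : ∀ it ∈ l, ∀ r ∈ g it, r.length ≤ 2 ∧ ∀ w ∈ r, w < W) (hS : 3 * l.length ≤ S) :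
    Fits S W (l.filterMap g) := by
  have hmem : ∀ r ∈ l.filterMap g, r.length ≤ 2 ∧ ∀ w ∈ r, w < W := by
    intro r hr
    obtain ⟨it, hit, h⟩ := List.mem_filterMap.1 hr
    exact hg it hit r h
  refine ⟨le_trans ?_ hS, fun r hr => (hmem r hr).2⟩
  have h1 : recordsSize (l.filterMap g) ≤ ((l.filterMap g).map fun r => r.length + 1).length * 3 :=
    List.sum_le_card_nsmul _ 3 fun x hx => by
      obtain ⟨r, hr, rfl⟩ := List.mem_map.1 hx
      have := (hmem r hr).1
      omega
  have h2 := List.length_filterMap_le g l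
  rw [List.length_map] at h1
  omega

theorem Item.Small.toRecord_lt {X : ℕ} {it : Item} (h : it.Small X) :
    ∀ r ∈ it.toRecord, r.length ≤ 2 ∧ ∀ w ∈ r, w < X := by
  intro r hr
  obtain ⟨-, h1, h2, -⟩ := h
  unfold Item.toRecord at hr
  split_ifs at hr <;> simp only [Option.mem_def, Option.some.injEq, reduceCtorEq] at hr <;> subst hr
  · simpa using (Nat.lt_succ_self _).trans h2
  · simpa using ⟨(Nat.lt_succ_self _).trans h1, (Nat.lt_succ_self _).trans h2⟩

theorem Item.Small.toLabel_lt {X : ℕ} {it : Item} (h : it.Small X) :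
    ∀ r ∈ it.toLabel, r.length ≤ 2 ∧ ∀ w ∈ r, w < X := by
  intro r hr
  obtain ⟨-, h1, -, -, h4⟩ := h
  unfold Item.toLabel at hr
  split_ifs at hr <;> simp only [Option.mem_def, Option.some.injEq, reduceCtorEq] at hr
  subst hr
  refine ⟨by simp, fun w hw => ?_⟩
  simp only [List.mem_pair] at hw
  omega

theorem nonempty_fin_splitting {k n : ℕ} (hk : 0 < k) : Nonempty (Fin (2 * k * 2 ^ bits k n)) :=
  ⟨⟨0, by positivity⟩⟩

/-- The program for the contracted graph. -/
noncomputable def constructProgram {k : ℕ} (hk : 0 < k) (c : ℝ) (n m : ℕ) :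
    Program (machineCount k n m) :=
  haveI := nonempty_fin_splitting (n := n) hk
  Program.ofSteps
    (constructSteps (Classical.choose (exists_splitting_family k (bits k n))) ((n + 2) ^ (0 + 1))
      (base_pos (k := k) (n := n)) (3 * k * (0 + 1)) (machineCount k n m) (2 * k) (fan k n m)
      (capacity k n) (phaseCount k c n))
    fun _ st => (unpack st.memory : List Item).filterMap Item.toRecord

/-- The program that transfers a connectivity solution with labels below `(n + 2) ^ a`. -/
noncomputable def transferProgram (k a n m : ℕ) : Program (machineCount k n m) :=
  Program.ofSteps
    (transferSteps ((n + 2) ^ (a + 1)) (base_pos (k := k) (n := n)) (3 * k * (a + 1))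
      (machineCount k n m) (2 * k) (fan k n m) (capacity k n))
    fun _ st => (unpack st.memory : List Item).filterMap Item.toLabel

/-- The rounds of a phase of `constructProgram`. -/
def phaseRounds (k : ℕ) : ℕ := 2 * (3 * k * (2 * k + 3)) + 3 * (2 * k + 1)

/-- The rounds of `constructProgram` outside of the phases. -/
def outerRounds (k : ℕ) : ℕ :=
  1 + (2 * k + 3) + (2 * k + 1) + (3 * k * (2 * k + 3) + (2 * k + 1))

theorem rounds_constructProgram_le {k : ℕ} (hk : 0 < k) (c : ℝ) (n m : ℕ) :
    ((constructProgram hk c n m).rounds : ℝ) ≤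
      ((outerRounds k + (⌈4 * k * (|c| + 1)⌉₊ + 1) * phaseRounds k : ℕ) : ℝ) *
        max 1 (Real.log (Real.log n)) := by
  have h1 : (constructProgram hk c n m).rounds = outerRounds k + phaseCount k c n * phaseRounds k := by
    simp only [constructProgram, Program.ofSteps, length_constructSteps, outerRounds, phaseRounds]
    ring
  have h2 := phaseCount_le k c n
  have h3 : (1 : ℝ) ≤ max 1 (Real.log (Real.log n)) := le_max_left _ _
  have h4 := mul_le_mul_of_nonneg_right h2 (Nat.cast_nonneg (α := ℝ) (phaseRounds k))
  have h5 := mul_le_mul_of_nonneg_left h3 (Nat.cast_nonneg (α := ℝ) (outerRounds k))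
  rw [h1]
  push_cast at h4 ⊢
  linarith

theorem rounds_transferProgram (k a n m : ℕ) : (transferProgram k a n m).rounds =
    1 + (3 * k * (a + 1) * (2 * k + 3) + (2 * k + 1)) := by
  simp only [transferProgram, Program.ofSteps, length_transferSteps]

/-! ### Correctness of the two programs -/

section specification

variable {k n m : ℕ} {c : ℝ} {G : SimpleGraph (Fin n)}

theorem constructProgram_spec (hk : 0 < k) (hn : 0 < n) (hm : m = G.edgeSet.ncard)
    {D : Fin (machineCount k n m) → List Record}
    (hD : StoresGraph (fun v : Fin n => (v : ℕ)) G D) (hDS : ∀ i, recordsSize (D i) ≤ space k n) :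
    (constructProgram hk c n m).Respects (space k n) ((n + 2) ^ (2 * exponent k 0))
        (inputStates D) ∧
      ∃ H ρ L, ∃ l : Fin (machineCount k n m) → List Item, Tracks G H ρ ∧ Represents H ρ L ∧
        (List.finRange _).flatMap l = L ∧ (∀ i, (l i).length ≤ capacity k n) ∧
        (4 * k) ^ phaseCount k c n * H.support.ncard ≤ (4 * k - 1) ^ phaseCount k c n * n ∧
        StoresGraph (fun v : H.verts => ((v : Fin n) : ℕ)) H.coe
          ((constructProgram hk c n m).result (inputStates D)) ∧
        (constructProgram hk c n m).final (inputStates D) = canon l := by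
  have := nonempty_fin_splitting (n := n) hk
  have hm2 : 2 * m ≤ n * n := hm ▸ two_mul_ncard_edgeSet_le G
  have hS := sizes hk hn hm2 0
  have hb := two_le_base (k := k) (n := n)
  have h6 := capacity_le_space_div hk hn
  -- The local space is chosen odd so that a full input of `S / 2` items, packed into one record,
  -- leaves a unit for the delimiter.
  have hodd : 2 * (space k n / 2) + 1 ≤ space k n := by
    have h1 : space k n = 2 * ((8 * k + 2) * base k n ^ 2) + 1 := by
      rw [space, if_neg hn.ne', mul_assoc]
    omega
  obtain ⟨H, ρ, L, l, hG, hL, hnd, hl, hlc, hsupp, hrun⟩ := runs_construct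
    (Classical.choose (exists_splitting_family k (bits k n))) (N := 2 ^ (k * bits k n)) (k := k)
    (X := (n + 2) ^ (0 + 1)) (p := 3 * k * (0 + 1)) hS base_pos (by nlinarith) (by nlinarith)
    (by change 2 * k * base k n ≤ _; exact Nat.mul_le_mul_right _ (by omega)) (entry_le k 0)
    (by positivity) (key_le hk 0) (by simp)
    -- The splitting family separates numbers of `k * bits k n` bits, which includes all
    -- identifiers.
    (by
      have h1 := le_base_pow (n := n) hk
      rw [base, ← pow_mul, mul_comm] at h1
      omega)
    (Classical.choose_spec (exists_splitting_family k (bits k n))) hD hDS hodd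
    (by have := le_fan_pow (n := n) (m := m) hk; omega) (phaseCount k c n)
  have hfinal := hrun.final fun _ st => (unpack st.memory : List Item).filterMap Item.toRecord
  refine ⟨?_, H, ρ, L, l, hG, hL, hl, hlc, hsupp, ?_, hfinal⟩
  · refine hrun.respects fun i => ?_
    simp only [canon, unpack_pack]
    refine fits_filterMap (fun it hit r hr => ?_) (by have := hlc i; omega)
    have hsm := hL.small (X := n + 1) (by omega)
      (hl ▸ List.mem_flatMap.2 ⟨i, List.mem_finRange i, hit⟩)
    refine ⟨(hsm.toRecord_lt r hr).1, fun w hw => ((hsm.toRecord_lt r hr).2 w hw).trans_le ?_⟩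
    exact (show n + 1 ≤ n + 2 by omega).trans
      (Nat.le_self_pow (by unfold exponent; omega) _)
  · refine hL.storesGraph hG hnd ?_
    rw [← hl, List.filterMap_flatMap, gather]
    congr 1
    funext i
    change ((unpack ((constructProgram hk c n m).final (inputStates D) i).memory : List Item)).filterMap
      Item.toRecord = _
    rw [show (constructProgram hk c n m).final (inputStates D) = canon l from hfinal]
    simp only [canon, unpack_pack]

theorem transferProgram_spec {a : ℕ} (hk : 0 < k) (hn : 0 < n) (hm : m = G.edgeSet.ncard)
    {H : SubsetGraph (Fin n)} {ρ : Fin n → Fin n} (hG : Tracks G H ρ) {L : List Item}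
    (hL : Represents H ρ L) {l : Fin (machineCount k n m) → List Item}
    (hl : (List.finRange _).flatMap l = L) (hlc : ∀ i, (l i).length ≤ capacity k n)
    {cc : H.verts → ℕ} (hcc : ∀ v, cc v < (n + 2) ^ a)
    {E : Fin (machineCount k n m) → List Record}
    (hE : StoresFunction (fun v : H.verts => ((v : Fin n) : ℕ)) cc E)
    (hES : ∀ i, recordsSize (E i) ≤ space k n) :
    (transferProgram k a n m).Respects (space k n) ((n + 2) ^ (2 * exponent k a))
        (resumeStates (canon l) E) ∧
      StoresFunction (fun v : Fin n => (v : ℕ)) (fun v => cc ⟨ρ v, hG.mem v⟩)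
        ((transferProgram k a n m).result (resumeStates (canon l) E)) := by
  have hm2 : 2 * m ≤ n * n := hm ▸ two_mul_ncard_edgeSet_le G
  have hS := sizes hk hn hm2 a
  have hb := two_le_base (k := k) (n := n)
  have h6 := capacity_le_space_div hk hn
  have hpos : 0 < (n + 2) ^ a := by positivity
  obtain ⟨l', hlc', hsm, hst, hrun⟩ := runs_transfer (X := (n + 2) ^ (a + 1))
    (p := 3 * k * (a + 1)) hS base_pos (by nlinarith) (by nlinarith) (entry_le k a)
    (by positivity) (key_le hk a) (Nat.le_self_pow (Nat.succ_ne_zero a) _) h6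
    (by have := le_fan_pow (n := n) (m := m) hk; omega) hG hL hl hlc
    (fun v => by have := hcc v; rw [pow_succ]; nlinarith) hE hES
  have hfinal := hrun.final fun _ st => (unpack st.memory : List Item).filterMap Item.toLabel
  refine ⟨?_, ?_⟩
  · refine hrun.respects fun i => ?_
    simp only [canon, unpack_pack]
    refine fits_filterMap (fun it hit r hr => ?_) (by have := hlc' i; omega)
    have h := (hsm i it hit).toLabel_lt r hr
    refine ⟨h.1, fun w hw => (h.2 w hw).trans_le ?_⟩
    exact Nat.pow_le_pow_right (by omega) (by unfold exponent; omega)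
  · convert hst using 1
    funext i
    change ((unpack ((transferProgram k a n m).final (resumeStates (canon l) E) i).memory :
      List Item)).filterMap Item.toLabel = _
    rw [show (transferProgram k a n m).final (resumeStates (canon l) E) = canon l' from hfinal]
    simp only [canon, unpack_pack]

end specification

/-- With no vertices, the least admissible fan is 0, so there are no machines and all requirements
on them hold vacuously. -/
theorem isEmpty_fin_machineCount {k : ℕ} (hk : 0 < k) : IsEmpty (Fin (machineCount k 0 0)) := by
  have h : fan k 0 0 = 0 := Nat.sInf_eq_zero.2 (Or.inl (by simp))
  rw [machineCount, h, zero_pow (by omega)]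
  infer_instance

theorem Program.respects_of_isEmpty {M : ℕ} [IsEmpty (Fin M)] (P : Program M) (S W : ℕ)
    (s : Fin M → LocalState) : P.Respects S W s :=
  ⟨fun _ _ i => isEmptyElim i, fun _ _ i => isEmptyElim i, fun _ _ i => isEmptyElim i,
    fun i => isEmptyElim i⟩

theorem gather_of_isEmpty {M : ℕ} [h : IsEmpty (Fin M)] (D : Fin M → List Record) :
    gather D = [] :=
  List.eq_nil_iff_forall_not_mem.2 fun r hr => by
    obtain ⟨i, -⟩ := List.mem_flatMap.1 hr
    exact h.elim i

theorem storesGraph_of_isEmpty {M : ℕ} {V : Type} [IsEmpty (Fin M)] [IsEmpty V] (ident : V → ℕ)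
    (G : SimpleGraph V) (D : Fin M → List Record) : StoresGraph ident G D := by
  simp [StoresGraph, gather_of_isEmpty]

theorem storesFunction_of_isEmpty {M : ℕ} {V : Type} [IsEmpty (Fin M)] [IsEmpty V]
    (ident : V → ℕ) (f : V → ℕ) (D : Fin M → List Record) : StoresFunction ident f D := by
  simp [StoresFunction, gather_of_isEmpty]

theorem support_eq_empty {n : ℕ} (hn : n ≤ 1) (H : SubsetGraph (Fin n)) : H.support = ∅ := by
  have := Fin.subsingleton_iff_le_one.2 hn
  refine Set.eq_empty_of_forall_notMem fun u hu => ?_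
  obtain ⟨v, huv⟩ := hu
  exact (H.adj_sub huv).ne (Subsingleton.elim u v)

end MPC

/-! ### The main theorem -/

open MPC in
theorem mainTheorem7 (δ : ℝ) (hδ : 0 < δ) (c : ℝ) :
    -- For graphs with `n` vertices and `m` edges, `S n m` is the local space, `M n m` the number of
    -- machines, `(n + 2) ^ K` the word bound, and `P n m` the program for the contracted graph.
    ∃ (K : ℕ) (S M : ℕ → ℕ → ℕ) (P : ∀ n m : ℕ, MPC.Program (M n m)),
      -- For labels below `(n + 2) ^ a`, i.e. of `O(log n)` bits, `Q n m` is the program that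
      -- transforms the connectivity solutions, with word bound `(n + 2) ^ L`.
      ∀ a : ℕ, ∃ (L : ℕ) (Q : ∀ n m : ℕ, MPC.Program (M n m)),
      ∀ (n : ℕ) (G : SimpleGraph (Fin n)) (m : ℕ), m = G.edgeSet.ncard →
        -- local space `O(n ^ δ)`, global space `O(n + m)`
        ((S n m : ℝ) ≤ K * (n : ℝ) ^ δ) ∧
        (S n m * M n m ≤ K * (n + m)) ∧
        -- every machine has room for `S / 3` records of at most two words: the input does fit
        (n + m ≤ M n m * (S n m / 3)) ∧
        -- `O(log log n)` rounds
        (((P n m).rounds : ℝ) ≤ K * max 1 (Real.log (Real.log n))) ∧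
        (((Q n m).rounds : ℝ) ≤ L * max 1 (Real.log (Real.log n))) ∧
        -- for every distribution of the input graph among the machines
        ∀ D : Fin (M n m) → List MPC.Record,
          MPC.StoresGraph (fun v : Fin n => (v : ℕ)) G D →
          (∀ i, MPC.recordsSize (D i) ≤ S n m) →
          (P n m).Respects (S n m) ((n + 2) ^ K) (MPC.inputStates D) ∧
          ∃ H : SubsetGraph (Fin n),
            G.toSubsetGraph.IsContraction H ∧
            (H.support.ncard : ℝ) ≤ n / Real.log n ^ c ∧
            MPC.StoresGraph (fun v : H.verts => ((v : Fin n) : ℕ)) H.coe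
              ((P n m).result (MPC.inputStates D)) ∧
            -- for every solution for `H`, and every distribution of it among the machines
            ∀ (cc : H.verts → ℕ) (E : Fin (M n m) → List MPC.Record),
              IsConnectivitySolution H.coe cc →
              (∀ v, cc v < (n + 2) ^ a) →
              MPC.StoresFunction (fun v : H.verts => ((v : Fin n) : ℕ)) cc E →
              (∀ i, MPC.recordsSize (E i) ≤ S n m) →
              (Q n m).Respects (S n m) ((n + 2) ^ L)
                (MPC.resumeStates ((P n m).final (MPC.inputStates D)) E) ∧
              ∃ cc' : Fin n → ℕ,
                IsConnectivitySolution G cc' ∧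
                MPC.StoresFunction (fun v : Fin n => (v : ℕ)) cc'
                  ((Q n m).result
                    (MPC.resumeStates ((P n m).final (MPC.inputStates D)) E)) := by
  -- The local space is of order `n ^ (2 / k)`, so `k` must be at least `2 / δ`.
  obtain ⟨k, hk2, hkδ⟩ : ∃ k : ℕ, 2 ≤ k ∧ 2 / (k : ℝ) ≤ δ := by
    obtain ⟨j, hj⟩ := exists_nat_ge (2 / δ)
    refine ⟨max 2 j, le_max_left _ _, ?_⟩
    have h1 : (2 / δ : ℝ) ≤ (max 2 j : ℕ) := hj.trans (by exact_mod_cast le_max_right 2 j)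
    have h2 : (0 : ℝ) < (max 2 j : ℕ) := lt_of_lt_of_le (by positivity) h1
    rw [div_le_iff₀ hδ] at h1
    rw [div_le_iff₀ h2, mul_comm]
    exact h1
  have hk : 0 < k := by omega
  set K₁ := (16 * k + 5) * (2 ^ (k + 1) * 3) with hK₁
  set K₂ := (16 * k + 5) * (2 ^ (k + 1) * 3 + 2 ^ (2 * k) * 2) with hK₂
  set K₃ := outerRounds k + (⌈4 * k * (|c| + 1)⌉₊ + 1) * phaseRounds k with hK₃
  set K := K₁ + K₂ + K₃ + 2 * exponent k 0 with hK
  refine ⟨K, fun n _ => space k n, machineCount k, constructProgram hk c, fun a => ?_⟩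
  -- The transfer takes a constant number of rounds, independent of `n`; only the construction needs
  -- the factor `log log n`.
  set R := 1 + (3 * k * (a + 1) * (2 * k + 3) + (2 * k + 1)) with hR
  refine ⟨R + 2 * exponent k a, transferProgram k a, fun n G m hm => ?_⟩
  have hmx : (1 : ℝ) ≤ max 1 (Real.log (Real.log n)) := le_max_left _ _
  have hm2 : 2 * m ≤ n * n := hm ▸ two_mul_ncard_edgeSet_le G
  have hm0 : n = 0 → m = 0 := fun h => by
    rw [h] at hm2
    omega
  have hmono : ∀ {x y : ℕ} {z : ℝ}, x ≤ y → 0 ≤ z → (x : ℝ) * z ≤ y * z := fun h hz =>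
    mul_le_mul_of_nonneg_right (by exact_mod_cast h) hz
  have hrespects : ∀ {P : Program (machineCount k n m)} {s : Fin (machineCount k n m) → LocalState}
      {x y : ℕ}, P.Respects (space k n) ((n + 2) ^ x) s → x ≤ y →
      P.Respects (space k n) ((n + 2) ^ y) s := fun h hxy =>
    have hW := Nat.pow_le_pow_right (show 0 < n + 2 by omega) hxy
    ⟨fun t ht i => (h.memory t ht i).mono le_rfl hW, fun t ht i => (h.received t ht i).mono le_rfl hW,
      fun t ht i => (h.sent t ht i).mono le_rfl hW, fun i => (h.output i).mono le_rfl hW⟩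
  refine ⟨(space_le_rpow hδ hk2 hkδ).trans (hmono (by omega) (by positivity)),
    (space_mul_machineCount_le hk2 hm0).trans (Nat.mul_le_mul_right _ (by omega)),
    add_le_machineCount_mul hk hm0,
    (rounds_constructProgram_le hk c n m).trans (hmono (by omega) (by linarith)), ?_,
    fun D hD hDS => ?_⟩
  · rw [rounds_transferProgram]
    refine le_trans ?_ (hmono (show R ≤ _ by omega) (by linarith))
    nlinarith [Nat.cast_nonneg (α := ℝ) R]
  rcases Nat.eq_zero_or_pos n with rfl | hn
  · obtain rfl := hm0 rfl
    have := isEmpty_fin_machineCount hk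
    refine ⟨Program.respects_of_isEmpty _ _ _ _, G.toSubsetGraph, Relation.ReflTransGen.refl, ?_,
      storesGraph_of_isEmpty _ _ _, fun cc E _ _ _ _ => ⟨Program.respects_of_isEmpty _ _ _ _,
        isEmptyElim, fun u => isEmptyElim u, storesFunction_of_isEmpty _ _ _⟩⟩
    simp [support_eq_empty]
  · obtain ⟨hP, H, ρ, L, l, hG, hL, hl, hlc, hsupp, hst, hfinal⟩ :=
      constructProgram_spec (c := c) hk hn hm hD hDS
    refine ⟨hrespects hP (by omega), H, hG.contraction,
      support_le_of_phases hk (fun h => support_eq_empty h H) hsupp, hst,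
      fun cc E hcc hlt hE hES => ?_⟩
    obtain ⟨hQ, hQst⟩ := transferProgram_spec (a := a) hk hn hm hG hL hl hlc hlt hE hES
    rw [hfinal]
    exact ⟨hrespects hQ (by omega), _, hG.isConnectivitySolution hcc, hQst⟩
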